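/- Let $a_1,a_2,b_1\in\mathbb{Q}$ and let $\mathbb{H}=\mathbb{H}(a_1,a_2;b_1,1)$ be the rank-two local system on $\mathbb{P}^1(\mathbb{C})\setminus\{0,1,\infty\}$ of local holomorphic solutions of the hypergeometric differential equation $$\Big[(z\partial_z+b_1-1)\,z\partial_z \;-\; z\,(z\partial_z+a_1)(z\partial_z+a_2)\Big]f=0 .$$ Let $\rho\colon \pi_1(\mathbb{P}^1(\mathbb{C})\setminus\{0,1,\infty\},x_0)\to \mathrm{GL}(\mathbb{H}_{x_0})$ be its monodromy representation at a base point $x_0$, and let $$F=\mathbb{Q}\big(\{\operatorname{tr}\,\mathrm{ad}(\rho)(\gamma) : \gamma\in\pi_1\}\big)\subset\mathbb{C}$$ be its adjoint trace field, where $\mathrm{ad}(\rho)$ is the action on $\mathrm{End}(\mathbb{H}_{x_0})$ by $A\mapsto\rho(\gamma)A\rho(\gamma)^{-1}$. Assume that $\mathbb{H}$ is irreducible. Then: 1. $F$ is contained in a cyclotomic field, that is, $F\subset\mathbb{Q}(e^{2\pi i/n})$ for some integer $n\ge 1$. 2. $F\neq\mathbb{Q}(\sqrt{D})$ for every odd squarefree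 integer $D\ge 7$. -/

import Mathlib

noncomputable section

namespace HypLocSys

/-- The operator `∏_{c ∈ cs} (z∂_z + c)` acting on functions of one complex variable. -/
def eulerProd (cs : List ℂ) (f : ℂ → ℂ) : ℂ → ℂ :=
  cs.foldr (fun c g z => z * deriv g z + c * g z) f

/-- The hypergeometric differential operator
`Hyp(a;b) = ∏_i (z∂_z + b_i - 1) - z ∏_j (z∂_z + a_j)`. -/
def hyp (a b : List ℚ) (f : ℂ → ℂ) : ℂ → ℂ := fun z =>
  eulerProd (b.map fun q => (q : ℂ) - 1) f z - z * eulerProd (a.map fun q => (q : ℂ)) f z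

/-- `ℙ¹ ∖ {0, 1, ∞}`, that is, the complex plane without `0` and `1`. -/
abbrev Base : Type := ↥({0, 1}ᶜ : Set ℂ)

/-- `f` is a holomorphic solution of `Hyp(a;b) f = 0` on the open set `U`. -/
def IsSolOn (a b : List ℚ) (U : Set ℂ) (f : ℂ → ℂ) : Prop :=
  DifferentiableOn ℂ f U ∧ ∀ z ∈ U, hyp a b f z = 0

theorem differentiableOn_eulerProd {U : Set ℂ} (hU : IsOpen U) (cs : List ℂ) {f : ℂ → ℂ}
    (hf : DifferentiableOn ℂ f U) : DifferentiableOn ℂ (eulerProd cs f) U := by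
  induction cs with
  | nil => exact hf
  | cons c cs ih =>
    exact (differentiableOn_id.mul (ih.deriv hU)).add ((differentiableOn_const c).mul ih)

theorem eulerProd_add {U : Set ℂ} (hU : IsOpen U) (cs : List ℂ) {f g : ℂ → ℂ}
    (hf : DifferentiableOn ℂ f U) (hg : DifferentiableOn ℂ g U) :
    Set.EqOn (eulerProd cs (f + g)) (eulerProd cs f + eulerProd cs g) U := by
  induction cs with
  | nil => exact fun _ _ => rfl
  | cons c cs ih =>
    intro z hz
    have h1 := (ih.eventuallyEq_of_mem (hU.mem_nhds hz)).deriv_eq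
    have h2 := ((differentiableOn_eulerProd hU cs hf).differentiableAt (hU.mem_nhds hz))
    have h3 := ((differentiableOn_eulerProd hU cs hg).differentiableAt (hU.mem_nhds hz))
    have h4 := ih hz
    rw [deriv_add h2 h3] at h1
    change z * deriv (eulerProd cs (f + g)) z + c * eulerProd cs (f + g) z
      = (z * deriv (eulerProd cs f) z + c * eulerProd cs f z)
        + (z * deriv (eulerProd cs g) z + c * eulerProd cs g z)
    rw [h1, h4, Pi.add_apply]
    ring

theorem eulerProd_smul (cs : List ℂ) (k : ℂ) (f : ℂ → ℂ) :
    eulerProd cs (k • f) = k • eulerProd cs f := by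
  induction cs with
  | nil => rfl
  | cons c cs ih =>
    funext z
    change z * deriv (eulerProd cs (k • f)) z + c * eulerProd cs (k • f) z
      = k * (z * deriv (eulerProd cs f) z + c * eulerProd cs f z)
    rw [ih, deriv_const_smul_field]
    simp only [Pi.smul_apply, smul_eq_mul]
    ring

theorem IsSolOn.add {a b : List ℚ} {U : Set ℂ} (hU : IsOpen U) {f g : ℂ → ℂ}
    (hf : IsSolOn a b U f) (hg : IsSolOn a b U g) : IsSolOn a b U (f + g) := by
  refine ⟨hf.1.add hg.1, fun z hz => ?_⟩
  have h1 := hf.2 z hz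
  have h2 := hg.2 z hz
  simp only [hyp] at h1 h2 ⊢
  rw [eulerProd_add hU _ hf.1 hg.1 hz, eulerProd_add hU _ hf.1 hg.1 hz, Pi.add_apply, Pi.add_apply]
  linear_combination h1 + h2

theorem IsSolOn.smul {a b : List ℚ} {U : Set ℂ} {f : ℂ → ℂ} (k : ℂ)
    (hf : IsSolOn a b U f) : IsSolOn a b U (k • f) := by
  refine ⟨hf.1.const_smul k, fun z hz => ?_⟩
  have h1 := hf.2 z hz
  simp only [hyp] at h1 ⊢
  rw [eulerProd_smul, eulerProd_smul, Pi.smul_apply, Pi.smul_apply, smul_eq_mul, smul_eq_mul]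
  linear_combination k * h1

theorem IsSolOn.mono {a b : List ℚ} {U V : Set ℂ} {f : ℂ → ℂ} (h : V ⊆ U)
    (hf : IsSolOn a b U f) : IsSolOn a b V f :=
  ⟨hf.1.mono h, fun z hz => hf.2 z (h hz)⟩

/-- The points of the universal cover of `ℙ¹ ∖ {0,1,∞}` are the homotopy classes of paths `c` that
start at the base point `x₀`. A function `F` on the universal cover is a (multivalued) solution of
`Hyp(a;b)` if around each point `c` it is a holomorphic solution of the differential equation in
the coordinate `z`: on a disc around the endpoint of `c`, prolonging `c` inside the disc to `w`
gives the value at `w` of a holomorphic solution `f` on the disc. -/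
def IsMultivaluedSol (a b : List ℚ) (x₀ : Base) (F : (y : Base) → Path.Homotopic.Quotient x₀ y → ℂ) : Prop :=
  ∀ (y : Base) (c : Path.Homotopic.Quotient x₀ y), ∃ r : ℝ, 0 < r ∧ ∃ f : ℂ → ℂ,
    IsSolOn a b (Metric.ball (y : ℂ) r) f ∧
    ∀ (w : Base) (δ : Path y w), (∀ t, (δ t : ℂ) ∈ Metric.ball (y : ℂ) r) →
      F w (c.trans (Path.Homotopic.Quotient.mk δ)) = f w

/-- The fibre at `x₀` of the hypergeometric local system `ℍ(a;b)`, realized as the space of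
solutions of `Hyp(a;b)` on the universal cover (germs of solutions at `x₀` together with all their
analytic continuations). -/
def solSpace (a b : List ℚ) (x₀ : Base) :
    Submodule ℂ ((y : Base) → Path.Homotopic.Quotient x₀ y → ℂ) where
  carrier := {F | IsMultivaluedSol a b x₀ F}
  zero_mem' := by
    intro y c
    refine ⟨1, one_pos, (0 : ℂ) • (0 : ℂ → ℂ), ⟨?_, ?_⟩, ?_⟩
    · rw [zero_smul]
      exact differentiableOn_const 0
    · intro z _
      simp only [hyp, eulerProd_smul]
      simp
    · intro w δ _
      simp
  add_mem' := by
    intro F G hF hG y c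
    obtain ⟨r, hr, f, hf, hFf⟩ := hF y c
    obtain ⟨s, hs, g, hg, hGg⟩ := hG y c
    refine ⟨min r s, lt_min hr hs, f + g, IsSolOn.add Metric.isOpen_ball
      (hf.mono (Metric.ball_subset_ball (min_le_left r s)))
      (hg.mono (Metric.ball_subset_ball (min_le_right r s))), ?_⟩
    intro w δ hδ
    have h1 := hFf w δ fun t => Metric.ball_subset_ball (min_le_left r s) (hδ t)
    have h2 := hGg w δ fun t => Metric.ball_subset_ball (min_le_right r s) (hδ t)
    simp only [Pi.add_apply, h1, h2]
  smul_mem' := by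
    intro k F hF y c
    obtain ⟨r, hr, f, hf, hFf⟩ := hF y c
    refine ⟨r, hr, k • f, hf.smul k, ?_⟩
    intro w δ hδ
    simp only [Pi.smul_apply, hFf w δ hδ]

/-- The monodromy representation of the local system `ℍ(a;b)`: a loop `g` at `x₀` acts on the
solutions on the universal cover by `(g F)(c) = F(g · c)` (first run through `g`, then through
`c`), that is, by analytic continuation along `g`. -/
def monodromy (a b : List ℚ) (x₀ : Base) :
    Representation ℂ (FundamentalGroup Base x₀) (solSpace a b x₀) where
  toFun g :=
    { toFun := fun F => ⟨fun y c => F.1 y ((FundamentalGroup.toPath g).trans c), by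
        intro y c
        obtain ⟨r, hr, f, hf, hFf⟩ := F.2 y ((FundamentalGroup.toPath g).trans c)
        refine ⟨r, hr, f, hf, fun w δ hδ => ?_⟩
        have h := hFf w δ hδ
        rw [Path.Homotopic.Quotient.trans_assoc] at h
        exact h⟩
      map_add' := fun _ _ => rfl
      map_smul' := fun _ _ => rfl }
  map_one' := by
    ext F : 1
    apply Subtype.ext
    funext y c
    exact congrArg (F.1 y) (Path.Homotopic.Quotient.refl_trans c)
  map_mul' g h := by
    ext F : 1
    apply Subtype.ext
    funext y c
    exact congrArg (F.1 y) (Path.Homotopic.Quotient.trans_assoc (FundamentalGroup.toPath h)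
      (FundamentalGroup.toPath g) c)

/-- The trace field of a complex representation: the subfield of `ℂ` generated over `ℚ` by the
traces of all group elements. -/
def traceField {G V : Type*} [Group G] [AddCommGroup V] [Module ℂ V]
    (ρ : Representation ℂ G V) : IntermediateField ℚ ℂ :=
  IntermediateField.adjoin ℚ (Set.range fun g : G => LinearMap.trace ℂ V (ρ g))

/-- The adjoint trace field: the trace field of the adjoint representation `ad(ρ)` on `End(V)`,
where `g` acts by `A ↦ ρ(g) A ρ(g)⁻¹`. -/
def adjointTraceField {G V : Type*} [Group G] [AddCommGroup V] [Module ℂ V]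
    (ρ : Representation ℂ G V) : IntermediateField ℚ ℂ :=
  traceField (Representation.linHom ρ ρ)

end HypLocSys

end

/-! The trace of `ad(ρ)(γ)` is `tr ρ(γ⁻¹) · tr ρ(γ)`, so `F` is governed by traces in rank two. A
solution is determined by its value and derivative at one point, hence the solution space has
dimension at most 2. In dimension at most 1 the endomorphisms commute, `ad(ρ)` is trivial and `F =
ℚ`.

In dimension 2, the fundamental group is generated by loops around `0` and `1`
(`subgroup_eq_top_of_realLoop_mem`). In a coordinate `s` with `s ↦ s + 2πi` turning around the
puncture, every puncture looks like the origin of some hypergeometric equation. There a power series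
solution gives one eigenvalue of the local monodromy and the Wronskian gives its determinant
(`local_monodromy`, `PunctureChart.monodromy_eigenvalue_det`). With `e(q) = exp(2πiq)`, the two
generators and their product have eigenvalues `1, e(-b₁)`; `1, e(b₁-a₁-a₂)`; `e(-a₁), e(-a₂)`.

By Fricke's argument, traces and determinants of two generators together with the trace of their
product control all traces, and the generators may be rescaled because scalars do not act under `ad`
(`adjointTraceField_le`). Without rescaling this puts `F` into a cyclotomic field containing the six
eigenvalues.

Suppose `F = ℚ(√D)`. For each of the three elements, `tr²/det = 2 + 2cos(2πq)` with `q` rational,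
and this lies in `F`. The bounds on trace and norm of an algebraic integer all of whose conjugates
lie in `[-2, 2]` force it to be an integer between `0` and `4` (`two_cos_mem_quadratic`). After
division by a square root of the determinant, the three traces are therefore square roots of `0, 1,
2, 3, 4`, so `F ⊆ ℚ(√2, √3)`. But `D` has a prime factor at least 5, so `√D` is not in that field
(`sqrt_not_mem_sqrtField`). -/

noncomputable section

namespace HypLocSys

open Topology Filter

/-! ### Path classes through simply connected spaces -/

section PathClasses

variable {S T X : Type*} [TopologicalSpace S] [TopologicalSpace T] [TopologicalSpace X]

theorem map_trans_class {s s' s'' : S} (f : C(S, X)) (p : Path.Homotopic.Quotient s s')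
    (q : Path.Homotopic.Quotient s' s'') : (p.trans q).map f = (p.map f).trans (q.map f) := by
  induction p using Path.Homotopic.Quotient.ind
  induction q using Path.Homotopic.Quotient.ind
  rw [← Path.Homotopic.Quotient.mk_trans, ← Path.Homotopic.Quotient.mk_map,
    ← Path.Homotopic.Quotient.mk_map, ← Path.Homotopic.Quotient.mk_map,
    ← Path.Homotopic.Quotient.mk_trans, Path.map_trans]

variable [SimplyConnectedSpace S] [SimplyConnectedSpace T]

/-- The class of the image under `ψ` of any path from `s` to `s'` in a simply connected space. -/
def pathClass (ψ : C(S, X)) (s s' : S) : Path.Homotopic.Quotient (ψ s) (ψ s') :=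
  (Path.Homotopic.Quotient.mk (PathConnectedSpace.somePath s s')).map ψ

/-- Simple connectedness of `S` leaves a single class from `s` to `s'`, so the arbitrary choice in
`pathClass` is harmless. -/
theorem map_eq_pathClass (ψ : C(S, X)) {s s' : S} (δ : Path.Homotopic.Quotient s s') :
    δ.map ψ = pathClass ψ s s' :=
  congrArg (fun ε => Path.Homotopic.Quotient.map ε ψ) (Subsingleton.elim _ _)

theorem mk_map_eq_pathClass (ψ : C(S, X)) {s s' : S} (δ : Path s s') :
    Path.Homotopic.Quotient.mk (δ.map ψ.continuous) = pathClass ψ s s' :=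
  map_eq_pathClass ψ (Path.Homotopic.Quotient.mk δ)

@[simp]
theorem pathClass_trans (ψ : C(S, X)) (s s' s'' : S) :
    (pathClass ψ s s').trans (pathClass ψ s' s'') = pathClass ψ s s'' := by
  rw [pathClass, pathClass, ← map_trans_class, map_eq_pathClass]

@[simp]
theorem pathClass_self (ψ : C(S, X)) (s : S) :
    pathClass ψ s s = Path.Homotopic.Quotient.refl (ψ s) := by
  rw [← map_eq_pathClass ψ (Path.Homotopic.Quotient.refl s)]
  rfl

theorem pathClass_comp (ψ : C(T, X)) (φ : C(S, T)) (s s' : S) :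
    pathClass (ψ.comp φ) s s' = pathClass ψ (φ s) (φ s') := by
  rw [← map_eq_pathClass ψ (pathClass φ s s')]
  rw [pathClass, pathClass, Path.Homotopic.Quotient.map_comp]

theorem exists_path_in_nhds [LocallyPathConnectedSpace S] (ψ : C(S, X)) (s : S) {N : Set X}
    (hN : N ∈ 𝓝 (ψ s)) : ∃ M ∈ 𝓝 s, ∀ s' ∈ M, ∃ δ : Path (ψ s) (ψ s'),
      (∀ t, δ t ∈ N) ∧ Path.Homotopic.Quotient.mk δ = pathClass ψ s s' := by
  have h1 : ψ ⁻¹' N ∈ 𝓝 s := ψ.continuous.continuousAt hN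
  refine ⟨_, pathComponentIn_mem_nhds h1, fun s' hs' => ?_⟩
  obtain ⟨δ, hδ⟩ := hs'
  exact ⟨δ.map ψ.continuous, hδ, mk_map_eq_pathClass ψ δ⟩

instance : LocallyPathConnectedSpace unitInterval :=
  (convex_Icc (0 : ℝ) 1).locallyPathConnectedSpace

instance : SimplyConnectedSpace unitInterval :=
  have := (convex_Icc (0 : ℝ) 1).contractibleSpace ⟨0, by simp⟩
  SimplyConnectedSpace.ofContractible _

/-- A property of path classes starting at `x` which is locally constant along paths and holds for
one class holds for all of them. -/
theorem path_induction {x : X} (Q : ∀ w, Path.Homotopic.Quotient x w → Prop)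
    (hloc : ∀ w c, ∃ N ∈ 𝓝 w, ∀ w' (δ : Path w w'), (∀ t, δ t ∈ N) →
      (Q w c ↔ Q w' (c.trans (Path.Homotopic.Quotient.mk δ))))
    {y : X} (c : Path.Homotopic.Quotient x y) (hc : Q y c) (w : X)
    (c' : Path.Homotopic.Quotient x w) : Q w c' := by
  have key : ∀ (ψ : C(unitInterval, X)) (c : Path.Homotopic.Quotient x (ψ 0)), Q (ψ 0) c →
      Q (ψ 1) (c.trans (pathClass ψ 0 1)) := by
    intro ψ c hc
    let R : unitInterval → Prop := fun t => Q (ψ t) (c.trans (pathClass ψ 0 t))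
    -- Along a single path, `Q` becomes a locally constant predicate on the connected unit interval,
    -- so it cannot change its truth value.
    have hR : IsLocallyConstant R := by
      rw [IsLocallyConstant.iff_eventually_eq]
      intro t
      obtain ⟨N, hN, h⟩ := hloc (ψ t) (c.trans (pathClass ψ 0 t))
      obtain ⟨M, hM, h'⟩ := exists_path_in_nhds ψ t hN
      filter_upwards [hM] with t' ht'
      obtain ⟨δ, hδ, hδ'⟩ := h' t' ht'
      have := h _ δ hδ
      rw [hδ', Path.Homotopic.Quotient.trans_assoc, pathClass_trans] at this
      exact propext this.symm
    have h0 : R 0 := by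
      simpa [R] using hc
    have h1 : R 1 = R 0 := hR.apply_eq_of_isPreconnected isPreconnected_univ trivial trivial
    exact h1.mpr h0
  have h2 : c.trans (c.symm.trans c') = c' := by
    rw [← Path.Homotopic.Quotient.trans_assoc, Path.Homotopic.Quotient.trans_symm,
      Path.Homotopic.Quotient.refl_trans]
  rw [← h2]
  generalize c.symm.trans c' = γ
  induction γ using Path.Homotopic.Quotient.ind with | mk γ => ?_
  obtain ⟨f, rfl, rfl⟩ := γ
  have := key f c hc
  have e : Path.Homotopic.Quotient.mk (⟨f, rfl, rfl⟩ : Path (f 0) (f 1)) = pathClass f 0 1 :=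
    mk_map_eq_pathClass f ⟨ContinuousMap.id _, rfl, rfl⟩
  rw [← e] at this
  exact this

end PathClasses

section Within

/-- The inclusion of a subset of `ℂ ∖ {0, 1}` into the base. -/
def inclBase {A : Set ℂ} (hA : A ⊆ {0, 1}ᶜ) : C(A, Base) :=
  ⟨Set.inclusion hA, continuous_inclusion hA⟩

variable {A : Set ℂ} [SimplyConnectedSpace A] (hA : A ⊆ {0, 1}ᶜ)

/-- The class of the paths from `y` to `w` inside the simply connected set `A`. -/
def within (y w : Base) (hy : (y : ℂ) ∈ A) (hw : (w : ℂ) ∈ A) : Path.Homotopic.Quotient y w :=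
  pathClass (inclBase hA) ⟨y, hy⟩ ⟨w, hw⟩

theorem within_trans {y w v : Base} (hy : (y : ℂ) ∈ A) (hw : (w : ℂ) ∈ A) (hv : (v : ℂ) ∈ A) :
    (within hA y w hy hw).trans (within hA w v hw hv) = within hA y v hy hv :=
  pathClass_trans (inclBase hA) ⟨y, hy⟩ ⟨w, hw⟩ ⟨v, hv⟩

theorem within_self {y : Base} (hy : (y : ℂ) ∈ A) :
    within hA y y hy hy = Path.Homotopic.Quotient.refl y :=
  pathClass_self (inclBase hA) ⟨y, hy⟩

theorem within_symm {y w : Base} (hy : (y : ℂ) ∈ A) (hw : (w : ℂ) ∈ A) :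
    (within hA y w hy hw).symm = within hA w y hw hy := by
  rw [← Path.Homotopic.Quotient.trans_refl (within hA y w hy hw).symm, ← within_self hA hy,
    ← within_trans hA hy hw hy, ← Path.Homotopic.Quotient.trans_assoc,
    Path.Homotopic.Quotient.symm_trans, Path.Homotopic.Quotient.refl_trans]

theorem mk_eq_within {y w : Base} (δ : Path y w) (hδ : ∀ t, (δ t : ℂ) ∈ A) (hy : (y : ℂ) ∈ A)
    (hw : (w : ℂ) ∈ A) : Path.Homotopic.Quotient.mk δ = within hA y w hy hw := by
  let ε : Path (⟨y, hy⟩ : A) ⟨w, hw⟩ :=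
    { toFun := fun t => ⟨δ t, hδ t⟩
      continuous_toFun := by fun_prop
      source' := Subtype.ext (congrArg (fun v : Base => (v : ℂ)) δ.source)
      target' := Subtype.ext (congrArg (fun v : Base => (v : ℂ)) δ.target) }
  exact mk_map_eq_pathClass (inclBase hA) ε

end Within

/-! ### Two slit planes and the generators of the fundamental group -/

/-- The plane without two rays going down from `0` and `1`. -/
def upperDom : Set ℂ :=
  {z | ¬(z.im ≤ 0 ∧ z.re = z.im / 2) ∧ ¬(z.im ≤ 0 ∧ z.re - 1 = -z.im / 2)}

/-- The plane without two rays going up from `0` and `1`. -/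
def lowerDom : Set ℂ :=
  {z | ¬(0 ≤ z.im ∧ z.re = -z.im / 2) ∧ ¬(0 ≤ z.im ∧ z.re - 1 = z.im / 2)}

theorem isOpen_upperDom : IsOpen upperDom := by
  have h1 : IsClosed ({z : ℂ | z.im ≤ 0} ∩ {z : ℂ | z.re = z.im / 2}) :=
    IsClosed.inter (isClosed_le (by fun_prop) (by fun_prop)) (isClosed_eq (by fun_prop) (by fun_prop))
  have h2 : IsClosed ({z : ℂ | z.im ≤ 0} ∩ {z : ℂ | z.re - 1 = -z.im / 2}) :=
    IsClosed.inter (isClosed_le (by fun_prop) (by fun_prop)) (isClosed_eq (by fun_prop) (by fun_prop))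
  exact h1.isOpen_compl.inter h2.isOpen_compl

theorem isOpen_lowerDom : IsOpen lowerDom := by
  have h1 : IsClosed ({z : ℂ | 0 ≤ z.im} ∩ {z : ℂ | z.re = -z.im / 2}) :=
    IsClosed.inter (isClosed_le (by fun_prop) (by fun_prop)) (isClosed_eq (by fun_prop) (by fun_prop))
  have h2 : IsClosed ({z : ℂ | 0 ≤ z.im} ∩ {z : ℂ | z.re - 1 = z.im / 2}) :=
    IsClosed.inter (isClosed_le (by fun_prop) (by fun_prop)) (isClosed_eq (by fun_prop) (by fun_prop))
  exact h1.isOpen_compl.inter h2.isOpen_compl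

theorem upperDom_subset : upperDom ⊆ {0, 1}ᶜ := by
  rintro z ⟨h1, h2⟩ (rfl | rfl)
  · simp at h1
  · simp at h2

theorem lowerDom_subset : lowerDom ⊆ {0, 1}ᶜ := by
  rintro z ⟨h1, h2⟩ (rfl | rfl)
  · simp at h1
  · simp at h2

/-- The slopes of the removed rays are chosen for this: both rays lie on lines through `1/2 + i` and
point away from it, so a segment from the centre that meets a ray has its far end on that ray. -/
theorem starConvex_upperDom : StarConvex ℝ (⟨1 / 2, 1⟩ : ℂ) upperDom := by
  intro z hz a t ha ht hat
  obtain rfl : a = 1 - t := by linarith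
  obtain ⟨h1, h2⟩ := hz
  have hre : ((1 - t) • (⟨1 / 2, 1⟩ : ℂ) + t • z).re = (1 - t) * (1 / 2) + t * z.re := by simp
  have him : ((1 - t) • (⟨1 / 2, 1⟩ : ℂ) + t • z).im = (1 - t) + t * z.im := by simp
  have pos : ¬ z.im ≤ 0 → 0 < (1 - t) + t * z.im := fun h => by
    push Not at h
    rcases ht.eq_or_lt with rfl | ht
    · simp
    · have := mul_pos ht h
      linarith
  constructor
  · rintro ⟨h3, h4⟩
    rw [him] at h3
    rw [hre, him] at h4
    rcases ht.eq_or_lt with rfl | ht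
    · norm_num at h3
    have h5 : z.re = z.im / 2 := by
      apply mul_left_cancel₀ ht.ne'
      linarith
    exact absurd (pos fun h => h1 ⟨h, h5⟩) (not_lt.2 h3)
  · rintro ⟨h3, h4⟩
    rw [him] at h3
    rw [hre, him] at h4
    rcases ht.eq_or_lt with rfl | ht
    · norm_num at h3
    have h5 : z.re - 1 = -z.im / 2 := by
      apply mul_left_cancel₀ ht.ne'
      linarith
    exact absurd (pos fun h => h2 ⟨h, h5⟩) (not_lt.2 h3)

theorem lowerDom_eq_preimage : lowerDom = Complex.conjLIE ⁻¹' upperDom := by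
  ext z
  simp [lowerDom, upperDom]

theorem starConvex_lowerDom : StarConvex ℝ (⟨1 / 2, -1⟩ : ℂ) lowerDom := by
  rw [lowerDom_eq_preimage]
  have h : StarConvex ℝ (Complex.conjLIE (⟨1 / 2, -1⟩ : ℂ)) upperDom := by
    have e : Complex.conjLIE (⟨1 / 2, -1⟩ : ℂ) = ⟨1 / 2, 1⟩ := by
      apply Complex.ext <;> simp
    rw [e]
    exact starConvex_upperDom
  intro z hz a t ha ht hat
  have := h hz ha ht hat
  simpa only [Set.mem_preimage, map_add, map_smul] using this

instance : SimplyConnectedSpace upperDom :=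
  have := starConvex_upperDom.contractibleSpace ⟨⟨1 / 2, 1⟩, by constructor <;> norm_num⟩
  SimplyConnectedSpace.ofContractible _

instance : SimplyConnectedSpace lowerDom :=
  have := starConvex_lowerDom.contractibleSpace ⟨⟨1 / 2, -1⟩, by constructor <;> norm_num⟩
  SimplyConnectedSpace.ofContractible _

theorem mem_upperDom_or_lowerDom (w : Base) : (w : ℂ) ∈ upperDom ∨ (w : ℂ) ∈ lowerDom := by
  by_contra! h
  obtain ⟨h1, h2⟩ := h
  have h3 : (w : ℂ) ≠ 0 := fun h => w.2 (Or.inl h)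
  have h4 : (w : ℂ) ≠ 1 := fun h => w.2 (Or.inr h)
  have key : ∀ {p q : Prop}, ¬(¬p ∧ ¬q) → p ∨ q := fun {p q} h => by tauto
  replace h1 := key h1
  replace h2 := key h2
  have h5 : (w : ℂ).im = 0 := by
    rcases h1 with h1 | h1 <;> rcases h2 with h2 | h2 <;> exact le_antisymm h1.1 h2.1
  rw [h5] at h1
  rcases h1 with h1 | h1
  · exact h3 (Complex.ext (by simpa using h1.2) h5)
  · exact h4 (Complex.ext (by simpa [sub_eq_zero] using h1.2) h5)

theorem ofReal_mem_upperDom {x : ℝ} (h0 : x ≠ 0) (h1 : x ≠ 1) : (x : ℂ) ∈ upperDom := by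
  constructor <;> simp [h0, sub_eq_zero, h1]

theorem ofReal_mem_lowerDom {x : ℝ} (h0 : x ≠ 0) (h1 : x ≠ 1) : (x : ℂ) ∈ lowerDom := by
  constructor <;> simp [h0, sub_eq_zero, h1]

/-- A real point of the base. -/
def realPt (x : ℝ) (h0 : x ≠ 0) (h1 : x ≠ 1) : Base :=
  ⟨x, upperDom_subset (ofReal_mem_upperDom h0 h1)⟩

/-- The loop at `b` that goes to `y` in `upperDom` and comes back in `lowerDom`. -/
def crossLoop (b y : Base) (hb : (b : ℂ) ∈ upperDom ∩ lowerDom)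
    (hy : (y : ℂ) ∈ upperDom ∩ lowerDom) : Path.Homotopic.Quotient b b :=
  (within upperDom_subset b y hb.1 hy.1).trans (within lowerDom_subset y b hy.2 hb.2)

/-- A segment inside the intersection represents the class from `y` to `w` in both slit planes, so
it is inserted and cancelled. Thus only the component of the crossing point matters. -/
theorem crossLoop_eq_of_segment {b y w : Base} (hb : (b : ℂ) ∈ upperDom ∩ lowerDom)
    (hy : (y : ℂ) ∈ upperDom ∩ lowerDom) (hw : (w : ℂ) ∈ upperDom ∩ lowerDom)
    (h : ∀ t : ℝ, 0 ≤ t → t ≤ 1 → (y : ℂ) + t * (w - y) ∈ upperDom ∩ lowerDom) :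
    crossLoop b y hb hy = crossLoop b w hb hw := by
  let δ : Path y w :=
    { toFun := fun t => ⟨(y : ℂ) + (t : ℝ) * (w - y), upperDom_subset (h t t.2.1 t.2.2).1⟩
      continuous_toFun := by fun_prop
      source' := Subtype.ext (by simp)
      target' := Subtype.ext (by simp) }
  have h1 := mk_eq_within upperDom_subset δ (fun t => (h t t.2.1 t.2.2).1) hy.1 hw.1
  have h2 := mk_eq_within lowerDom_subset δ (fun t => (h t t.2.1 t.2.2).2) hy.2 hw.2
  simp only [crossLoop]
  rw [← within_trans upperDom_subset hb.1 hy.1 hw.1,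
    ← within_trans lowerDom_subset hy.2 hw.2 hb.2, ← h1, ← h2,
    Path.Homotopic.Quotient.trans_assoc]

theorem crossLoop_self {b : Base} (hb : (b : ℂ) ∈ upperDom ∩ lowerDom) :
    crossLoop b b hb hb = Path.Homotopic.Quotient.refl b := by
  rw [crossLoop, within_self, within_self,
    Path.Homotopic.Quotient.trans_refl]

/-- This form exhibits the three components of the intersection: a left cone, a right cone, and the
region between them. The first two are convex and the third is star-shaped about each point of `(0,
1)`, which is what the `segment_mem_*` lemmas use. -/
theorem mem_inter_iff (z : ℂ) :
    z ∈ upperDom ∩ lowerDom ↔ z.re ≠ -|z.im| / 2 ∧ z.re - 1 ≠ |z.im| / 2 := by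
  simp only [upperDom, lowerDom, Set.mem_inter_iff, Set.mem_ofPred_eq]
  rcases le_or_gt 0 z.im with h | h
  · rw [abs_of_nonneg h]
    constructor
    · rintro ⟨-, h3, h4⟩
      exact ⟨fun h5 => h3 ⟨h, h5⟩, fun h5 => h4 ⟨h, h5⟩⟩
    · rintro ⟨h3, h4⟩
      refine ⟨⟨?_, ?_⟩, fun h5 => h3 h5.2, fun h5 => h4 h5.2⟩
      · rintro ⟨h5, h6⟩
        exact h3 (by linarith)
      · rintro ⟨h5, h6⟩
        exact h4 (by linarith)
  · rw [abs_of_neg h]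
    constructor
    · rintro ⟨⟨h3, h4⟩, -⟩
      exact ⟨fun h5 => h3 ⟨h.le, by linarith⟩, fun h5 => h4 ⟨h.le, by linarith⟩⟩
    · rintro ⟨h3, h4⟩
      exact ⟨⟨fun h5 => h3 (by linarith), fun h5 => h4 (by linarith)⟩,
        fun h5 => absurd h (not_lt.2 h5.1), fun h5 => absurd h (not_lt.2 h5.1)⟩

theorem ofReal_mem_inter {x : ℝ} (h0 : x ≠ 0) (h1 : x ≠ 1) : (x : ℂ) ∈ upperDom ∩ lowerDom :=
  ⟨ofReal_mem_upperDom h0 h1, ofReal_mem_lowerDom h0 h1⟩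

theorem segment_re_im (x : ℝ) (z : ℂ) (t : ℝ) :
    ((x : ℂ) + t * (z - x)).re = (1 - t) * x + t * z.re ∧
      ((x : ℂ) + t * (z - x)).im = t * z.im := by
  constructor
  · simp; ring
  · simp

theorem segment_mem_left {x : ℝ} (hx : x < 0) {z : ℂ} (hz : z.re < -|z.im| / 2) {t : ℝ}
    (h0 : 0 ≤ t) (h1 : t ≤ 1) : (x : ℂ) + t * (z - x) ∈ upperDom ∩ lowerDom := by
  rw [mem_inter_iff, (segment_re_im x z t).1, (segment_re_im x z t).2, abs_mul, abs_of_nonneg h0]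
  have h2 : (1 - t) * x + t * z.re < -(t * |z.im|) / 2 := by
    rcases h0.eq_or_lt with rfl | h0
    · simpa using hx
    · have := mul_nonpos_of_nonneg_of_nonpos (sub_nonneg.2 h1) hx.le
      have := mul_lt_mul_of_pos_left hz h0
      linarith
  have := mul_nonneg h0 (abs_nonneg z.im)
  exact ⟨h2.ne, fun h => by linarith⟩

theorem segment_mem_right {x : ℝ} (hx : 1 < x) {z : ℂ} (hz : |z.im| / 2 < z.re - 1) {t : ℝ}
    (h0 : 0 ≤ t) (h1 : t ≤ 1) : (x : ℂ) + t * (z - x) ∈ upperDom ∩ lowerDom := by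
  rw [mem_inter_iff, (segment_re_im x z t).1, (segment_re_im x z t).2, abs_mul, abs_of_nonneg h0]
  have h2 : t * |z.im| / 2 < (1 - t) * x + t * z.re - 1 := by
    rcases h0.eq_or_lt with rfl | h0
    · simpa using hx
    · have := mul_nonneg (sub_nonneg.2 h1) (sub_nonneg.2 hx.le)
      have := mul_lt_mul_of_pos_left hz h0
      linarith
  have := mul_nonneg h0 (abs_nonneg z.im)
  exact ⟨fun h => by linarith, h2.ne'⟩

theorem segment_mem_middle {x : ℝ} (hx0 : 0 < x) (hx1 : x < 1) {z : ℂ} (hz : -|z.im| / 2 < z.re)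
    (hz' : z.re - 1 < |z.im| / 2) {t : ℝ}
    (h0 : 0 ≤ t) (h1 : t ≤ 1) : (x : ℂ) + t * (z - x) ∈ upperDom ∩ lowerDom := by
  rw [mem_inter_iff, (segment_re_im x z t).1, (segment_re_im x z t).2, abs_mul, abs_of_nonneg h0]
  rcases h0.eq_or_lt with rfl | h0
  · constructor
    · simpa using hx0.ne'
    · simpa [sub_eq_zero] using hx1.ne
  have := mul_nonneg (sub_nonneg.2 h1) (sub_nonneg.2 hx1.le)
  have := mul_nonneg (sub_nonneg.2 h1) hx0.le
  have := mul_lt_mul_of_pos_left hz h0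
  have := mul_lt_mul_of_pos_left hz' h0
  exact ⟨fun h => by linarith, fun h => by linarith⟩

/-- The base point `1/2`. -/
def midPt : Base := realPt (1 / 2) (by norm_num) (by norm_num)

theorem midPt_mem : (midPt : ℂ) ∈ upperDom ∩ lowerDom :=
  ofReal_mem_inter (by norm_num) (by norm_num)

theorem realPt_mem {x : ℝ} (h0 : x ≠ 0) (h1 : x ≠ 1) :
    (realPt x h0 h1 : ℂ) ∈ upperDom ∩ lowerDom := ofReal_mem_inter h0 h1

/-- The loop at `x₀` that follows `d` to `1/2`, goes to the real number `x` through the upper half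
plane and comes back through the lower half plane. -/
def realLoop {x₀ : Base} (d : Path.Homotopic.Quotient x₀ midPt) (x : ℝ) (h0 : x ≠ 0)
    (h1 : x ≠ 1) : FundamentalGroup Base x₀ :=
  FundamentalGroup.fromPath
    ((d.trans (crossLoop midPt (realPt x h0 h1) midPt_mem (realPt_mem h0 h1))).trans d.symm)

theorem crossLoop_real_left {x y : ℝ} (hx : x < 0) (hy : y < 0) (hx1 : x ≠ 1) (hy1 : y ≠ 1) :
    crossLoop midPt (realPt x hx.ne hx1) midPt_mem (realPt_mem hx.ne hx1) =
      crossLoop midPt (realPt y hy.ne hy1) midPt_mem (realPt_mem hy.ne hy1) :=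
  crossLoop_eq_of_segment _ _ _ fun _ h0 h1 => segment_mem_left hx (by simpa [realPt] using hy) h0 h1

theorem crossLoop_real_right {x y : ℝ} (hx : 1 < x) (hy : 1 < y) (hx0 : x ≠ 0) (hy0 : y ≠ 0) :
    crossLoop midPt (realPt x hx0 hx.ne') midPt_mem (realPt_mem hx0 hx.ne') =
      crossLoop midPt (realPt y hy0 hy.ne') midPt_mem (realPt_mem hy0 hy.ne') :=
  crossLoop_eq_of_segment _ _ _ fun _ h0 h1 => segment_mem_right hx (by simpa [realPt] using hy) h0 h1

/-- The generation half of van Kampen's theorem for the cover by the two slit planes. A path class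
is closed up to a loop through the slit plane containing its endpoint; whether this loop lies in `H`
is independent of the slit plane and locally constant along paths, hence always true by
`path_induction`. -/
theorem subgroup_eq_top_of_realLoop_mem {x₀ : Base} (d : Path.Homotopic.Quotient x₀ midPt)
    (H : Subgroup (FundamentalGroup Base x₀)) {x y : ℝ} (hx : x < 0) (hy : 1 < y)
    (h1 : realLoop d x hx.ne (by linarith) ∈ H)
    (h2 : realLoop d y (by linarith) hy.ne' ∈ H) : H = ⊤ := by
  have hk : ∀ (w : Base) (hw : (w : ℂ) ∈ upperDom ∩ lowerDom),
      FundamentalGroup.fromPath ((d.trans (crossLoop midPt w midPt_mem hw)).trans d.symm) ∈ H := by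
    intro w hw
    obtain ⟨h3, h4⟩ := (mem_inter_iff _).1 hw
    rcases lt_or_gt_of_ne h3 with h3 | h3
    · rw [← crossLoop_eq_of_segment (y := realPt x hx.ne (by linarith)) midPt_mem
        (realPt_mem hx.ne (by linarith)) hw
        fun t h0 h1 => segment_mem_left hx h3 h0 h1]
      exact h1
    rcases lt_or_gt_of_ne h4 with h4 | h4
    · rw [← crossLoop_eq_of_segment midPt_mem midPt_mem hw fun t h0 h1 =>
        segment_mem_middle (x := 1 / 2) (by norm_num) (by norm_num) h3 h4 h0 h1, crossLoop_self,
        Path.Homotopic.Quotient.trans_refl, Path.Homotopic.Quotient.trans_symm]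
      exact H.one_mem
    · rw [← crossLoop_eq_of_segment (y := realPt y (by linarith) hy.ne') midPt_mem
        (realPt_mem (by linarith) hy.ne') hw
        fun t h0 h1 => segment_mem_right hy h4 h0 h1]
      exact h2
  let QU : ∀ w : Base, Path.Homotopic.Quotient x₀ w → (w : ℂ) ∈ upperDom → Prop := fun w c hw =>
    FundamentalGroup.fromPath ((c.trans (within upperDom_subset w midPt hw midPt_mem.1)).trans d.symm) ∈ H
  let QL : ∀ w : Base, Path.Homotopic.Quotient x₀ w → (w : ℂ) ∈ lowerDom → Prop := fun w c hw =>
    FundamentalGroup.fromPath ((c.trans (within lowerDom_subset w midPt hw midPt_mem.2)).trans d.symm) ∈ H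
  -- The two ways of closing up differ by the crossing loop at `w`, which `hk` places in `H`. In a
  -- product in the fundamental group the right factor is run through first.
  have hUL : ∀ (w : Base) c (hw : (w : ℂ) ∈ upperDom ∩ lowerDom), QU w c hw.1 ↔ QL w c hw.2 := by
    intro w c hw
    have e : FundamentalGroup.fromPath
        ((c.trans (within lowerDom_subset w midPt hw.2 midPt_mem.2)).trans d.symm) =
        FundamentalGroup.fromPath
          ((d.trans (crossLoop midPt w midPt_mem hw)).trans d.symm) *
        FundamentalGroup.fromPath
          ((c.trans (within upperDom_subset w midPt hw.1 midPt_mem.1)).trans d.symm) := by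
      rw [FundamentalGroup.mul_def]
      simp only [Path.Homotopic.Quotient.trans_assoc]
      congr 1
      rw [← Path.Homotopic.Quotient.trans_assoc d.symm, Path.Homotopic.Quotient.symm_trans,
        Path.Homotopic.Quotient.refl_trans, crossLoop]
      rw [Path.Homotopic.Quotient.trans_assoc (within upperDom_subset midPt w _ _),
        ← Path.Homotopic.Quotient.trans_assoc (within upperDom_subset w midPt _ _), within_trans,
        within_self, Path.Homotopic.Quotient.refl_trans]
    simp only [QU, QL]
    rw [e, H.mul_mem_cancel_left (hk w hw)]
  let Q : ∀ w : Base, Path.Homotopic.Quotient x₀ w → Prop := fun w c =>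
    (∃ hw, QU w c hw) ∨ (∃ hw, QL w c hw)
  have hQU : ∀ (w : Base) c (hw : (w : ℂ) ∈ upperDom), Q w c ↔ QU w c hw := fun w c hw =>
    ⟨fun h => h.elim (fun h => h.2) fun h => (hUL w c ⟨hw, h.1⟩).2 h.2, fun h => Or.inl ⟨hw, h⟩⟩
  have hQL : ∀ (w : Base) c (hw : (w : ℂ) ∈ lowerDom), Q w c ↔ QL w c hw := fun w c hw =>
    ⟨fun h => h.elim (fun h => (hUL w c ⟨h.1, hw⟩).1 h.2) fun h => h.2, fun h => Or.inr ⟨hw, h⟩⟩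
  have hQ : ∀ w c, Q w c := by
    refine path_induction Q ?_ d ?_
    · intro w c
      rcases mem_upperDom_or_lowerDom w with hw | hw
      · refine ⟨_, (isOpen_upperDom.preimage continuous_subtype_val).mem_nhds hw,
          fun w' δ hδ => ?_⟩
        have hw' : (w' : ℂ) ∈ upperDom := by simpa using hδ 1
        rw [hQU w c hw, hQU w' _ hw']
        simp only [QU]
        rw [mk_eq_within upperDom_subset δ hδ hw hw',
          Path.Homotopic.Quotient.trans_assoc c (within _ w w' hw hw'),
          within_trans]
      · refine ⟨_, (isOpen_lowerDom.preimage continuous_subtype_val).mem_nhds hw,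
          fun w' δ hδ => ?_⟩
        have hw' : (w' : ℂ) ∈ lowerDom := by simpa using hδ 1
        rw [hQL w c hw, hQL w' _ hw']
        simp only [QL]
        rw [mk_eq_within lowerDom_subset δ hδ hw hw',
          Path.Homotopic.Quotient.trans_assoc c (within _ w w' hw hw'),
          within_trans]
    · rw [hQU _ _ midPt_mem.1]
      simp only [QU]
      rw [within_self, Path.Homotopic.Quotient.trans_refl, Path.Homotopic.Quotient.trans_symm]
      exact H.one_mem
  rw [Subgroup.eq_top_iff']
  intro g
  have h := (hQU _ _ midPt_mem.1).1 (hQ midPt ((FundamentalGroup.toPath g).trans d))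
  simp only [QU] at h
  rw [within_self, Path.Homotopic.Quotient.trans_refl, Path.Homotopic.Quotient.trans_assoc,
    Path.Homotopic.Quotient.trans_symm, Path.Homotopic.Quotient.trans_refl] at h
  exact h

theorem exists_path_to_midPt (x₀ : Base) : Nonempty (Path.Homotopic.Quotient x₀ midPt) := by
  rcases mem_upperDom_or_lowerDom x₀ with h | h
  · exact ⟨within upperDom_subset x₀ midPt h midPt_mem.1⟩
  · exact ⟨within lowerDom_subset x₀ midPt h midPt_mem.2⟩

/-! ### The hypergeometric equation in a logarithmic coordinate -/

theorem eqOn_zero_of_linear_ode {U : Set ℂ} (hU : IsOpen U) (hc : IsPreconnected U)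
    {G p q : ℂ → ℂ} (hG : DifferentiableOn ℂ G U) (hp : DifferentiableOn ℂ p U)
    (hq : DifferentiableOn ℂ q U)
    (h : ∀ s ∈ U, deriv (deriv G) s = p s * deriv G s + q s * G s) {s₀ : ℂ} (hs : s₀ ∈ U)
    (h0 : G s₀ = 0) (h1 : deriv G s₀ = 0) : Set.EqOn G 0 U := by
  have aG : AnalyticAt ℂ G s₀ := hG.analyticAt (hU.mem_nhds hs)
  have ap : AnalyticAt ℂ p s₀ := hp.analyticAt (hU.mem_nhds hs)
  have aq : AnalyticAt ℂ q s₀ := hq.analyticAt (hU.mem_nhds hs)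
  have o1 := aG.analyticOrderAt_deriv_add_one
  have o2 := aG.deriv.analyticOrderAt_deriv_add_one
  simp only [h0, h1, sub_zero] at o1 o2
  have e : deriv (deriv G) =ᶠ[𝓝 s₀] p * deriv G + q * G := by
    filter_upwards [hU.mem_nhds hs] with s hs'
    exact h s hs'
  -- Uniqueness by orders of vanishing: the equation makes `G''` vanish at least as often as `G'`,
  -- whereas differentiation lowers a finite positive order by one. So the order is infinite.
  have o3 : analyticOrderAt (deriv G) s₀ ≤ analyticOrderAt (deriv (deriv G)) s₀ := by
    rw [analyticOrderAt_congr e]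
    refine le_trans (le_min ?_ ?_) le_analyticOrderAt_add
    · rw [analyticOrderAt_mul ap aG.deriv]
      exact le_add_self
    · rw [analyticOrderAt_mul aq aG, ← o1]
      exact le_self_add.trans le_add_self
  have o4 : analyticOrderAt G s₀ = ⊤ := by
    have o5 : analyticOrderAt (deriv (deriv G)) s₀ = ⊤ := by
      rw [← o2] at o3
      by_contra hne
      have := ENat.lt_add_one_iff hne (m := analyticOrderAt (deriv (deriv G)) s₀) |>.2 le_rfl
      exact absurd o3 (not_le.2 this)
    rw [← o1, ← o2, o5]
    rfl
  exact AnalyticOnNhd.eqOn_zero_of_preconnected_of_eventuallyEq_zero (hG.analyticOnNhd hU) hc hs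
    (analyticOrderAt_eq_top.1 o4)

/-- The left half plane. -/
def leftHalf : Set ℂ := {s | s.re < 0}

theorem isOpen_leftHalf : IsOpen leftHalf := isOpen_lt Complex.continuous_re continuous_const

theorem convex_leftHalf : Convex ℝ leftHalf := convex_halfSpace_re_lt 0

theorem one_sub_exp_mem_slitPlane {s : ℂ} (hs : s ∈ leftHalf) :
    1 - Complex.exp s ∈ Complex.slitPlane := by
  have h1 : ‖Complex.exp s‖ < 1 := by
    rw [Complex.norm_exp]
    rw [← Real.exp_zero]
    exact Real.exp_lt_exp.2 hs
  left
  have := (Complex.re_le_norm (Complex.exp s)).trans_lt h1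
  simp only [Complex.sub_re, Complex.one_re]
  linarith

theorem one_sub_exp_ne_zero {s : ℂ} (hs : s ∈ leftHalf) : 1 - Complex.exp s ≠ 0 :=
  Complex.slitPlane_ne_zero (one_sub_exp_mem_slitPlane hs)

/-- Holomorphic solutions of the hypergeometric equation with parameters `α, β; γ` on the unit
disc without the origin, in the coordinate `s = log z`. -/
def IsLogSol (α β γ : ℂ) (G : ℂ → ℂ) : Prop :=
  DifferentiableOn ℂ G leftHalf ∧ ∀ s ∈ leftHalf,
    (1 - Complex.exp s) * deriv (deriv G) s + ((γ - 1) - (α + β) * Complex.exp s) * deriv G s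
      - α * β * Complex.exp s * G s = 0

variable {α β γ : ℂ}

theorem IsLogSol.sub {G₁ G₂ : ℂ → ℂ} (h₁ : IsLogSol α β γ G₁) (h₂ : IsLogSol α β γ G₂) :
    IsLogSol α β γ (G₁ - G₂) := by
  refine ⟨h₁.1.sub h₂.1, fun s hs => ?_⟩
  have hd : ∀ s ∈ leftHalf, deriv (G₁ - G₂) s = (deriv G₁ - deriv G₂) s := fun s hs =>
    deriv_sub (h₁.1.differentiableAt (isOpen_leftHalf.mem_nhds hs))
      (h₂.1.differentiableAt (isOpen_leftHalf.mem_nhds hs))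
  have hdd : deriv (deriv (G₁ - G₂)) s = deriv (deriv G₁) s - deriv (deriv G₂) s := by
    rw [(eventuallyEq_of_mem (isOpen_leftHalf.mem_nhds hs) hd).deriv_eq]
    exact deriv_sub ((h₁.1.deriv isOpen_leftHalf).differentiableAt (isOpen_leftHalf.mem_nhds hs))
      ((h₂.1.deriv isOpen_leftHalf).differentiableAt (isOpen_leftHalf.mem_nhds hs))
  rw [hdd, hd s hs, Pi.sub_apply, Pi.sub_apply]
  linear_combination h₁.2 s hs - h₂.2 s hs

theorem IsLogSol.eqOn_zero {G : ℂ → ℂ} (h : IsLogSol α β γ G) {s₀ : ℂ} (hs : s₀ ∈ leftHalf)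
    (h0 : G s₀ = 0) (h1 : deriv G s₀ = 0) : Set.EqOn G 0 leftHalf := by
  refine eqOn_zero_of_linear_ode (p := fun s => -((γ - 1) - (α + β) * Complex.exp s) /
    (1 - Complex.exp s)) (q := fun s => α * β * Complex.exp s / (1 - Complex.exp s))
    isOpen_leftHalf convex_leftHalf.isPreconnected h.1 ?_ ?_ ?_ hs h0 h1
  · exact DifferentiableOn.div (by fun_prop) (by fun_prop) fun s hs => one_sub_exp_ne_zero hs
  · exact DifferentiableOn.div (by fun_prop) (by fun_prop) fun s hs => one_sub_exp_ne_zero hs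
  · intro s hs
    have := one_sub_exp_ne_zero hs
    field_simp
    linear_combination h.2 s hs

theorem add_two_pi_I_mem {s : ℂ} (hs : s ∈ leftHalf) : s + 2 * Real.pi * Complex.I ∈ leftHalf := by
  simpa [leftHalf] using hs

/-- Abel's identity: the Wronskian times the integrating factor `E` is constant. The logarithm in
`E` is single-valued because `1 - exp s` stays in the slit plane, so only the factor `exp ((γ - 1)
s)` sees the translation by `2πi`. -/
theorem IsLogSol.wronskian {G₁ G₂ : ℂ → ℂ} (h₁ : IsLogSol α β γ G₁) (h₂ : IsLogSol α β γ G₂)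
    {s₀ : ℂ} (hs : s₀ ∈ leftHalf) {s₁ : ℂ} (hs₁ : s₁ = s₀ + 2 * Real.pi * Complex.I) :
    G₁ s₁ * deriv G₂ s₁ - deriv G₁ s₁ * G₂ s₁ =
      Complex.exp (2 * Real.pi * Complex.I * (1 - γ)) *
        (G₁ s₀ * deriv G₂ s₀ - deriv G₁ s₀ * G₂ s₀) := by
  subst hs₁
  let E : ℂ → ℂ := fun s => Complex.exp ((γ - 1) * s -
    (γ - 1 - α - β) * Complex.log (1 - Complex.exp s))
  let W : ℂ → ℂ := fun s => (G₁ s * deriv G₂ s - deriv G₁ s * G₂ s) * E s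
  have hW : ∀ s ∈ leftHalf, HasDerivAt W 0 s := by
    intro s hs
    have n := isOpen_leftHalf.mem_nhds hs
    have d1 := (h₁.1.differentiableAt n).hasDerivAt
    have d2 := (h₂.1.differentiableAt n).hasDerivAt
    have d3 := ((h₁.1.deriv isOpen_leftHalf).differentiableAt n).hasDerivAt
    have d4 := ((h₂.1.deriv isOpen_leftHalf).differentiableAt n).hasDerivAt
    have d5 : HasDerivAt (fun s => 1 - Complex.exp s) (-Complex.exp s) s :=
      (Complex.hasDerivAt_exp s).const_sub 1
    have d6 := (((hasDerivAt_id s).const_mul (γ - 1)).sub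
      ((d5.clog (one_sub_exp_mem_slitPlane hs)).const_mul (γ - 1 - α - β))).cexp
    have d7 := ((d1.mul d4).sub (d3.mul d2)).mul d6
    refine d7.congr_deriv ?_
    have e1 := h₁.2 s hs
    have e2 := h₂.2 s hs
    have ne := one_sub_exp_ne_zero hs
    simp only [Pi.mul_apply, Pi.sub_apply, id]
    field_simp
    linear_combination (Complex.exp ((γ - 1) * s - (γ - 1 - α - β) *
      Complex.log (1 - Complex.exp s))) * (G₁ s * e2 - G₂ s * e1)
  have hconst : W s₀ = W (s₀ + 2 * Real.pi * Complex.I) :=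
    isOpen_leftHalf.is_const_of_deriv_eq_zero convex_leftHalf.isPreconnected
      (fun s hs => (hW s hs).differentiableAt.differentiableWithinAt)
      (fun s hs => (hW s hs).deriv) hs (add_two_pi_I_mem hs)
  have hE : E (s₀ + 2 * Real.pi * Complex.I) =
      Complex.exp (2 * Real.pi * Complex.I * (γ - 1)) * E s₀ := by
    simp only [E]
    rw [Complex.exp_periodic s₀, ← Complex.exp_add]
    congr 1
    ring
  simp only [W, hE] at hconst
  have hE0 : E s₀ ≠ 0 := Complex.exp_ne_zero _
  have h3 : Complex.exp (2 * Real.pi * Complex.I * (1 - γ)) *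
      Complex.exp (2 * Real.pi * Complex.I * (γ - 1)) = 1 := by
    rw [← Complex.exp_add, ← Complex.exp_zero]
    congr 1
    ring
  apply mul_right_cancel₀ hE0
  linear_combination (-(Complex.exp (2 * Real.pi * Complex.I * (1 - γ)))) * hconst -
    ((G₁ (s₀ + 2 * Real.pi * Complex.I) * deriv G₂ (s₀ + 2 * Real.pi * Complex.I) - deriv G₁ (s₀ + 2 * Real.pi * Complex.I) * G₂ (s₀ + 2 * Real.pi * Complex.I)) * E s₀) * h3

/-! ### Power series solutions -/

/-- The coefficients of a power series whose radius of convergence is at least one. -/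
def SubexpGrowth (v : ℕ → ℂ) : Prop := ∀ δ : ℝ, 0 < δ → Summable fun n => ‖v n‖ * Real.exp (-(n * δ))

/-- The power series with coefficients `v` as a function of the logarithm of its argument. -/
def expSeries (v : ℕ → ℂ) (s : ℂ) : ℂ := ∑' n : ℕ, v n * Complex.exp (n * s)

theorem SubexpGrowth.nat_mul {v : ℕ → ℂ} (hv : SubexpGrowth v) :
    SubexpGrowth fun n => n * v n := by
  intro δ hδ
  refine Summable.of_nonneg_of_le (fun n => by positivity) (fun n => ?_)
    ((hv (δ / 2) (by positivity)).mul_left (2 / δ))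
  have h1 : (n : ℝ) * Real.exp (-(n * δ)) ≤ 2 / δ * Real.exp (-(n * (δ / 2))) := by
    have h2 : Real.exp (-(n * δ)) = Real.exp (-(n * (δ / 2))) * Real.exp (-(n * (δ / 2))) := by
      rw [← Real.exp_add]
      congr 1
      ring
    have h3 : (n : ℝ) * (δ / 2) ≤ Real.exp (n * (δ / 2)) := by
      have := Real.add_one_le_exp ((n : ℝ) * (δ / 2))
      linarith
    have h4 : (n : ℝ) * Real.exp (-(n * (δ / 2))) ≤ 2 / δ := by
      rw [Real.exp_neg, ← div_eq_mul_inv, div_le_div_iff₀ (Real.exp_pos _) hδ]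
      linarith
    rw [h2, ← mul_assoc]
    exact mul_le_mul_of_nonneg_right h4 (Real.exp_pos _).le
  rw [norm_mul, Complex.norm_natCast]
  calc (n : ℝ) * ‖v n‖ * Real.exp (-(n * δ)) = ‖v n‖ * (n * Real.exp (-(n * δ))) := by ring
    _ ≤ ‖v n‖ * (2 / δ * Real.exp (-(n * (δ / 2)))) :=
        mul_le_mul_of_nonneg_left h1 (norm_nonneg _)
    _ = _ := by ring

theorem norm_term_le (v : ℕ → ℂ) {δ : ℝ} {s : ℂ} (hs : s.re ≤ -δ) (n : ℕ) :
    ‖v n * Complex.exp (n * s)‖ ≤ ‖v n‖ * Real.exp (-(n * δ)) := by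
  rw [norm_mul, Complex.norm_exp]
  refine mul_le_mul_of_nonneg_left (Real.exp_le_exp.2 ?_) (norm_nonneg _)
  have : ((n : ℂ) * s).re = n * s.re := by simp
  rw [this]
  have := mul_le_mul_of_nonneg_left hs (Nat.cast_nonneg (α := ℝ) n)
  linarith

theorem SubexpGrowth.summable {v : ℕ → ℂ} (hv : SubexpGrowth v) {s : ℂ} (hs : s ∈ leftHalf) :
    Summable fun n : ℕ => v n * Complex.exp (n * s) :=
  Summable.of_norm_bounded (hv (-s.re) (neg_pos.2 hs)) fun n => norm_term_le v (by simp) n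

theorem SubexpGrowth.hasDerivAt {v : ℕ → ℂ} (hv : SubexpGrowth v) {s : ℂ} (hs : s ∈ leftHalf) :
    HasDerivAt (expSeries v) (expSeries (fun n => n * v n) s) s := by
  have hs' : s.re < 0 := hs
  let U : Set ℂ := {w | w.re < s.re / 2}
  have hU : IsOpen U := isOpen_lt Complex.continuous_re continuous_const
  have hsU : s ∈ U := by
    change s.re < s.re / 2
    linarith
  have hu := hv (-(s.re / 2)) (by linarith)
  have hd : ∀ i : ℕ, DifferentiableOn ℂ (fun w : ℂ => v i * Complex.exp (i * w)) U :=
    fun i => by fun_prop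
  have hle : ∀ (i : ℕ) (w : ℂ), w ∈ U → ‖v i * Complex.exp (i * w)‖ ≤
      ‖v i‖ * Real.exp (-(i * -(s.re / 2))) := fun i w hw =>
    norm_term_le v (by rw [neg_neg]; exact le_of_lt hw) i
  have h1 := Complex.hasSum_deriv_of_summable_norm hu hd hU hle hsU
  have h2 : DifferentiableAt ℂ (expSeries v) s :=
    (Complex.differentiableOn_tsum_of_summable_norm hu hd hU hle).differentiableAt
      (hU.mem_nhds hsU)
  refine h2.hasDerivAt.congr_deriv ?_
  rw [expSeries]
  change deriv (fun w => ∑' n : ℕ, v n * Complex.exp (n * w)) s = _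
  rw [← h1.tsum_eq]
  refine tsum_congr fun n => ?_
  have h3 : HasDerivAt (fun w : ℂ => v n * Complex.exp (n * w))
      (v n * (Complex.exp (n * s) * (n * 1))) s :=
    (((hasDerivAt_id s).const_mul (n : ℂ)).cexp).const_mul (v n)
  rw [h3.deriv]
  ring

theorem expSeries_periodic (v : ℕ → ℂ) (s : ℂ) :
    expSeries v (s + 2 * Real.pi * Complex.I) = expSeries v s := by
  refine tsum_congr fun n => ?_
  rw [mul_add, Complex.exp_add, Complex.exp_nat_mul_two_pi_mul_I, mul_one]

variable {α β γ : ℂ}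

theorem isLogSol_expSeries {v : ℕ → ℂ} (hv : SubexpGrowth v)
    (h : ∀ n : ℕ, (n + 1) * (n + γ) * v (n + 1) = (n + α) * (n + β) * v n) :
    IsLogSol α β γ (expSeries v) := by
  have hv1 := hv.nat_mul
  have hv2 := hv1.nat_mul
  refine ⟨fun s hs => (hv.hasDerivAt hs).differentiableAt.differentiableWithinAt, fun s hs => ?_⟩
  have d1 : deriv (expSeries v) s = expSeries (fun n => n * v n) s := (hv.hasDerivAt hs).deriv
  have d2 : deriv (deriv (expSeries v)) s = expSeries (fun n => n * (n * v n)) s := by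
    have : deriv (expSeries v) =ᶠ[𝓝 s] expSeries (fun n => n * v n) := by
      filter_upwards [isOpen_leftHalf.mem_nhds hs] with w hw
      exact (hv.hasDerivAt hw).deriv
    rw [this.deriv_eq]
    exact (hv1.hasDerivAt hs).deriv
  have s0 := hv.summable hs
  have s1 := hv1.summable hs
  have s2 := hv2.summable hs
  have e1 : deriv (deriv (expSeries v)) s + (γ - 1) * deriv (expSeries v) s =
      ∑' n : ℕ, (n * (n + γ - 1) * v n) * Complex.exp (n * s) := by
    rw [d1, d2, expSeries, expSeries, ← tsum_mul_left, ← s2.tsum_add (s1.mul_left _)]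
    exact tsum_congr fun n => by ring
  have e2 : Complex.exp s * (deriv (deriv (expSeries v)) s + (α + β) * deriv (expSeries v) s +
      α * β * expSeries v s) =
      ∑' n : ℕ, ((n + 1) * (n + γ) * v (n + 1)) * Complex.exp ((n + 1 : ℕ) * s) := by
    rw [d1, d2, expSeries, expSeries, expSeries, ← tsum_mul_left, ← tsum_mul_left,
      ← s2.tsum_add (s1.mul_left _), ← (s2.add (s1.mul_left _)).tsum_add (s0.mul_left _),
      ← tsum_mul_left]
    refine tsum_congr fun n => ?_
    rw [h n]
    push_cast
    rw [add_mul (n : ℂ) 1 s, Complex.exp_add, one_mul]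
    ring
  have e3 : ∑' n : ℕ, (n * (n + γ - 1) * v n) * Complex.exp (n * s) =
      ∑' n : ℕ, ((n + 1) * (n + γ) * v (n + 1)) * Complex.exp ((n + 1 : ℕ) * s) := by
    have hs : Summable fun n : ℕ => (n * (n + γ - 1) * v n) * Complex.exp (n * s) :=
      (s2.add (s1.mul_left (γ - 1))).congr fun n => by ring
    rw [hs.tsum_eq_zero_add]
    simp only [Nat.cast_zero, zero_mul, zero_add]
    refine tsum_congr fun n => ?_
    push_cast
    ring
  linear_combination e1 - e2 + e3

/-- The recurrence from `1` at index `0` breaks down only if `γ = -k` for a natural number `k`. Then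
the series starts at `N = k + 1 = 1 - γ`, the larger exponent, where no logarithm can occur: at `n =
k` the factor `n + γ` vanishes, so the jump from `0` to `1` is allowed. -/
theorem exists_coeff (α β γ : ℂ) : ∃ (N : ℕ) (v : ℕ → ℂ), (∀ n < N, v n = 0) ∧ v N = 1 ∧
    (∀ n ≥ N, n + γ ≠ 0) ∧
    ∀ n : ℕ, (n + 1) * (n + γ) * v (n + 1) = (n + α) * (n + β) * v n := by
  obtain ⟨N, hN, hN'⟩ : ∃ N : ℕ, (∀ n ≥ N, (n : ℂ) + γ ≠ 0) ∧
      ∀ n : ℕ, n + 1 = N → (n : ℂ) + γ = 0 := by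
    by_cases h : ∃ k : ℕ, (k : ℂ) + γ = 0
    · obtain ⟨k, hk⟩ := h
      refine ⟨k + 1, fun n hn h => ?_, fun n hn => by rwa [Nat.succ_injective hn]⟩
      have : (n : ℂ) = k := by linear_combination h - hk
      rw [Nat.cast_inj] at this
      omega
    · push Not at h
      exact ⟨0, fun n _ => h n, fun n hn => absurd hn (Nat.succ_ne_zero n)⟩
  let w : ℕ → ℂ := fun j => Nat.rec 1 (fun j x =>
    ((N + j : ℕ) + α) * ((N + j : ℕ) + β) / (((N + j : ℕ) + 1) * ((N + j : ℕ) + γ)) * x) j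
  have hw : ∀ j, w (j + 1) =
    ((N + j : ℕ) + α) * ((N + j : ℕ) + β) / (((N + j : ℕ) + 1) * ((N + j : ℕ) + γ)) * w j :=
    fun j => rfl
  refine ⟨N, fun n => if n < N then 0 else w (n - N), fun n hn => if_pos hn, by simp [w], hN,
    fun n => ?_⟩
  dsimp only
  rcases lt_trichotomy (n + 1) N with h | h | h
  · rw [if_pos h, if_pos (by omega)]
    simp
  · rw [hN' n h, if_pos (by omega : n < N)]
    simp
  · rw [if_neg (by omega), if_neg (by omega)]
    obtain ⟨j, rfl⟩ : ∃ j, n = N + j := ⟨n - N, by omega⟩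
    have e : N + j + 1 - N = j + 1 := by omega
    have e' : N + j - N = j := by omega
    have h1 := hN (N + j) (by omega)
    have h2 : ((N + j : ℕ) : ℂ) + 1 ≠ 0 := Nat.cast_add_one_ne_zero _
    rw [e, e', hw]
    field_simp

/-- Ratio test: consecutive coefficients have ratio tending to `1`, eventually below `exp (δ/2)` in
norm, so the weighted terms shrink by at least `exp (-δ/2)`. -/
theorem subexpGrowth_of_recurrence {N : ℕ} {v : ℕ → ℂ} (h0 : ∀ n ≥ N, (n : ℂ) + γ ≠ 0)
    (h : ∀ n : ℕ, (n + 1) * (n + γ) * v (n + 1) = (n + α) * (n + β) * v n) : SubexpGrowth v := by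
  intro δ hδ
  have hlim : Tendsto (fun n : ℕ => ((n : ℂ) + α) * (n + β) / ((n + 1) * (n + γ))) atTop
      (𝓝 1) := by
    have key : ∀ c : ℂ, Tendsto (fun n : ℕ => 1 + c / (n : ℂ)) atTop (𝓝 1) := fun c => by
      simpa using (tendsto_const_div_atTop_nhds_zero_nat c).const_add 1
    have h1 := ((key α).mul (key β)).div ((key 1).mul (key γ)) (by norm_num)
    simp only [mul_one, div_one] at h1
    refine h1.congr' ?_
    filter_upwards [eventually_ge_atTop (max N 1)] with n hn
    have hn1 : (n : ℂ) ≠ 0 := by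
      rw [Nat.cast_ne_zero]
      have := le_of_max_le_right hn
      omega
    have hn2 := h0 n (le_of_max_le_left hn)
    have hn3 : (n : ℂ) + 1 ≠ 0 := Nat.cast_add_one_ne_zero _
    simp only [Pi.div_apply]
    have : 1 + γ / n ≠ 0 := by
      intro h
      apply hn2
      field_simp at h
      simpa using h
    have : (1 : ℂ) + 1 / n ≠ 0 := by
      intro h
      apply hn3
      field_simp at h
      simpa using h
    field_simp
  have hr : Real.exp (-δ) < 1 := by
    rw [← Real.exp_zero]
    exact Real.exp_lt_exp.2 (by linarith)
  have hev := hlim.norm.eventually_lt_const (u := Real.exp (δ / 2)) (by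
    rw [norm_one, ← Real.exp_zero]
    exact Real.exp_lt_exp.2 (by linarith))
  refine summable_of_ratio_norm_eventually_le (r := Real.exp (-(δ / 2)))
    (by rw [← Real.exp_zero]; exact Real.exp_lt_exp.2 (by linarith)) ?_
  filter_upwards [hev, eventually_ge_atTop N] with n hn hN
  have h2 : v (n + 1) = ((n : ℂ) + α) * (n + β) / ((n + 1) * (n + γ)) * v n := by
    have := h0 n hN
    have : (n : ℂ) + 1 ≠ 0 := Nat.cast_add_one_ne_zero _
    field_simp
    linear_combination h n
  rw [norm_mul, norm_mul, norm_norm, norm_norm, Real.norm_of_nonneg (Real.exp_pos _).le,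
    Real.norm_of_nonneg (Real.exp_pos _).le, h2, norm_mul]
  have h3 : Real.exp (-((n + 1 : ℕ) * δ)) = Real.exp (-δ) * Real.exp (-(n * δ)) := by
    rw [← Real.exp_add]
    congr 1
    push_cast
    ring
  have h4 : Real.exp (-(δ / 2)) = Real.exp (δ / 2) * Real.exp (-δ) := by
    rw [← Real.exp_add]
    congr 1
    ring
  rw [h3, h4]
  calc _ = ‖((n : ℂ) + α) * (n + β) / ((n + 1) * (n + γ))‖ *
        (‖v n‖ * (Real.exp (-δ) * Real.exp (-(n * δ)))) := by ring
    _ ≤ Real.exp (δ / 2) * (‖v n‖ * (Real.exp (-δ) * Real.exp (-(n * δ)))) :=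
        mul_le_mul_of_nonneg_right hn.le (by positivity)
    _ = _ := by ring

/-- After division by `exp (N s)`, the series tends to its leading coefficient `1` as `s = -(m + 1)`
goes to `-∞`, by dominated convergence. -/
theorem exists_expSeries_ne_zero {N : ℕ} {v : ℕ → ℂ} (hv : SubexpGrowth v)
    (h0 : ∀ n < N, v n = 0) (h1 : v N = 1) : ∃ s ∈ leftHalf, expSeries v s ≠ 0 := by
  let f : ℕ → ℕ → ℂ := fun m n => v (n + N) * Complex.exp (n * (-(m + 1 : ℕ) : ℂ))
  have hmem : ∀ m : ℕ, (-(m + 1 : ℕ) : ℂ) ∈ leftHalf := fun m => by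
    change ((-(m + 1 : ℕ) : ℂ)).re < 0
    rw [Complex.neg_re, Complex.natCast_re, neg_lt_zero]
    positivity
  have hlim : Tendsto (fun m => ∑' n, f m n) atTop (𝓝 (∑' n, if n = 0 then (1 : ℂ) else 0)) := by
    refine tendsto_tsum_of_dominated_convergence
      (bound := fun n => Real.exp N * (‖v (n + N)‖ * Real.exp (-((n + N : ℕ) * 1)))) ?_ ?_ ?_
    · exact (((summable_nat_add_iff N).2 (hv 1 one_pos))).mul_left _
    · intro n
      by_cases hn : n = 0
      · subst hn
        simp [f, h1]
      · rw [if_neg hn]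
        have : Tendsto (fun m : ℕ => Complex.exp (n * (-(m + 1 : ℕ) : ℂ))) atTop (𝓝 0) := by
          rw [tendsto_zero_iff_norm_tendsto_zero]
          simp only [Complex.norm_exp]
          refine Real.tendsto_exp_atBot.comp ?_
          have e : ∀ m : ℕ, ((n : ℂ) * (-(m + 1 : ℕ) : ℂ)).re = -((n : ℝ) * ((m + 1 : ℕ) : ℝ)) := by
            intro m
            rw [← Complex.ofReal_natCast, ← Complex.ofReal_natCast, ← Complex.ofReal_neg,
              ← Complex.ofReal_mul, Complex.ofReal_re]
            ring
          simp only [e]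
          refine tendsto_neg_atTop_atBot.comp (Tendsto.const_mul_atTop (by positivity) ?_)
          exact tendsto_natCast_atTop_atTop.comp (tendsto_add_atTop_nat 1)
        have h3 := this.const_mul (v (n + N))
        rwa [mul_zero] at h3
    · refine Eventually.of_forall fun m n => ?_
      refine (norm_term_le (fun n => v (n + N)) (δ := 1) ?_ n).trans_eq ?_
      · rw [Complex.neg_re, Complex.natCast_re]
        push_cast
        linarith [Nat.cast_nonneg (α := ℝ) m]
      · have : Real.exp (-((n : ℝ) * 1)) = Real.exp N * Real.exp (-((n + N : ℕ) * 1)) := by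
          rw [← Real.exp_add]
          congr 1
          push_cast
          ring
        rw [this]
        ring
  rw [tsum_ite_eq] at hlim
  obtain ⟨m, hm⟩ := (hlim.eventually_ne one_ne_zero).exists
  refine ⟨_, hmem m, fun h => hm ?_⟩
  rw [expSeries, ← (hv.summable (hmem m)).sum_add_tsum_nat_add N,
    Finset.sum_eq_zero fun i hi => by rw [h0 i (Finset.mem_range.1 hi), zero_mul], zero_add] at h
  have h2 : ∀ n : ℕ, v (n + N) * Complex.exp ((n + N : ℕ) * (-(m + 1 : ℕ) : ℂ)) =
      Complex.exp (N * (-(m + 1 : ℕ) : ℂ)) * f m n := fun n => by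
    simp only [f]
    rw [mul_left_comm, ← Complex.exp_add]
    congr 2
    push_cast
    ring
  rw [tsum_congr h2, tsum_mul_left] at h
  exact (mul_eq_zero.1 h).resolve_left (Complex.exp_ne_zero _)

/-- Frobenius: there is always a solution that is invariant under the local monodromy. -/
theorem exists_periodic_isLogSol (α β γ : ℂ) : ∃ G, IsLogSol α β γ G ∧
    (∃ s ∈ leftHalf, G s ≠ 0) ∧ ∀ s, G (s + 2 * Real.pi * Complex.I) = G s := by
  obtain ⟨N, v, h0, h1, h2, h3⟩ := exists_coeff α β γ
  have hv := subexpGrowth_of_recurrence h2 h3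
  exact ⟨expSeries v, isLogSol_expSeries hv h3, exists_expSeries_ne_zero hv h0 h1,
    expSeries_periodic v⟩

/-! ### Local monodromy from initial data -/

section LinearOde

variable {α β γ : ℂ} {V : Type*} [AddCommGroup V] [Module ℂ V]

/-- The value and the derivative of the function attached to a vector. -/
def initialData (Φ : V →ₗ[ℂ] (ℂ → ℂ)) (hΦ : ∀ F, DifferentiableOn ℂ (Φ F) leftHalf) (s₀ : ℂ)
    (hs : s₀ ∈ leftHalf) : V →ₗ[ℂ] (Fin 2 → ℂ) where
  toFun F := ![Φ F s₀, deriv (Φ F) s₀]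
  map_add' F F' := by
    have h : ∀ F, DifferentiableAt ℂ (Φ F) s₀ := fun F =>
      (hΦ F).differentiableAt (isOpen_leftHalf.mem_nhds hs)
    rw [map_add, deriv_add (h F) (h F')]
    ext i
    fin_cases i <;> rfl
  map_smul' k F := by
    rw [map_smul, deriv_const_smul_field]
    ext i
    fin_cases i <;> rfl

theorem neg_one_mem_leftHalf : (-1 : ℂ) ∈ leftHalf := by
  change (-1 : ℂ).re < 0
  simp

section

variable {Φ : V →ₗ[ℂ] (ℂ → ℂ)} (hsol : ∀ F, IsLogSol α β γ (Φ F))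
  (hinj : ∀ F, Set.EqOn (Φ F) 0 leftHalf → F = 0)
include hsol hinj

theorem initialData_injective {s₀ : ℂ} (hs : s₀ ∈ leftHalf) :
    Function.Injective (initialData Φ (fun F => (hsol F).1) s₀ hs) := by
  rw [injective_iff_map_eq_zero]
  intro F hF
  have h0 : Φ F s₀ = 0 := congrFun hF 0
  have h1 : deriv (Φ F) s₀ = 0 := congrFun hF 1
  exact hinj F ((hsol F).eqOn_zero hs h0 h1)

theorem finiteDimensional_of_isLogSol : FiniteDimensional ℂ V :=
  FiniteDimensional.of_injective _
    (initialData_injective hsol hinj neg_one_mem_leftHalf)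

theorem finrank_le_two_of_isLogSol : Module.finrank ℂ V ≤ 2 := by
  simpa using LinearMap.finrank_le_finrank_of_injective
    (initialData_injective hsol hinj neg_one_mem_leftHalf)

/-- The local monodromy of the hypergeometric equation at a puncture with exponents `0, 1 - γ`. -/
theorem local_monodromy {T : V →ₗ[ℂ] V}
    (hT : ∀ F, ∀ s ∈ leftHalf, Φ (T F) s = Φ F (s + 2 * Real.pi * Complex.I))
    (hdim : Module.finrank ℂ V = 2) :
    (∃ F, F ≠ 0 ∧ T F = F) ∧
      LinearMap.det T = Complex.exp (2 * Real.pi * Complex.I * (1 - γ)) := by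
  have hs := neg_one_mem_leftHalf
  have := finiteDimensional_of_isLogSol hsol hinj
  let ev : V ≃ₗ[ℂ] (Fin 2 → ℂ) := LinearEquiv.ofInjectiveOfFinrankEq _
    (initialData_injective hsol hinj hs) (by simp [hdim])
  have hev : ∀ F, ev F = ![Φ F (-1), deriv (Φ F) (-1)] := fun F => rfl
  constructor
  -- In dimension 2, initial data at `-1` identify `V` with all solutions on the half plane. So the
  -- periodic series solution comes from a vector, which `T` must fix.
  · obtain ⟨G, hG, ⟨s, hs', hGs⟩, hper⟩ := exists_periodic_isLogSol α β γ
    obtain ⟨F, hF⟩ := ev.surjective ![G (-1), deriv G (-1)]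
    rw [hev] at hF
    have h0 : Φ F (-1) = G (-1) := congrFun hF 0
    have h1 : deriv (Φ F) (-1) = deriv G (-1) := congrFun hF 1
    have hn := isOpen_leftHalf.mem_nhds hs
    have h2 : Set.EqOn (Φ F - G) 0 leftHalf := by
      refine ((hsol F).sub hG).eqOn_zero hs ?_ ?_
      · rw [Pi.sub_apply, h0, sub_self]
      · rw [deriv_sub ((hsol F).1.differentiableAt hn) (hG.1.differentiableAt hn), h1, sub_self]
    have h3 : ∀ s ∈ leftHalf, Φ F s = G s := fun s hs => sub_eq_zero.1 (h2 hs)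
    refine ⟨F, ?_, ?_⟩
    · rintro rfl
      apply hGs
      rw [← h3 s hs', map_zero]
      rfl
    · rw [← sub_eq_zero]
      refine hinj _ fun s hs => ?_
      rw [map_sub, Pi.sub_apply, hT F s hs, h3 s hs, h3 _ (add_two_pi_I_mem hs), hper, sub_self]
      rfl
  -- In the coordinates `ev`, the matrix of `T` has as columns the initial data of `F₀` and `F₁` at
  -- `-1 + 2πi`. Its determinant is their Wronskian there, and their Wronskian at `-1` is `1`.
  · rw [← LinearMap.det_conj T ev, ← LinearMap.det_toMatrix', Matrix.det_fin_two]
    set F₀ := ev.symm (Pi.single 0 1) with hF₀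
    set F₁ := ev.symm (Pi.single 1 1) with hF₁
    have e0 : ![Φ F₀ (-1), deriv (Φ F₀) (-1)] = Pi.single 0 1 := by
      rw [← hev, hF₀, LinearEquiv.apply_symm_apply]
    have e1 : ![Φ F₁ (-1), deriv (Φ F₁) (-1)] = Pi.single 1 1 := by
      rw [← hev, hF₁, LinearEquiv.apply_symm_apply]
    have a0 : Φ F₀ (-1) = 1 := by simpa using congrFun e0 0
    have a1 : deriv (Φ F₀) (-1) = 0 := by simpa using congrFun e0 1
    have b0 : Φ F₁ (-1) = 0 := by simpa using congrFun e1 0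
    have b1 : deriv (Φ F₁) (-1) = 1 := by simpa using congrFun e1 1
    have hd : ∀ F, deriv (Φ (T F)) (-1) = deriv (Φ F) (-1 + 2 * Real.pi * Complex.I) := by
      intro F
      have : Φ (T F) =ᶠ[𝓝 (-1)] fun s => Φ F (s + 2 * Real.pi * Complex.I) := by
        filter_upwards [isOpen_leftHalf.mem_nhds hs] with s hs using hT F s hs
      rw [this.deriv_eq, deriv_comp_add_const]
    have hW := (hsol F₀).wronskian (hsol F₁) hs rfl
    rw [a0, a1, b0, b1] at hW
    simp only [LinearMap.toMatrix'_apply, LinearMap.coe_comp, Function.comp_apply,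
      LinearEquiv.coe_coe]
    simp only [hev, hd, hT _ _ hs, Matrix.cons_val_zero, Matrix.cons_val_one]
    linear_combination hW

end

end LinearOde

/-! ### Multivalued solutions and their pullback to the half plane -/

instance : SimplyConnectedSpace leftHalf :=
  have := convex_leftHalf.contractibleSpace ⟨-1, neg_one_mem_leftHalf⟩
  SimplyConnectedSpace.ofContractible _

instance : LocallyPathConnectedSpace leftHalf := convex_leftHalf.locallyPathConnectedSpace

/-- Translation by `2πi`, the deck transformation of the exponential map. -/
def deck : C(leftHalf, leftHalf) :=
  ⟨fun s => ⟨s + 2 * Real.pi * Complex.I, add_two_pi_I_mem s.2⟩, by fun_prop⟩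

variable {a b : List ℚ} {x₀ : Base}

theorem IsSolOn.eqOn_zero_of_eventually {y w : ℂ} {r : ℝ} {f : ℂ → ℂ}
    (hf : IsSolOn a b (Metric.ball y r) f) (hw : w ∈ Metric.ball y r)
    (h : ∀ᶠ z in 𝓝 w, f z = 0) : Set.EqOn f 0 (Metric.ball y r) :=
  AnalyticOnNhd.eqOn_zero_of_preconnected_of_eventuallyEq_zero
    (hf.1.analyticOnNhd Metric.isOpen_ball) (convex_ball y r).isPreconnected hw h

theorem eventually_exists_short_path (y : Base) {N : Set Base} (hN : N ∈ 𝓝 y) :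
    ∀ᶠ z in 𝓝 (y : ℂ), ∃ (w : Base) (δ : Path y w), (w : ℂ) = z ∧ ∀ t, δ t ∈ N := by
  obtain ⟨M, hM, hMN⟩ := mem_nhds_subtype _ y N |>.1 hN
  have ho : ({0, 1}ᶜ : Set ℂ) ∈ 𝓝 (y : ℂ) :=
    (Set.toFinite ({0, 1} : Set ℂ)).isClosed.isOpen_compl.mem_nhds y.2
  obtain ⟨ε, hε, h⟩ := Metric.mem_nhds_iff.1 (inter_mem hM ho)
  filter_upwards [Metric.ball_mem_nhds (y : ℂ) hε] with z hz
  have hseg : ∀ t : unitInterval, (y : ℂ) + ((t : ℝ) : ℂ) * (z - y) ∈ Metric.ball (y : ℂ) ε := by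
    intro t
    rw [Metric.mem_ball, dist_eq_norm] at hz ⊢
    rw [add_sub_cancel_left, norm_mul, Complex.norm_real, Real.norm_of_nonneg t.2.1]
    exact (mul_le_of_le_one_left (norm_nonneg _) t.2.2).trans_lt hz
  let δ : Path y (⟨z, (h hz).2⟩ : Base) :=
    { toFun := fun t => ⟨(y : ℂ) + ((t : ℝ) : ℂ) * (z - y), (h (hseg t)).2⟩
      continuous_toFun := by fun_prop
      source' := Subtype.ext (by simp)
      target' := Subtype.ext (by simp) }
  exact ⟨_, δ, rfl, fun t => hMN (h (hseg t)).1⟩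

/-- A multivalued solution that vanishes near one point of the universal cover is zero. -/
theorem eq_zero_of_vanishes_near (F : solSpace a b x₀) {y : Base}
    (c : Path.Homotopic.Quotient x₀ y) {r : ℝ} (hr : 0 < r) {f : ℂ → ℂ}
    (hF : ∀ (w : Base) (δ : Path y w), (∀ t, (δ t : ℂ) ∈ Metric.ball (y : ℂ) r) →
      F.1 w (c.trans (Path.Homotopic.Quotient.mk δ)) = f w)
    (h0 : ∀ᶠ z in 𝓝 (y : ℂ), f z = 0) : F = 0 := by
  let Q : ∀ w, Path.Homotopic.Quotient x₀ w → Prop := fun w c => ∃ N ∈ 𝓝 w,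
    ∀ (w' : Base) (δ : Path w w'), (∀ t, δ t ∈ N) →
      F.1 w' (c.trans (Path.Homotopic.Quotient.mk δ)) = 0
  have nball : ∀ (y : Base) (z : ℂ) (r : ℝ), (y : ℂ) ∈ Metric.ball z r →
      {w : Base | (w : ℂ) ∈ Metric.ball z r} ∈ 𝓝 y := fun y z r h =>
    (Metric.isOpen_ball.preimage continuous_subtype_val).mem_nhds h
  have hQ : ∀ w c, Q w c := by
    refine path_induction Q ?_ c ?_
    · intro w c
      obtain ⟨r, hr, f, hf, hFf⟩ := F.2 w c
      -- On a disc where `F` is given by one holomorphic `f`, the identity theorem makes vanishing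
      -- near any point equivalent to `f = 0` on the disc. Hence `Q` is locally constant along
      -- paths.
      have key : ∀ (w' : Base) (δ : Path w w'), (∀ t, (δ t : ℂ) ∈ Metric.ball (w : ℂ) r) →
          (Q w' (c.trans (Path.Homotopic.Quotient.mk δ)) ↔
            Set.EqOn f 0 (Metric.ball (w : ℂ) r)) := by
        intro w' δ hδ
        have hw' : (w' : ℂ) ∈ Metric.ball (w : ℂ) r := by simpa using hδ 1
        have hcont : ∀ (w'' : Base) (ε : Path w' w''),
            (∀ t, (ε t : ℂ) ∈ Metric.ball (w : ℂ) r) →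
            F.1 w'' ((c.trans (Path.Homotopic.Quotient.mk δ)).trans
              (Path.Homotopic.Quotient.mk ε)) = f w'' := by
          intro w'' ε hε
          rw [Path.Homotopic.Quotient.trans_assoc, ← Path.Homotopic.Quotient.mk_trans]
          refine hFf w'' (δ.trans ε) fun t => ?_
          have := Set.mem_range_self (f := δ.trans ε) t
          rw [Path.trans_range] at this
          rcases this with ⟨u, hu⟩ | ⟨u, hu⟩
          · rw [← hu]
            exact hδ u
          · rw [← hu]
            exact hε u
        constructor
        · rintro ⟨N, hN, h⟩
          refine hf.eqOn_zero_of_eventually hw' ?_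
          filter_upwards [eventually_exists_short_path w'
            (inter_mem hN (nball w' w r hw'))] with z hz
          obtain ⟨w'', ε, rfl, hε⟩ := hz
          rw [← hcont w'' ε fun t => (hε t).2]
          exact h w'' ε fun t => (hε t).1
        · intro h
          refine ⟨_, nball w' w r hw', fun w'' ε hε => ?_⟩
          rw [hcont w'' ε hε]
          exact h (by simpa using hε 1)
      refine ⟨_, nball w w r (Metric.mem_ball_self hr), fun w' δ hδ => ?_⟩
      rw [key w' δ hδ, ← key w (Path.refl w) fun t => by simpa using hr,
        Path.Homotopic.Quotient.mk_refl, Path.Homotopic.Quotient.trans_refl]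
    · obtain ⟨M, hM, h⟩ := h0.exists_mem
      refine ⟨{w : Base | (w : ℂ) ∈ Metric.ball (y : ℂ) r ∩ M},
        continuous_subtype_val.continuousAt (inter_mem (Metric.ball_mem_nhds _ hr) hM),
        fun w δ hδ => ?_⟩
      rw [hF w δ fun t => (hδ t).1]
      exact h _ (by simpa using (hδ 1).2)
  apply Subtype.ext
  funext w c
  obtain ⟨N, hN, h⟩ := hQ w c
  have := h w (Path.refl w) fun t => mem_of_mem_nhds hN
  rwa [Path.Homotopic.Quotient.mk_refl, Path.Homotopic.Quotient.trans_refl] at this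

section Chart

variable (ψ : C(leftHalf, Base))

/-- The pullback of a multivalued solution along a map from the half plane to the base. -/
def pullback (s₀ : leftHalf) (c : Path.Homotopic.Quotient x₀ (ψ s₀)) :
    solSpace a b x₀ →ₗ[ℂ] (ℂ → ℂ) where
  toFun F := fun s => open Classical in
    if h : s ∈ leftHalf then F.1 (ψ ⟨s, h⟩) (c.trans (pathClass ψ s₀ ⟨s, h⟩)) else 0
  map_add' F F' := by
    ext s
    by_cases h : s ∈ leftHalf <;> simp [h]
  map_smul' k F := by
    ext s
    by_cases h : s ∈ leftHalf <;> simp [h]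

variable {ψ} {s₀ : leftHalf} {c : Path.Homotopic.Quotient x₀ (ψ s₀)}

theorem pullback_apply (F : solSpace a b x₀) (s : leftHalf) :
    pullback ψ s₀ c F s = F.1 (ψ s) (c.trans (pathClass ψ s₀ s)) :=
  dif_pos s.2

theorem pullback_local (F : solSpace a b x₀) (s : leftHalf) : ∃ r : ℝ, 0 < r ∧ ∃ f : ℂ → ℂ,
    IsSolOn a b (Metric.ball (ψ s : ℂ) r) f ∧
    (∀ (w : Base) (δ : Path (ψ s) w), (∀ t, (δ t : ℂ) ∈ Metric.ball (ψ s : ℂ) r) →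
      F.1 w ((c.trans (pathClass ψ s₀ s)).trans (Path.Homotopic.Quotient.mk δ)) = f w) ∧
    ∀ᶠ s' : leftHalf in 𝓝 s, pullback ψ s₀ c F s' = f (ψ s') := by
  obtain ⟨r, hr, f, hf, hFf⟩ := F.2 (ψ s) (c.trans (pathClass ψ s₀ s))
  refine ⟨r, hr, f, hf, hFf, ?_⟩
  have hN : {w : Base | (w : ℂ) ∈ Metric.ball (ψ s : ℂ) r} ∈ 𝓝 (ψ s) :=
    (Metric.isOpen_ball.preimage continuous_subtype_val).mem_nhds (Metric.mem_ball_self hr)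
  obtain ⟨M, hM, h⟩ := exists_path_in_nhds ψ s hN
  filter_upwards [hM] with s' hs'
  obtain ⟨δ, hδ, hδ'⟩ := h s' hs'
  rw [← hFf _ δ hδ, pullback_apply, hδ', Path.Homotopic.Quotient.trans_assoc, pathClass_trans]

theorem apply_trans_pathClass_congr (F : ∀ y, Path.Homotopic.Quotient x₀ y → ℂ)
    {ψ ψ' : C(leftHalf, Base)} (h : ψ' = ψ) {s₀ : leftHalf}
    {d : Path.Homotopic.Quotient x₀ (ψ' s₀)} {d' : Path.Homotopic.Quotient x₀ (ψ s₀)}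
    (hd : d ≍ d') (s : leftHalf) :
    F (ψ' s) (d.trans (pathClass ψ' s₀ s)) = F (ψ s) (d'.trans (pathClass ψ s₀ s)) := by
  subst h
  rw [eq_of_heq hd]

/-- If `ψ` carries the path from `s₀` to `s₀ + 2πi` to the loop `g`, then continuation along `g` is
translation by `2πi` upstairs. The hypothesis is heterogeneous since `ψ (deck s₀)` and `ψ s₀` are
only propositionally equal. -/
theorem pullback_monodromy (hψ : ψ.comp deck = ψ) {g : FundamentalGroup Base x₀}
    (hg : c.trans (pathClass ψ s₀ (deck s₀)) ≍ (FundamentalGroup.toPath g).trans c)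
    (F : solSpace a b x₀) (s : leftHalf) :
    pullback ψ s₀ c (monodromy a b x₀ g F) s = pullback ψ s₀ c F (deck s) := by
  rw [pullback_apply, pullback_apply, ← pathClass_trans ψ s₀ (deck s₀) (deck s),
    ← pathClass_comp, ← Path.Homotopic.Quotient.trans_assoc]
  have h1 := apply_trans_pathClass_congr F.1 hψ hg s
  rw [Path.Homotopic.Quotient.trans_assoc (FundamentalGroup.toPath g)] at h1
  exact h1.symm

end Chart

/-! ### Charts at the three punctures -/

theorem eulerProd_pair {U : Set ℂ} (hU : IsOpen U) {f : ℂ → ℂ} (hf : DifferentiableOn ℂ f U)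
    (c₁ c₂ : ℂ) {z : ℂ} (hz : z ∈ U) : eulerProd [c₁, c₂] f z =
      z * (deriv f z + z * deriv (deriv f) z + c₂ * deriv f z) + c₁ * (z * deriv f z + c₂ * f z) := by
  have h1 := (hf.differentiableAt (hU.mem_nhds hz)).hasDerivAt
  have h2 := ((hf.deriv hU).differentiableAt (hU.mem_nhds hz)).hasDerivAt
  have h3 : HasDerivAt (fun z => z * deriv f z + c₂ * f z)
      (1 * deriv f z + z * deriv (deriv f) z + c₂ * deriv f z) z :=
    ((hasDerivAt_id z).mul h2).add (h1.const_mul c₂)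
  change z * deriv (fun z => z * deriv f z + c₂ * f z) z + c₁ * (z * deriv f z + c₂ * f z) = _
  rw [h3.deriv, one_mul]

theorem IsSolOn.ode {a₁ a₂ b₁ : ℚ} {U : Set ℂ} (hU : IsOpen U) {f : ℂ → ℂ}
    (hf : IsSolOn [a₁, a₂] [b₁, 1] U f) {z : ℂ} (hz : z ∈ U) :
    z ^ 2 * (1 - z) * deriv (deriv f) z + z * (b₁ - (1 + a₁ + a₂) * z) * deriv f z
      - a₁ * a₂ * z * f z = 0 := by
  have h : eulerProd [(b₁ : ℂ) - 1, ((1 : ℚ) : ℂ) - 1] f z -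
      z * eulerProd [(a₁ : ℂ), (a₂ : ℂ)] f z = 0 := hf.2 z hz
  rw [eulerProd_pair hU hf.1 _ _ hz, eulerProd_pair hU hf.1 _ _ hz] at h
  push_cast at h
  linear_combination h

theorem hasDerivAt_gauge_comp {κ s : ℂ} {f ψ : ℂ → ℂ} {f' ψ' : ℂ} (hψ : HasDerivAt ψ ψ' s)
    (hf : HasDerivAt f f' (ψ s)) : HasDerivAt (fun s => Complex.exp (-κ * s) * f (ψ s))
      (Complex.exp (-κ * s) * (f' * ψ' - κ * f (ψ s))) s := by
  have h1 := (((hasDerivAt_id s).const_mul (-κ)).cexp).mul (hf.comp s hψ)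
  refine h1.congr_deriv ?_
  simp only [id, Function.comp_apply]
  ring

/-- A coordinate `ψ = ψ(s)` near one of the three punctures, defined on the left half plane and
invariant under `s ↦ s + 2πi`, such that multiplication by `exp (-κ s)` transforms the pullback of
the hypergeometric equation with parameters `a₁, a₂; b₁` into the one with parameters `α, β; γ`. -/
structure PunctureChart (a₁ a₂ b₁ : ℚ) (κ α β γ : ℂ) where
  toFun : ℂ → ℂ
  fst : ℂ → ℂ
  snd : ℂ → ℂ
  hasDerivAt_toFun : ∀ s, HasDerivAt toFun (fst s) s
  hasDerivAt_fst : ∀ s, HasDerivAt fst (snd s) s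
  fst_ne_zero : ∀ s, fst s ≠ 0
  mem_base : ∀ s ∈ leftHalf, toFun s ∈ ({0, 1}ᶜ : Set ℂ)
  periodic : ∀ s, toFun (s + 2 * Real.pi * Complex.I) = toFun s
  -- `X, Y, Z` stand for `f, f', f''` at the image point. The conclusion is the equation for `exp
  -- (-κ s) f(ψ(s))` with the exponential divided out.
  ode : ∀ s ∈ leftHalf, ∀ X Y Z : ℂ,
    toFun s ^ 2 * (1 - toFun s) * Z + toFun s * (b₁ - (1 + a₁ + a₂) * toFun s) * Y
      - a₁ * a₂ * toFun s * X = 0 →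
    (1 - Complex.exp s) * (Z * fst s ^ 2 + Y * snd s - 2 * κ * (Y * fst s) + κ ^ 2 * X) +
      ((γ - 1) - (α + β) * Complex.exp s) * (Y * fst s - κ * X) - α * β * Complex.exp s * X = 0

namespace PunctureChart

variable {a₁ a₂ b₁ : ℚ} {κ α β γ : ℂ} (C : PunctureChart a₁ a₂ b₁ κ α β γ) {x₀ : Base}

/-- The chart as a continuous map into the base. -/
def map : C(leftHalf, Base) :=
  ⟨fun s => ⟨C.toFun s, C.mem_base s s.2⟩, by
    have : Continuous C.toFun :=
      continuous_iff_continuousAt.2 fun s => (C.hasDerivAt_toFun s).continuousAt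
    fun_prop⟩

theorem map_comp_deck : C.map.comp deck = C.map := by
  ext s
  exact C.periodic s

/-- The pullback of solutions along a chart, multiplied by `exp (-κ s)`. -/
def gaugedPullback (s₀ : leftHalf) (c : Path.Homotopic.Quotient x₀ (C.map s₀)) :
    solSpace [a₁, a₂] [b₁, 1] x₀ →ₗ[ℂ] (ℂ → ℂ) :=
  (LinearMap.mulLeft ℂ fun s => Complex.exp (-κ * s)) ∘ₗ pullback C.map s₀ c

variable (s₀ : leftHalf) (c : Path.Homotopic.Quotient x₀ (C.map s₀))

theorem gaugedPullback_apply (F : solSpace [a₁, a₂] [b₁, 1] x₀) (s : ℂ) :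
    C.gaugedPullback s₀ c F s = Complex.exp (-κ * s) * pullback C.map s₀ c F s := rfl

theorem isLogSol_gaugedPullback (F : solSpace [a₁, a₂] [b₁, 1] x₀) :
    IsLogSol α β γ (C.gaugedPullback s₀ c F) := by
  have key : ∀ s ∈ leftHalf, DifferentiableAt ℂ (C.gaugedPullback s₀ c F) s ∧
      (1 - Complex.exp s) * deriv (deriv (C.gaugedPullback s₀ c F)) s +
        ((γ - 1) - (α + β) * Complex.exp s) * deriv (C.gaugedPullback s₀ c F) s
        - α * β * Complex.exp s * C.gaugedPullback s₀ c F s = 0 := by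
    intro s hs
    obtain ⟨r, hr, f, hf, -, hloc⟩ := pullback_local (c := c) F ⟨s, hs⟩
    change IsSolOn _ _ (Metric.ball (C.toFun s) r) f at hf
    have hloc' : C.gaugedPullback s₀ c F =ᶠ[𝓝 s]
        fun s => Complex.exp (-κ * s) * f (C.toFun s) := by
      obtain ⟨M, hM, h⟩ := hloc.exists_mem
      obtain ⟨M', hM', hMM'⟩ := mem_nhds_subtype _ _ _ |>.1 hM
      filter_upwards [hM', isOpen_leftHalf.mem_nhds hs] with w hw hw'
      rw [gaugedPullback_apply]
      congr 1
      exact h ⟨w, hw'⟩ (hMM' hw)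
    have hball : ∀ᶠ w in 𝓝 s, C.toFun w ∈ Metric.ball (C.toFun s) r :=
      (C.hasDerivAt_toFun s).continuousAt (Metric.ball_mem_nhds _ hr)
    have d1 : ∀ w, C.toFun w ∈ Metric.ball (C.toFun s) r → HasDerivAt
        (fun s => Complex.exp (-κ * s) * f (C.toFun s))
        (Complex.exp (-κ * w) * (deriv f (C.toFun w) * C.fst w - κ * f (C.toFun w))) w :=
      fun w hw => hasDerivAt_gauge_comp (C.hasDerivAt_toFun w)
        (hf.1.differentiableAt (Metric.isOpen_ball.mem_nhds hw)).hasDerivAt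
    have hs0 := hball.self_of_nhds
    have e1 : deriv (C.gaugedPullback s₀ c F) =ᶠ[𝓝 s] fun w =>
        (Complex.exp (-κ * w) * deriv f (C.toFun w)) * C.fst w -
          κ * (Complex.exp (-κ * w) * f (C.toFun w)) := by
      filter_upwards [hloc'.eventuallyEq_nhds, hball] with w hw hw'
      rw [hw.deriv_eq, (d1 w hw').deriv]
      ring
    have d2 := hasDerivAt_gauge_comp (κ := κ) (C.hasDerivAt_toFun s)
      ((hf.1.deriv Metric.isOpen_ball).differentiableAt
        (Metric.isOpen_ball.mem_nhds hs0)).hasDerivAt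
    have d3 := (d2.mul (C.hasDerivAt_fst s)).sub ((d1 s hs0).const_mul κ)
    refine ⟨(d1 s hs0).differentiableAt.congr_of_eventuallyEq hloc', ?_⟩
    have e2 : deriv (deriv (C.gaugedPullback s₀ c F)) s = _ := e1.deriv_eq.trans d3.deriv
    rw [e2, e1.self_of_nhds, hloc'.self_of_nhds]
    have := C.ode s hs _ _ _ (hf.ode Metric.isOpen_ball hs0)
    linear_combination Complex.exp (-κ * s) * this
  exact ⟨fun s hs => (key s hs).1.differentiableWithinAt, fun s hs => (key s hs).2⟩

/-- The chart has nonzero derivative, so it maps neighbourhoods of `s₀` onto neighbourhoods of its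
image. Vanishing upstairs thus gives vanishing near one point of the universal cover, which suffices
by `eq_zero_of_vanishes_near`. -/
theorem gaugedPullback_injective (F : solSpace [a₁, a₂] [b₁, 1] x₀)
    (hF : Set.EqOn (C.gaugedPullback s₀ c F) 0 leftHalf) : F = 0 := by
  obtain ⟨r, hr, f, hf, hFf, hloc⟩ := pullback_local (c := c) F s₀
  refine eq_zero_of_vanishes_near F _ hr hFf ?_
  have hs : HasStrictDerivAt C.toFun (C.fst s₀) s₀ :=
    (Differentiable.analyticAt (fun s => (C.hasDerivAt_toFun s).differentiableAt)
      (s₀ : ℂ)).hasStrictDerivAt.congr_deriv (C.hasDerivAt_toFun s₀).deriv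
  have h1 := hs.map_nhds_eq (C.fst_ne_zero s₀)
  change ∀ᶠ z in 𝓝 (C.toFun s₀), f z = 0
  rw [← h1, eventually_map]
  obtain ⟨M, hM, h⟩ := hloc.exists_mem
  obtain ⟨M', hM', hMM'⟩ := mem_nhds_subtype _ _ _ |>.1 hM
  filter_upwards [hM', isOpen_leftHalf.mem_nhds s₀.2] with w hw hw'
  have h2 : pullback C.map s₀ c F w = f (C.toFun w) := h ⟨w, hw'⟩ (hMM' hw)
  have h3 := hF hw'
  rw [gaugedPullback_apply, h2] at h3
  exact (mul_eq_zero.1 h3).resolve_left (Complex.exp_ne_zero _)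

include C c in
theorem finiteDimensional : FiniteDimensional ℂ (solSpace [a₁, a₂] [b₁, 1] x₀) :=
  finiteDimensional_of_isLogSol (C.isLogSol_gaugedPullback s₀ c) (C.gaugedPullback_injective s₀ c)

include C c in
theorem finrank_le_two : Module.finrank ℂ (solSpace [a₁, a₂] [b₁, 1] x₀) ≤ 2 :=
  finrank_le_two_of_isLogSol (C.isLogSol_gaugedPullback s₀ c) (C.gaugedPullback_injective s₀ c)

/-- An eigenvalue and the determinant of the monodromy around a puncture. -/
theorem monodromy_eigenvalue_det {g : FundamentalGroup Base x₀}
    (hg : c.trans (pathClass C.map s₀ (deck s₀)) ≍ (FundamentalGroup.toPath g).trans c)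
    (hdim : Module.finrank ℂ (solSpace [a₁, a₂] [b₁, 1] x₀) = 2) :
    (∃ F, F ≠ 0 ∧ monodromy [a₁, a₂] [b₁, 1] x₀ g F =
      Complex.exp (2 * Real.pi * Complex.I * κ) • F) ∧
    LinearMap.det (monodromy [a₁, a₂] [b₁, 1] x₀ g) =
      Complex.exp (2 * Real.pi * Complex.I * (2 * κ + 1 - γ)) := by
  -- The gauge factor `exp (-κ s)` is multiplied by `k` under `s ↦ s + 2πi`, so translation of the
  -- gauged functions corresponds to `k` times the monodromy. Undoing this contributes `k⁻¹` to the
  -- eigenvalue and `k⁻²` to the determinant.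
  let k : ℂ := Complex.exp (2 * Real.pi * Complex.I * -κ)
  have hk : Complex.exp (2 * Real.pi * Complex.I * κ) * k = 1 := by
    rw [← Complex.exp_add, ← Complex.exp_zero]
    congr 1
    ring
  obtain ⟨⟨F, hF, hTF⟩, hdet⟩ := local_monodromy (T := k • monodromy [a₁, a₂] [b₁, 1] x₀ g)
    (C.isLogSol_gaugedPullback s₀ c) (C.gaugedPullback_injective s₀ c) (fun F s hs => by
      have h := pullback_monodromy C.map_comp_deck hg F ⟨s, hs⟩
      rw [LinearMap.smul_apply, map_smul, Pi.smul_apply, gaugedPullback_apply,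
        gaugedPullback_apply, smul_eq_mul]
      change _ * (_ * pullback C.map s₀ c (monodromy [a₁, a₂] [b₁, 1] x₀ g F) (⟨s, hs⟩ : leftHalf))
        = _ * pullback C.map s₀ c F (deck ⟨s, hs⟩)
      rw [h, ← mul_assoc, ← Complex.exp_add]
      congr 2
      ring) hdim
  constructor
  · refine ⟨F, hF, ?_⟩
    rw [LinearMap.smul_apply] at hTF
    conv_rhs => rw [← hTF]
    rw [smul_smul, hk, one_smul]
  · rw [LinearMap.det_smul, hdim] at hdet
    have h2 : Complex.exp (2 * Real.pi * Complex.I * (2 * κ + 1 - γ)) =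
        Complex.exp (2 * Real.pi * Complex.I * κ) ^ 2 *
          Complex.exp (2 * Real.pi * Complex.I * (1 - γ)) := by
      rw [← Complex.exp_nat_mul, ← Complex.exp_add]
      congr 1
      push_cast
      ring
    rw [h2, ← hdet, ← mul_assoc, ← mul_pow, hk, one_pow, one_mul]

end PunctureChart

/-- The chart `z = exp s` around `0`. -/
def chartZero (a₁ a₂ b₁ : ℚ) : PunctureChart a₁ a₂ b₁ 0 a₁ a₂ b₁ where
  toFun := Complex.exp
  fst := Complex.exp
  snd := Complex.exp
  hasDerivAt_toFun := Complex.hasDerivAt_exp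
  hasDerivAt_fst := Complex.hasDerivAt_exp
  fst_ne_zero := Complex.exp_ne_zero
  mem_base s hs := by
    rintro (h | h)
    · exact Complex.exp_ne_zero s h
    · exact one_sub_exp_ne_zero hs (sub_eq_zero.2 h.symm)
  periodic := Complex.exp_periodic
  ode s _ X Y Z h := by linear_combination h

/-- The chart `z = 1 - exp s` around `1`. -/
def chartOne (a₁ a₂ b₁ : ℚ) : PunctureChart a₁ a₂ b₁ 0 a₁ a₂ (a₁ + a₂ + 1 - b₁) where
  toFun s := 1 - Complex.exp s
  fst s := -Complex.exp s
  snd s := -Complex.exp s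
  hasDerivAt_toFun s := (Complex.hasDerivAt_exp s).const_sub 1
  hasDerivAt_fst s := (Complex.hasDerivAt_exp s).neg
  fst_ne_zero s := neg_ne_zero.2 (Complex.exp_ne_zero s)
  mem_base s hs := by
    rintro (h | h)
    · exact one_sub_exp_ne_zero hs h
    · exact Complex.exp_ne_zero s (sub_eq_self.1 h)
  periodic s := by rw [Complex.exp_periodic s]
  ode s hs X Y Z h := by
    apply mul_left_cancel₀ (one_sub_exp_ne_zero hs)
    linear_combination Complex.exp s * h

/-- The chart `z = exp (-s)` around `∞`. -/
def chartInfty (a₁ a₂ b₁ : ℚ) : PunctureChart a₁ a₂ b₁ a₁ a₁ (a₁ - b₁ + 1) (a₁ - a₂ + 1) where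
  -- Kummer's solution `z^(-a₁) ₂F₁(a₁, a₁ - b₁ + 1; a₁ - a₂ + 1; 1/z)` explains the parameters:
  -- with `z = exp (-s)` the prefactor is `exp (a₁ s)`, removed by `κ = a₁`.
  toFun s := Complex.exp (-s)
  fst s := -Complex.exp (-s)
  snd s := Complex.exp (-s)
  hasDerivAt_toFun s := by simpa using (hasDerivAt_neg s).cexp
  hasDerivAt_fst s := (hasDerivAt_neg s).cexp.neg.congr_deriv (by ring)
  fst_ne_zero s := neg_ne_zero.2 (Complex.exp_ne_zero _)
  mem_base s hs := by
    rintro (h | h)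
    · exact Complex.exp_ne_zero _ h
    · rw [Set.mem_singleton_iff, Complex.exp_neg, inv_eq_one] at h
      exact one_sub_exp_ne_zero hs (sub_eq_zero.2 h.symm)
  periodic s := by rw [neg_add, ← sub_eq_add_neg, Complex.exp_periodic.sub_eq]
  ode s hs X Y Z h := by
    have e : Complex.exp s * Complex.exp (-s) = 1 := by
      rw [← Complex.exp_add, add_neg_cancel, Complex.exp_zero]
    have h2 : Complex.exp (-s) = (Complex.exp s)⁻¹ := Complex.exp_neg s
    have h3 := Complex.exp_ne_zero s
    rw [h2] at h ⊢
    field_simp at h ⊢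
    linear_combination -h

/-! ### Identification of the loops around the punctures -/

theorem mem_upperDom_of_im_nonneg {z : ℂ} (hz : z ∈ ({0, 1}ᶜ : Set ℂ)) (h : 0 ≤ z.im) :
    z ∈ upperDom := by
  constructor
  · rintro ⟨h1, h2⟩
    have h3 := le_antisymm h1 h
    rw [h3, zero_div] at h2
    exact hz (Or.inl (Complex.ext h2 h3))
  · rintro ⟨h1, h2⟩
    have h3 := le_antisymm h1 h
    rw [h3, neg_zero, zero_div, sub_eq_zero] at h2
    exact hz (Or.inr (Complex.ext h2 h3))

theorem mem_lowerDom_of_im_nonpos {z : ℂ} (hz : z ∈ ({0, 1}ᶜ : Set ℂ)) (h : z.im ≤ 0) :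
    z ∈ lowerDom := by
  constructor
  · rintro ⟨h1, h2⟩
    have h3 := le_antisymm h h1
    rw [h3, neg_zero, zero_div] at h2
    exact hz (Or.inl (Complex.ext h2 h3))
  · rintro ⟨h1, h2⟩
    have h3 := le_antisymm h h1
    rw [h3, zero_div, sub_eq_zero] at h2
    exact hz (Or.inr (Complex.ext h2 h3))

/-- Translation by `πi`, half of the deck transformation. -/
def halfDeck (s : leftHalf) : leftHalf :=
  ⟨s + Real.pi * Complex.I, by
    have h : (s : ℂ).re < 0 := s.2
    change ((s : ℂ) + Real.pi * Complex.I).re < 0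
    simpa using h⟩

theorem halfDeck_im (s : leftHalf) : (halfDeck s : ℂ).im = (s : ℂ).im + Real.pi := by
  simp [halfDeck]

theorem deck_im (s : leftHalf) : (deck s : ℂ).im = (s : ℂ).im + 2 * Real.pi := by
  simp [deck]

theorem pathClass_eq_within {A : Set ℂ} [SimplyConnectedSpace A] (hA : A ⊆ {0, 1}ᶜ)
    (ψ : C(leftHalf, Base)) {s s' : leftHalf} (hle : (s : ℂ).im ≤ (s' : ℂ).im)
    (h : ∀ w : leftHalf, (s : ℂ).im ≤ (w : ℂ).im → (w : ℂ).im ≤ (s' : ℂ).im → (ψ w : ℂ) ∈ A) :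
    pathClass ψ s s' = within hA (ψ s) (ψ s') (h s le_rfl hle) (h s' hle le_rfl) := by
  have hseg : ∀ t : unitInterval, (s : ℂ) + ((t : ℝ) : ℂ) * (s' - s) ∈ leftHalf := by
    intro t
    have := convex_leftHalf.add_smul_sub_mem s.2 s'.2 t.2
    simpa using this
  let δ : Path s s' :=
    { toFun := fun t => ⟨(s : ℂ) + ((t : ℝ) : ℂ) * (s' - s), hseg t⟩
      continuous_toFun := by fun_prop
      source' := Subtype.ext (by simp)
      target' := Subtype.ext (by simp) }
  rw [← mk_map_eq_pathClass ψ δ]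
  refine mk_eq_within hA _ (fun t => h (δ t) ?_ ?_) _ _
  all_goals
    have him : (δ t : ℂ).im = (s : ℂ).im + t * ((s' : ℂ).im - (s : ℂ).im) := by
      change ((s : ℂ) + ((t : ℝ) : ℂ) * (s' - s)).im = _
      simp
    rw [him]
  · have := mul_nonneg t.2.1 (sub_nonneg.2 hle)
    linarith
  · have := mul_le_of_le_one_left (sub_nonneg.2 hle) t.2.2
    linarith

/-- The loop around a puncture, as the composition of two half turns. -/
theorem loop_heq {x₀ : Base} {A B : Set ℂ} [SimplyConnectedSpace A] [SimplyConnectedSpace B]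
    (hA : A ⊆ {0, 1}ᶜ) (hB : B ⊆ {0, 1}ᶜ) {ψ : C(leftHalf, Base)} (hψ : ψ.comp deck = ψ)
    {s : leftHalf} (c : Path.Homotopic.Quotient x₀ (ψ s))
    (h1 : ∀ w : leftHalf, (s : ℂ).im ≤ (w : ℂ).im → (w : ℂ).im ≤ (s : ℂ).im + Real.pi →
      (ψ w : ℂ) ∈ A)
    (h2 : ∀ w : leftHalf, (s : ℂ).im + Real.pi ≤ (w : ℂ).im →
      (w : ℂ).im ≤ (s : ℂ).im + 2 * Real.pi → (ψ w : ℂ) ∈ B)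
    (hs : (ψ s : ℂ) ∈ A) (hs' : (ψ s : ℂ) ∈ B) (hm : (ψ (halfDeck s) : ℂ) ∈ A)
    (hm' : (ψ (halfDeck s) : ℂ) ∈ B) :
    c.trans (pathClass ψ s (deck s)) ≍ (FundamentalGroup.toPath (FundamentalGroup.fromPath
      (((c.trans (within hA (ψ s) (ψ (halfDeck s)) hs hm)).trans
        (within hB (ψ (halfDeck s)) (ψ s) hm' hs')).trans c.symm))).trans c := by
  have hpi := Real.pi_pos
  have e1 : pathClass ψ s (halfDeck s) = within hA (ψ s) (ψ (halfDeck s)) hs hm :=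
    pathClass_eq_within hA ψ (by rw [halfDeck_im]; linarith) (by rwa [halfDeck_im])
  have e2 : ψ (deck s) = ψ s := DFunLike.congr_fun hψ s
  have hd : (ψ (deck s) : ℂ) ∈ B := by rwa [e2]
  have e3 : pathClass ψ (halfDeck s) (deck s) =
      within hB (ψ (halfDeck s)) (ψ (deck s)) hm' hd :=
    pathClass_eq_within hB ψ (by rw [halfDeck_im, deck_im]; linarith)
      (by rwa [halfDeck_im, deck_im])
  rw [← pathClass_trans ψ s (halfDeck s) (deck s), e1, e3]
  change _ ≍ ((_ : Path.Homotopic.Quotient x₀ (ψ s)).trans c.symm).trans c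
  rw [Path.Homotopic.Quotient.trans_assoc _ c.symm c, Path.Homotopic.Quotient.symm_trans,
    Path.Homotopic.Quotient.trans_refl, ← Path.Homotopic.Quotient.trans_assoc]
  generalize c.trans (within hA (ψ s) (ψ (halfDeck s)) hs hm) = c'
  clear e3
  revert hd
  generalize ψ (deck s) = y at e2 ⊢
  subst e2
  exact fun _ => HEq.rfl

section Loops

variable {x₀ : Base} (d : Path.Homotopic.Quotient x₀ midPt)

theorem realLoop_congr_left {x y : ℝ} (hx : x < 0) (hy : y < 0) (hx1 : x ≠ 1) (hy1 : y ≠ 1) :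
    realLoop d x hx.ne hx1 = realLoop d y hy.ne hy1 := by
  rw [realLoop, realLoop, crossLoop_real_left hx hy hx1 hy1]

theorem realLoop_congr_right {x y : ℝ} (hx : 1 < x) (hy : 1 < y) (hx0 : x ≠ 0) (hy0 : y ≠ 0) :
    realLoop d x hx0 hx.ne' = realLoop d y hy0 hy.ne' := by
  rw [realLoop, realLoop, crossLoop_real_right hx hy hx0 hy0]

theorem symm_trans_class {X : Type*} [TopologicalSpace X] {x y z : X}
    (p : Path.Homotopic.Quotient x y) (q : Path.Homotopic.Quotient y z) :
    (p.trans q).symm = q.symm.trans p.symm := by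
  induction p using Path.Homotopic.Quotient.ind
  induction q using Path.Homotopic.Quotient.ind
  rw [← Path.Homotopic.Quotient.mk_trans, ← Path.Homotopic.Quotient.mk_symm, Path.trans_symm]
  rfl

theorem symm_symm_class {X : Type*} [TopologicalSpace X] {x y : X}
    (p : Path.Homotopic.Quotient x y) : p.symm.symm = p := by
  induction p using Path.Homotopic.Quotient.ind
  rw [← Path.Homotopic.Quotient.mk_symm, ← Path.Homotopic.Quotient.mk_symm, Path.symm_symm]

theorem crossLoop_eq {b y : Base} (hb : (b : ℂ) ∈ upperDom ∩ lowerDom)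
    (hy : (y : ℂ) ∈ upperDom ∩ lowerDom) : crossLoop b y hb hy =
      (within upperDom_subset b y hb.1 hy.1).trans (within lowerDom_subset y b hy.2 hb.2) := rfl

theorem crossLoop_symm {b y : Base} (hb : (b : ℂ) ∈ upperDom ∩ lowerDom)
    (hy : (y : ℂ) ∈ upperDom ∩ lowerDom) : (crossLoop b y hb hy).symm =
      (within lowerDom_subset b y hb.2 hy.2).trans (within upperDom_subset y b hy.1 hb.1) := by
  rw [crossLoop_eq, symm_trans_class, within_symm, within_symm]

theorem loop_zero_eq {y₀ y₁ : Base} {x : ℝ} (h0 : x ≠ 0) (h1 : x ≠ 1) (hy₀ : y₀ = midPt)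
    (hy₁ : y₁ = realPt x h0 h1) (m₀ : (y₀ : ℂ) ∈ upperDom ∩ lowerDom)
    (m₁ : (y₁ : ℂ) ∈ upperDom ∩ lowerDom) :
    FundamentalGroup.fromPath
      ((((d.trans (within upperDom_subset midPt y₀ midPt_mem.1 m₀.1)).trans
        (within upperDom_subset y₀ y₁ m₀.1 m₁.1)).trans (within lowerDom_subset y₁ y₀ m₁.2 m₀.2)).trans
        (d.trans (within upperDom_subset midPt y₀ midPt_mem.1 m₀.1)).symm) = realLoop d x h0 h1 := by
  subst hy₀ hy₁
  rw [within_self, Path.Homotopic.Quotient.trans_refl, Path.Homotopic.Quotient.trans_assoc d]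
  rfl

theorem loop_one_eq {y₀ y₁ : Base} {x : ℝ} (h0 : x ≠ 0) (h1 : x ≠ 1) (hy₀ : y₀ = midPt)
    (hy₁ : y₁ = realPt x h0 h1) (m₀ : (y₀ : ℂ) ∈ upperDom ∩ lowerDom)
    (m₁ : (y₁ : ℂ) ∈ upperDom ∩ lowerDom) :
    FundamentalGroup.fromPath
      ((((d.trans (within upperDom_subset midPt y₀ midPt_mem.1 m₀.1)).trans
        (within lowerDom_subset y₀ y₁ m₀.2 m₁.2)).trans (within upperDom_subset y₁ y₀ m₁.1 m₀.1)).trans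
        (d.trans (within upperDom_subset midPt y₀ midPt_mem.1 m₀.1)).symm) =
      (realLoop d x h0 h1)⁻¹ := by
  subst hy₀ hy₁
  rw [within_self, Path.Homotopic.Quotient.trans_refl, FundamentalGroup.inv_def]
  change _ = Path.Homotopic.Quotient.symm (Path.Homotopic.Quotient.trans _ _)
  rw [symm_trans_class, symm_trans_class, crossLoop_symm, symm_symm_class, Path.Homotopic.Quotient.trans_assoc d, Path.Homotopic.Quotient.trans_assoc d]

/-- The upper path from `y₀` to `y₁` is cut at `1/2`. The first half together with the lower path
from `1/2` to `y₀` is the reversed loop through `x`; the rest is the loop through `y`. Reaching `y₀`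
through the lower slit plane is what makes the pieces match. -/
theorem loop_infty_eq {y₀ y₁ : Base} {x y : ℝ} (h0 : x ≠ 0) (h1 : x ≠ 1) (h0' : y ≠ 0)
    (h1' : y ≠ 1) (hy₀ : y₀ = realPt x h0 h1)
    (hy₁ : y₁ = realPt y h0' h1') (m₀ : (y₀ : ℂ) ∈ upperDom ∩ lowerDom)
    (m₁ : (y₁ : ℂ) ∈ upperDom ∩ lowerDom) :
    FundamentalGroup.fromPath
      ((((d.trans (within lowerDom_subset midPt y₀ midPt_mem.2 m₀.2)).trans
        (within upperDom_subset y₀ y₁ m₀.1 m₁.1)).trans (within lowerDom_subset y₁ y₀ m₁.2 m₀.2)).trans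
        (d.trans (within lowerDom_subset midPt y₀ midPt_mem.2 m₀.2)).symm) =
      realLoop d y h0' h1' * (realLoop d x h0 h1)⁻¹ := by
  subst hy₀ hy₁
  rw [FundamentalGroup.mul_def, FundamentalGroup.inv_def]
  change _ = Path.Homotopic.Quotient.trans (Path.Homotopic.Quotient.symm
    (Path.Homotopic.Quotient.trans _ _)) (Path.Homotopic.Quotient.trans _ _)
  rw [symm_trans_class, symm_trans_class, symm_trans_class, crossLoop_symm, crossLoop_eq,
    within_symm, symm_symm_class,
    ← within_trans upperDom_subset m₀.1 midPt_mem.1 m₁.1]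
  change Path.Homotopic.Quotient.trans _ _ = _
  simp only [Path.Homotopic.Quotient.trans_assoc]
  congr 3
  rw [← Path.Homotopic.Quotient.trans_assoc d.symm d, Path.Homotopic.Quotient.symm_trans,
    Path.Homotopic.Quotient.refl_trans, ← Path.Homotopic.Quotient.trans_assoc (within lowerDom_subset _ _ _ _)
    (within lowerDom_subset _ _ _ _), within_trans]

end Loops

theorem exp_im_nonneg {w : ℂ} (h0 : 0 ≤ w.im) (h1 : w.im ≤ Real.pi) : 0 ≤ (Complex.exp w).im := by
  rw [Complex.exp_im]
  exact mul_nonneg (Real.exp_pos _).le (Real.sin_nonneg_of_nonneg_of_le_pi h0 h1)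

theorem exp_im_nonpos {w : ℂ} (h0 : Real.pi ≤ w.im) (h1 : w.im ≤ 2 * Real.pi) :
    (Complex.exp w).im ≤ 0 := by
  rw [Complex.exp_im]
  refine mul_nonpos_of_nonneg_of_nonpos (Real.exp_pos _).le ?_
  rw [← Real.sin_sub_two_pi]
  exact Real.sin_nonpos_of_nonpos_of_neg_pi_le (by linarith) (by linarith)

theorem exp_log_two_add {n : ℝ} {z : ℂ} (hn : 0 < n) (h : z = Real.log n + Real.pi * Complex.I) :
    Complex.exp z = -n := by
  rw [h, Complex.exp_add, Complex.exp_pi_mul_I, ← Complex.ofReal_exp, Real.exp_log hn]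
  ring

/-- The point over `1/2` in the charts around `0` and `1`. -/
def baseHalf : leftHalf := ⟨(Real.log (1 / 2) : ℝ), by
  change ((Real.log (1 / 2) : ℝ) : ℂ).re < 0
  rw [Complex.ofReal_re]
  exact Real.log_neg (by norm_num) (by norm_num)⟩

/-- The point over `-2` in the chart around `∞`. -/
def baseInfty : leftHalf := ⟨(Real.log (1 / 2) : ℝ) - Real.pi * Complex.I, by
  change ((Real.log (1 / 2) : ℝ) - Real.pi * Complex.I : ℂ).re < 0
  have : Real.log (1 / 2) < 0 := Real.log_neg (by norm_num) (by norm_num)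
  simp only [Complex.sub_re, Complex.ofReal_re, Complex.mul_re, Complex.I_re, Complex.ofReal_im,
    Complex.I_im]
  linarith⟩

theorem baseInfty_im : (baseInfty : ℂ).im = -Real.pi := by
  simp only [baseInfty, Complex.sub_im, Complex.ofReal_re, Complex.mul_im, Complex.I_re,
    Complex.ofReal_im, Complex.I_im]
  ring

theorem exp_baseHalf : Complex.exp baseHalf = (1 / 2 : ℝ) := by
  rw [baseHalf, ← Complex.ofReal_exp, Real.exp_log (by norm_num)]

theorem exp_halfDeck (s : leftHalf) : Complex.exp (halfDeck s) = -Complex.exp s := by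
  rw [halfDeck, Complex.exp_add, Complex.exp_pi_mul_I]
  ring

theorem exp_neg_baseInfty : Complex.exp (-baseInfty) = (-2 : ℝ) := by
  have e : (-baseInfty : ℂ) = (Real.log 2 : ℝ) + Real.pi * Complex.I := by
    have : Real.log (1 / 2) = -Real.log 2 := by rw [one_div, Real.log_inv]
    change -(((Real.log (1 / 2) : ℝ) : ℂ) - Real.pi * Complex.I) = _
    rw [this, Complex.ofReal_neg]
    ring
  rw [e, exp_log_two_add two_pos rfl]
  norm_num

/-! ### Eigenvalues and determinants at `0`, `1`, `∞` -/

section LocalMonodromy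

variable {a₁ a₂ b₁ : ℚ} {x₀ : Base} (d : Path.Homotopic.Quotient x₀ midPt)
  (hdim : Module.finrank ℂ (solSpace [a₁, a₂] [b₁, 1] x₀) = 2)

/-- The loop around `0`. -/
abbrev loopZero : FundamentalGroup Base x₀ := realLoop d (-1 / 2) (by norm_num) (by norm_num)

/-- The loop around `1`, run through clockwise. -/
abbrev loopOne : FundamentalGroup Base x₀ := realLoop d (3 / 2) (by norm_num) (by norm_num)

include hdim

theorem monodromy_loopZero : (∃ F, F ≠ 0 ∧ monodromy [a₁, a₂] [b₁, 1] x₀ (loopZero d) F = F) ∧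
    LinearMap.det (monodromy [a₁, a₂] [b₁, 1] x₀ (loopZero d)) =
      Complex.exp (2 * Real.pi * Complex.I * (1 - b₁)) := by
  let C := chartZero a₁ a₂ b₁
  have y₀ : C.map baseHalf = midPt := Subtype.ext exp_baseHalf
  have y₁ : C.map (halfDeck baseHalf) = realPt (-1 / 2) (by norm_num) (by norm_num) :=
    Subtype.ext ((exp_halfDeck _).trans (by rw [exp_baseHalf]; simp [realPt]; norm_num))
  have m₀ : (C.map baseHalf : ℂ) ∈ upperDom ∩ lowerDom := y₀ ▸ midPt_mem
  have m₁ : (C.map (halfDeck baseHalf) : ℂ) ∈ upperDom ∩ lowerDom :=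
    y₁ ▸ realPt_mem (by norm_num) (by norm_num)
  have him : (baseHalf : ℂ).im = 0 := Complex.ofReal_im _
  have hg := loop_heq upperDom_subset lowerDom_subset C.map_comp_deck (s := baseHalf)
    (d.trans (within upperDom_subset midPt _ midPt_mem.1 m₀.1))
    (fun w h1 h2 => mem_upperDom_of_im_nonneg (C.map w).2
      (exp_im_nonneg (by rwa [him] at h1) (by rwa [him, zero_add] at h2)))
    (fun w h1 h2 => mem_lowerDom_of_im_nonpos (C.map w).2
      (exp_im_nonpos (by rwa [him, zero_add] at h1) (by rwa [him, zero_add] at h2)))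
    m₀.1 m₀.2 m₁.1 m₁.2
  rw [loop_zero_eq d (by norm_num) (by norm_num) y₀ y₁ m₀ m₁] at hg
  have h := C.monodromy_eigenvalue_det baseHalf _ hg hdim
  simpa using h

theorem monodromy_loopOne : (∃ F, F ≠ 0 ∧ monodromy [a₁, a₂] [b₁, 1] x₀ (loopOne d)⁻¹ F = F) ∧
    LinearMap.det (monodromy [a₁, a₂] [b₁, 1] x₀ (loopOne d)⁻¹) =
      Complex.exp (2 * Real.pi * Complex.I * (b₁ - a₁ - a₂)) := by
  let C := chartOne a₁ a₂ b₁
  have y₀ : C.map baseHalf = midPt := Subtype.ext (by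
    change 1 - Complex.exp baseHalf = ((1 / 2 : ℝ) : ℂ)
    rw [exp_baseHalf]; push_cast; norm_num)
  have y₁ : C.map (halfDeck baseHalf) = realPt (3 / 2) (by norm_num) (by norm_num) :=
    Subtype.ext (by
      change 1 - Complex.exp (halfDeck baseHalf) = ((3 / 2 : ℝ) : ℂ)
      rw [exp_halfDeck, exp_baseHalf]; push_cast; norm_num)
  have m₀ : (C.map baseHalf : ℂ) ∈ upperDom ∩ lowerDom := y₀ ▸ midPt_mem
  have m₁ : (C.map (halfDeck baseHalf) : ℂ) ∈ upperDom ∩ lowerDom :=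
    y₁ ▸ realPt_mem (by norm_num) (by norm_num)
  have him : (baseHalf : ℂ).im = 0 := Complex.ofReal_im _
  have hmap : ∀ w, (C.map w : ℂ).im = -(Complex.exp w).im := fun w => by
    change (1 - Complex.exp w).im = _
    simp
  have hg := loop_heq lowerDom_subset upperDom_subset C.map_comp_deck (s := baseHalf)
    (d.trans (within upperDom_subset midPt _ midPt_mem.1 m₀.1))
    (fun w h1 h2 => mem_lowerDom_of_im_nonpos (C.map w).2 (by
      rw [hmap, neg_nonpos]
      exact exp_im_nonneg (by rwa [him] at h1) (by rwa [him, zero_add] at h2)))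
    (fun w h1 h2 => mem_upperDom_of_im_nonneg (C.map w).2 (by
      rw [hmap, neg_nonneg]
      exact exp_im_nonpos (by rwa [him, zero_add] at h1) (by rwa [him, zero_add] at h2)))
    m₀.2 m₀.1 m₁.2 m₁.1
  rw [loop_one_eq d (by norm_num) (by norm_num) y₀ y₁ m₀ m₁] at hg
  have h := C.monodromy_eigenvalue_det baseHalf _ hg hdim
  refine ⟨by simpa using h.1, h.2.trans ?_⟩
  congr 1
  ring

theorem monodromy_loopInfty :
    (∃ F, F ≠ 0 ∧ monodromy [a₁, a₂] [b₁, 1] x₀ (loopOne d * (loopZero d)⁻¹) F =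
      Complex.exp (2 * Real.pi * Complex.I * a₁) • F) ∧
    LinearMap.det (monodromy [a₁, a₂] [b₁, 1] x₀ (loopOne d * (loopZero d)⁻¹)) =
      Complex.exp (2 * Real.pi * Complex.I * (a₁ + a₂)) := by
  let C := chartInfty a₁ a₂ b₁
  have y₀ : C.map baseInfty = realPt (-2) (by norm_num) (by norm_num) :=
    Subtype.ext exp_neg_baseInfty
  have y₁ : C.map (halfDeck baseInfty) = realPt 2 (by norm_num) (by norm_num) :=
    Subtype.ext (by
      change Complex.exp (-halfDeck baseInfty) = ((2 : ℝ) : ℂ)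
      rw [Complex.exp_neg, exp_halfDeck, ← neg_inv, ← Complex.exp_neg, exp_neg_baseInfty]
      push_cast; norm_num)
  have m₀ : (C.map baseInfty : ℂ) ∈ upperDom ∩ lowerDom :=
    y₀ ▸ realPt_mem (by norm_num) (by norm_num)
  have m₁ : (C.map (halfDeck baseInfty) : ℂ) ∈ upperDom ∩ lowerDom :=
    y₁ ▸ realPt_mem (by norm_num) (by norm_num)
  have him : (baseInfty : ℂ).im = -Real.pi := baseInfty_im
  have hmap : ∀ w, (C.map w : ℂ) = Complex.exp (-w) := fun w => rfl
  have hg := loop_heq upperDom_subset lowerDom_subset C.map_comp_deck (s := baseInfty)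
    (d.trans (within lowerDom_subset midPt _ midPt_mem.2 m₀.2))
    (fun w h1 h2 => mem_upperDom_of_im_nonneg (C.map w).2 (by
      rw [him] at h1 h2
      exact exp_im_nonneg (by rw [Complex.neg_im]; linarith) (by rw [Complex.neg_im]; linarith)))
    (fun w h1 h2 => mem_lowerDom_of_im_nonpos (C.map w).2 (by
      rw [him] at h1 h2
      rw [hmap, ← Complex.exp_periodic]
      refine exp_im_nonpos ?_ ?_ <;> simp <;> linarith))
    m₀.1 m₀.2 m₁.1 m₁.2
  rw [loop_infty_eq d (by norm_num) (by norm_num) (by norm_num) (by norm_num) y₀ y₁ m₀ m₁,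
    realLoop_congr_left d (x := -2) (y := -1 / 2) (by norm_num) (by norm_num) (by norm_num)
      (by norm_num),
    realLoop_congr_right d (x := 2) (y := 3 / 2) (by norm_num) (by norm_num) (by norm_num)
      (by norm_num)] at hg
  have h := C.monodromy_eigenvalue_det baseInfty _ hg hdim
  refine ⟨h.1, h.2.trans ?_⟩
  congr 1
  ring

end LocalMonodromy

/-! ### Fricke's trace argument -/

section TraceField

variable (K : IntermediateField ℚ ℂ) (A B : Matrix (Fin 2) (Fin 2) ℂ)

/-- The matrices in the `K`-span of `1, A, B, AB`. -/
def InWordSpan (M : Matrix (Fin 2) (Fin 2) ℂ) : Prop :=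
  ∃ p ∈ K, ∃ q ∈ K, ∃ r ∈ K, ∃ s ∈ K, M = p • 1 + q • A + r • B + s • (A * B)

variable {K A B} {M N : Matrix (Fin 2) (Fin 2) ℂ}

theorem InWordSpan.add (hM : InWordSpan K A B M) (hN : InWordSpan K A B N) :
    InWordSpan K A B (M + N) := by
  obtain ⟨p, hp, q, hq, r, hr, s, hs, rfl⟩ := hM
  obtain ⟨p', hp', q', hq', r', hr', s', hs', rfl⟩ := hN
  exact ⟨_, add_mem hp hp', _, add_mem hq hq', _, add_mem hr hr', _, add_mem hs hs', by module⟩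

theorem InWordSpan.smul {k : ℂ} (hk : k ∈ K) (hM : InWordSpan K A B M) :
    InWordSpan K A B (k • M) := by
  obtain ⟨p, hp, q, hq, r, hr, s, hs, rfl⟩ := hM
  exact ⟨_, mul_mem hk hp, _, mul_mem hk hq, _, mul_mem hk hr, _, mul_mem hk hs, by module⟩

theorem inWordSpan_one : InWordSpan K A B 1 :=
  ⟨1, one_mem K, 0, zero_mem K, 0, zero_mem K, 0, zero_mem K, by module⟩

theorem inWordSpan_left : InWordSpan K A B A :=
  ⟨0, zero_mem K, 1, one_mem K, 0, zero_mem K, 0, zero_mem K, by module⟩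

theorem inWordSpan_right : InWordSpan K A B B :=
  ⟨0, zero_mem K, 0, zero_mem K, 1, one_mem K, 0, zero_mem K, by module⟩

/-- Cayley–Hamilton, `A² = tr(A) A - det(A)`, rewrites the words `A²` and `A²B`. -/
theorem InWordSpan.left_mul (tA : A.trace ∈ K) (dA : A.det ∈ K)
    (hM : InWordSpan K A B M) : InWordSpan K A B (A * M) := by
  obtain ⟨p, hp, q, hq, r, hr, s, hs, rfl⟩ := hM
  refine ⟨-(q * A.det), neg_mem (mul_mem hq dA), p + q * A.trace, add_mem hp (mul_mem hq tA),
    -(s * A.det), neg_mem (mul_mem hs dA), r + s * A.trace, add_mem hr (mul_mem hs tA), ?_⟩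
  ext i j
  fin_cases i <;> fin_cases j <;>
    simp [Matrix.mul_apply, Matrix.trace_fin_two, Matrix.det_fin_two] <;> ring

/-- Polarised Cayley–Hamilton gives `BA = -AB + tr(B) A + tr(A) B + (tr(AB) - tr(A) tr(B))`; with
`B² = tr(B) B - det(B)` it also reduces `BAB` to `det(B) A + tr(AB) B - tr(A) det(B)`. -/
theorem InWordSpan.right_mul (tA : A.trace ∈ K) (tB : B.trace ∈ K) (tAB : (A * B).trace ∈ K)
    (dB : B.det ∈ K) (hM : InWordSpan K A B M) : InWordSpan K A B (B * M) := by
  obtain ⟨p, hp, q, hq, r, hr, s, hs, rfl⟩ := hM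
  refine ⟨q * ((A * B).trace - A.trace * B.trace) - r * B.det - s * A.trace * B.det,
    sub_mem (sub_mem (mul_mem hq (sub_mem tAB (mul_mem tA tB))) (mul_mem hr dB))
      (mul_mem (mul_mem hs tA) dB),
    q * B.trace + s * B.det, add_mem (mul_mem hq tB) (mul_mem hs dB),
    p + q * A.trace + r * B.trace + s * (A * B).trace,
    add_mem (add_mem (add_mem hp (mul_mem hq tA)) (mul_mem hr tB)) (mul_mem hs tAB),
    -q, neg_mem hq, ?_⟩
  ext i j
  fin_cases i <;> fin_cases j <;>
    simp [Matrix.mul_apply, Matrix.trace_fin_two, Matrix.det_fin_two] <;> ring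

theorem InWordSpan.mul (tA : A.trace ∈ K) (tB : B.trace ∈ K) (tAB : (A * B).trace ∈ K)
    (dA : A.det ∈ K) (dB : B.det ∈ K) (hM : InWordSpan K A B M) (hN : InWordSpan K A B N) :
    InWordSpan K A B (M * N) := by
  obtain ⟨p, hp, q, hq, r, hr, s, hs, rfl⟩ := hM
  have hA := hN.left_mul tA dA
  have hB := hN.right_mul tA tB tAB dB
  have hAB := hB.left_mul tA dA
  have e : (p • 1 + q • A + r • B + s • (A * B)) * N =
      p • N + q • (A * N) + r • (B * N) + s • (A * (B * N)) := by
    simp only [add_mul, smul_mul_assoc, one_mul, mul_assoc]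
  rw [e]
  exact (((hN.smul hp).add (hA.smul hq)).add (hB.smul hr)).add (hAB.smul hs)

theorem InWordSpan.trace_mem (tA : A.trace ∈ K) (tB : B.trace ∈ K) (tAB : (A * B).trace ∈ K)
    (hM : InWordSpan K A B M) : M.trace ∈ K := by
  obtain ⟨p, hp, q, hq, r, hr, s, hs, rfl⟩ := hM
  simp only [Matrix.trace_add, Matrix.trace_smul, smul_eq_mul]
  refine add_mem (add_mem (add_mem (mul_mem hp ?_) (mul_mem hq tA)) (mul_mem hr tB)) (mul_mem hs tAB)
  rw [Matrix.trace_one]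
  exact natCast_mem K _

theorem inverse_fin_two {P Q : Matrix (Fin 2) (Fin 2) ℂ} (h : Q * P = 1) :
    P.det ≠ 0 ∧ Q = P.det⁻¹ • (P.trace • 1 - P) := by
  have hd : Q.det * P.det = 1 := by rw [← Matrix.det_mul, h, Matrix.det_one]
  have h0 : P.det ≠ 0 := right_ne_zero_of_mul_eq_one hd
  refine ⟨h0, ?_⟩
  have h1 : P * (P.trace • 1 - P) = P.det • 1 := by
    ext i j
    fin_cases i <;> fin_cases j <;>
      simp [Matrix.mul_apply, Matrix.trace_fin_two, Matrix.det_fin_two] <;> ring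
  have h2 : Q * (P * (P.trace • 1 - P)) = P.trace • 1 - P := by
    rw [← mul_assoc, h, one_mul]
  rw [h1, mul_smul_comm, mul_one] at h2
  rw [← h2, smul_smul, inv_mul_cancel₀ h0, one_smul]

theorem trace_inverse_fin_two {P Q : Matrix (Fin 2) (Fin 2) ℂ} (h : Q * P = 1) :
    Q.trace = P.trace / P.det := by
  rw [(inverse_fin_two h).2, Matrix.trace_smul, Matrix.trace_sub, Matrix.trace_smul,
    Matrix.trace_one, smul_eq_mul, smul_eq_mul]
  simp
  ring

/-- Fricke: the traces of a representation generated by two elements, up to scaling. -/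
theorem trace_mul_trace_inv_mem {G : Type*} [Group G] (K : IntermediateField ℚ ℂ)
    (R : G →* Matrix (Fin 2) (Fin 2) ℂ) {g h : G} (hgen : Subgroup.closure {g, h} = ⊤) {l m : ℂ}
    (hl : l ≠ 0) (hm : m ≠ 0) (tA : l⁻¹ * (R g).trace ∈ K) (tB : m⁻¹ * (R h).trace ∈ K)
    (tAB : (l * m)⁻¹ * (R (g * h)).trace ∈ K) (dA : (l ^ 2)⁻¹ * (R g).det ∈ K)
    (dB : (m ^ 2)⁻¹ * (R h).det ∈ K) (x : G) : (R x⁻¹).trace * (R x).trace ∈ K := by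
  set A := l⁻¹ • R g with hA
  set B := m⁻¹ • R h with hB
  replace tA : A.trace ∈ K := by simpa [hA] using tA
  replace tB : B.trace ∈ K := by simpa [hB] using tB
  replace tAB : (A * B).trace ∈ K := by
    rw [hA, hB, smul_mul_smul_comm, ← map_mul, ← mul_inv, Matrix.trace_smul]
    exact tAB
  replace dA : A.det ∈ K := by simpa [hA, Matrix.det_smul] using dA
  replace dB : B.det ∈ K := by simpa [hB, Matrix.det_smul] using dB
  have hinv : ∀ (k : ℂ), k ≠ 0 → ∀ y : G, InWordSpan K A B (k⁻¹ • R y) →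
      (k⁻¹ • R y).trace ∈ K → (k⁻¹ • R y).det ∈ K → InWordSpan K A B (k • R y⁻¹) := by
    intro k hk y h1 h2 h3
    have h4 : (k • R y⁻¹) * (k⁻¹ • R y) = 1 := by
      rw [smul_mul_smul_comm, ← map_mul, inv_mul_cancel, map_one, mul_inv_cancel₀ hk, one_smul]
    rw [(inverse_fin_two h4).2]
    refine InWordSpan.smul (inv_mem h3) ?_
    rw [sub_eq_add_neg, ← neg_one_smul ℂ (k⁻¹ • R y)]
    exact (inWordSpan_one.smul h2).add (h1.smul (neg_mem (one_mem K)))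
  -- Rescaling the generators rescales `R x` by some `k⁻¹` and `R x⁻¹` by `k`. Carrying both
  -- memberships through the induction handles inverses, and the scalars cancel in the product of
  -- the two traces.
  have key : ∃ k : ℂ, k ≠ 0 ∧ InWordSpan K A B (k⁻¹ • R x) ∧ InWordSpan K A B (k • R x⁻¹) := by
    have hx : x ∈ Subgroup.closure {g, h} := hgen ▸ Subgroup.mem_top x
    induction hx using Subgroup.closure_induction with
    | mem y hy =>
      rcases hy with rfl | rfl
      · exact ⟨l, hl, inWordSpan_left, hinv l hl _ inWordSpan_left tA dA⟩
      · exact ⟨m, hm, inWordSpan_right, hinv m hm _ inWordSpan_right tB dB⟩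
    | one => exact ⟨1, one_ne_zero, by simpa using inWordSpan_one, by simpa using inWordSpan_one⟩
    | mul y z _ _ hy hz =>
      obtain ⟨k, hk, h1, h2⟩ := hy
      obtain ⟨k', hk', h1', h2'⟩ := hz
      refine ⟨k * k', mul_ne_zero hk hk', ?_, ?_⟩
      · rw [map_mul, mul_inv, ← smul_mul_smul_comm]
        exact h1.mul tA tB tAB dA dB h1'
      · rw [mul_inv_rev, map_mul, mul_comm k, ← smul_mul_smul_comm]
        exact h2'.mul tA tB tAB dA dB h2
    | inv y _ hy =>
      obtain ⟨k, hk, h1, h2⟩ := hy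
      exact ⟨k⁻¹, inv_ne_zero hk, by rwa [inv_inv], by rwa [inv_inv]⟩
  obtain ⟨k, hk, h1, h2⟩ := key
  have h3 := mul_mem (h2.trace_mem tA tB tAB) (h1.trace_mem tA tB tAB)
  rw [Matrix.trace_smul, Matrix.trace_smul, smul_eq_mul, smul_eq_mul] at h3
  have e : k * (R x⁻¹).trace * (k⁻¹ * (R x).trace) = (R x⁻¹).trace * (R x).trace := by
    field_simp
  rwa [e] at h3

end TraceField

section Eigenvalue

variable {V : Type*} [AddCommGroup V] [Module ℂ V]

/-- The characteristic polynomial vanishes at `k`: `k² - tr(T) k + kδ = 0`, and `k` can be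
cancelled. -/
theorem trace_eq_of_eigenvector [FiniteDimensional ℂ V] (hdim : Module.finrank ℂ V = 2)
    {T : V →ₗ[ℂ] V} {k δ : ℂ} (hk : k ≠ 0) (hdet : LinearMap.det T = k * δ)
    (h : ∃ F, F ≠ 0 ∧ T F = k • F) : LinearMap.trace ℂ V T = k + δ := by
  obtain ⟨F, hF, hTF⟩ := h
  let bs := Module.finBasisOfFinrankEq ℂ V hdim
  have h0 : LinearMap.det (T - k • (1 : V →ₗ[ℂ] V)) = 0 := by
    by_contra hne
    have hu := (LinearMap.isUnit_iff_isUnit_det _).2 (isUnit_iff_ne_zero.2 hne)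
    have hi := (LinearMap.isUnit_iff_ker_eq_bot _).1 hu
    rw [LinearMap.ker_eq_bot'] at hi
    exact hF (hi F (by simp [hTF]))
  rw [← LinearMap.det_toMatrix bs, map_sub, map_smul, LinearMap.toMatrix_one,
    Matrix.det_fin_two] at h0
  rw [← LinearMap.det_toMatrix bs, Matrix.det_fin_two] at hdet
  rw [LinearMap.trace_eq_matrix_trace ℂ bs, Matrix.trace_fin_two]
  simp at h0
  apply mul_left_cancel₀ hk
  linear_combination hdet - h0

end Eigenvalue

/-! ### Roots of unity and real quadratic fields -/

/-- `e(q) = exp(2πiq)`. -/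
def expTwoPi (q : ℚ) : ℂ := Complex.exp (2 * Real.pi * Complex.I * q)

theorem expTwoPi_ne_zero (q : ℚ) : expTwoPi q ≠ 0 := Complex.exp_ne_zero _

theorem expTwoPi_add (q r : ℚ) : expTwoPi (q + r) = expTwoPi q * expTwoPi r := by
  rw [expTwoPi, expTwoPi, expTwoPi, ← Complex.exp_add]
  push_cast
  ring_nf

theorem expTwoPi_neg (q : ℚ) : expTwoPi (-q) = (expTwoPi q)⁻¹ := by
  rw [expTwoPi, expTwoPi, ← Complex.exp_neg]
  push_cast
  ring_nf

theorem expTwoPi_pow_den (q : ℚ) : expTwoPi q ^ q.den = 1 := by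
  rw [expTwoPi, ← Complex.exp_nat_mul, Complex.exp_eq_one_iff]
  refine ⟨q.num, ?_⟩
  have h : (q.den : ℂ) * (q : ℂ) = q.num := by
    have := Rat.den_mul_eq_num q
    exact_mod_cast this
  linear_combination 2 * Real.pi * Complex.I * h

theorem expTwoPi_mem_adjoin {n : ℕ} (hn : 0 < n) {q : ℚ} (h : q.den ∣ n) :
    expTwoPi q ∈ IntermediateField.adjoin ℚ {Complex.exp (2 * Real.pi * Complex.I / n)} := by
  obtain ⟨k, rfl⟩ := h
  have hk : (k : ℂ) ≠ 0 := by
    rw [Nat.cast_ne_zero]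
    rintro rfl
    simp at hn
  have hd : (q.den : ℂ) ≠ 0 := by simp
  have e : expTwoPi q =
      Complex.exp (2 * Real.pi * Complex.I / (q.den * k : ℕ)) ^ (q.num * k : ℤ) := by
    rw [expTwoPi, ← Complex.exp_int_mul]
    congr 1
    have h : (q : ℂ) = q.num / q.den := by
      exact_mod_cast (Rat.num_div_den q).symm
    rw [h]
    push_cast
    field_simp
  rw [e]
  exact zpow_mem (IntermediateField.mem_adjoin_simple_self ℚ _) _

theorem norm_eq_one_of_pow {y : ℂ} {n : ℕ} (hn : n ≠ 0) (h : y ^ n = 1) : ‖y‖ = 1 :=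
  Complex.norm_eq_one_of_pow_eq_one h hn

/-- A conjugate of `ζ + ζ⁻¹`, with `ζ` a root of unity, has the same shape. -/
theorem exists_root_of_unity_of_dickson {n : ℕ} {x : ℂ}
    (h : (Polynomial.dickson 1 (1 : ℂ) n).eval x = 2) : ∃ y : ℂ, y ^ n = 1 ∧ x = y + y⁻¹ := by
  -- `(x ± z)/2` are the roots `y, y⁻¹` of `Y² - xY + 1`. The Dickson polynomial takes the value `yⁿ
  -- + y⁻ⁿ` at `x`; when this is `2`, `(yⁿ - 1)² = 0`.
  obtain ⟨z, hz⟩ := IsAlgClosed.exists_pow_nat_eq (x ^ 2 - 4) two_pos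
  have hy : (x + z) / 2 * ((x - z) / 2) = 1 := by linear_combination (-1 / 4) * hz
  have hx : (x + z) / 2 + (x - z) / 2 = x := by ring
  have h1 := Polynomial.dickson_one_one_eval_add_inv _ _ hy n
  rw [hx, h] at h1
  have h2 : ((x + z) / 2) ^ n * ((x - z) / 2) ^ n = 1 := by rw [← mul_pow, hy, one_pow]
  refine ⟨(x + z) / 2, ?_, ?_⟩
  · have h3 : (((x + z) / 2) ^ n - 1) ^ 2 = 0 := by
      linear_combination -(((x + z) / 2) ^ n) * h1 - h2
    exact sub_eq_zero.1 (pow_eq_zero_iff two_ne_zero |>.1 h3)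
  · rw [inv_eq_of_mul_eq_one_right hy, hx]

theorem isIntegral_add_inv_of_pow {y : ℂ} {n : ℕ} (hn : n ≠ 0) (h : y ^ n = 1) :
    IsIntegral ℤ (y + y⁻¹) ∧ ‖y + y⁻¹‖ ≤ 2 := by
  have hy : IsIntegral ℤ y := IsIntegral.of_pow (Nat.pos_of_ne_zero hn) (h ▸ isIntegral_one)
  have h' : y⁻¹ ^ n = 1 := by rw [inv_pow, h, inv_one]
  have hy' : IsIntegral ℤ y⁻¹ := IsIntegral.of_pow (Nat.pos_of_ne_zero hn) (h' ▸ isIntegral_one)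
  refine ⟨hy.add hy', (norm_add_le _ _).trans_eq ?_⟩
  rw [norm_eq_one_of_pow hn h, norm_eq_one_of_pow hn h']
  norm_num

/-- This replaces the Galois conjugation of `ℚ(√D)`: since `u` and `w` serve both square roots of
`D`, a polynomial equation at `p + r√D` passes to `p - r√D` when `√D` is irrational. -/
theorem aeval_conj (p r D : ℚ) (P : Polynomial ℤ) : ∃ u w : ℚ, ∀ s : ℂ, s ^ 2 = D →
    Polynomial.aeval ((p : ℂ) + r * s) P = u + w * s := by
  induction P using Polynomial.induction_on with
  | C a => exact ⟨a, 0, fun s _ => by simp⟩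
  | add P Q hP hQ =>
    obtain ⟨u, w, h⟩ := hP
    obtain ⟨u', w', h'⟩ := hQ
    refine ⟨u + u', w + w', fun s hs => ?_⟩
    rw [map_add, h s hs, h' s hs]
    push_cast
    ring
  | monomial n a h =>
    obtain ⟨u, w, h⟩ := h
    refine ⟨u * p + w * r * D, u * r + w * p, fun s hs => ?_⟩
    rw [pow_succ, ← mul_assoc, map_mul, h s hs, Polynomial.aeval_X]
    push_cast
    linear_combination w * r * hs

theorem eq_zero_of_add_mul_eq_zero {s : ℂ} (hs : ∀ t : ℚ, s ≠ t) {u w : ℚ}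
    (h : (u : ℂ) + w * s = 0) : u = 0 ∧ w = 0 := by
  have hw : w = 0 := by
    by_contra hw
    apply hs (-u / w)
    have : (w : ℂ) ≠ 0 := by exact_mod_cast hw
    push_cast
    field_simp
    linear_combination h
  subst hw
  simpa using h

theorem exists_int_of_isIntegral {t : ℚ} (h : IsIntegral ℤ (t : ℂ)) : ∃ m : ℤ, t = m := by
  have h1 : IsIntegral ℤ t :=
    (isIntegral_algebraMap_iff (R := ℤ) (A := ℚ) (B := ℂ) (algebraMap ℚ ℂ).injective).1 h
  obtain ⟨m, hm⟩ := IsIntegrallyClosed.isIntegral_iff.1 h1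
  exact ⟨m, by simpa using hm.symm⟩

/-- The square of the denominator of `t` is prime to that of its numerator, so it divides `D`, and
squarefreeness makes the denominator `1`. -/
theorem exists_int_of_sq_mul_squarefree {D N : ℤ} (hD : Squarefree D) {t : ℚ}
    (h : t ^ 2 * D = N) : ∃ v : ℤ, t = v := by
  have h1 : t.num ^ 2 * D = N * t.den ^ 2 := by
    have h2 : (t.num : ℚ) = t * t.den := (Rat.mul_den_eq_num t).symm
    have : (t.num : ℚ) ^ 2 * D = N * t.den ^ 2 := by
      rw [h2, ← h]
      ring
    exact_mod_cast this
  have h3 : IsCoprime ((t.den : ℤ) ^ 2) (t.num ^ 2) := by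
    apply IsCoprime.pow
    rw [Int.isCoprime_iff_gcd_eq_one, Int.gcd_comm]
    exact t.reduced
  have h4 : (t.den : ℤ) ^ 2 ∣ D := h3.dvd_of_dvd_mul_left ⟨N, by rw [h1]; ring⟩
  have h5 := hD t.den (by rwa [sq] at h4)
  have h6 : t.den = 1 := by
    rw [Int.isUnit_iff] at h5
    omega
  exact ⟨t.num, by rw [← Rat.num_div_den t, h6]; simp⟩

/-- Here `u` and `m` play the trace and norm of a quadratic integer with both conjugates in `[-2,
2]`; `h1` and `h2` are the norms of `2 - x` and `2 + x`. They give `u² - 4m ≤ (4 - |u|)² ≤ 16`, so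
`v² D ≤ 16` and `v² = 1`. As `D` is odd, so is `u`, and `D ≡ 1 mod 4` with `7 ≤ D ≤ 9` leaves only
`D = 9`, which is not squarefree. -/
theorem no_quadratic_conjugates {D u m v : ℤ} (hodd : Odd D) (hD : Squarefree D) (h7 : 7 ≤ D)
    (hu : |u| ≤ 4) (h1 : 0 ≤ 4 - 2 * u + m) (h2 : 0 ≤ 4 + 2 * u + m)
    (hv : u ^ 2 - 4 * m = v ^ 2 * D) (hv0 : v ≠ 0) : False := by
  have hv2 : v ^ 2 < 4 := by
    have h3 : u ^ 2 - 4 * m ≤ 16 := by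
      obtain ⟨hu1, hu2⟩ := abs_le.1 hu
      rcases le_total 0 u with h | h <;> nlinarith
    nlinarith [sq_nonneg v]
  have hv1 : v ^ 2 = 1 := by
    have : |v| < 2 := by
      rw [← sq_lt_sq₀ (abs_nonneg v) (by norm_num), sq_abs]
      linarith
    have h3 : 0 < |v| := abs_pos.2 hv0
    rw [← sq_abs, show |v| = 1 by omega]
    rfl
  rw [hv1, one_mul] at hv
  obtain ⟨k, rfl⟩ := hodd
  obtain ⟨hu1, hu2⟩ := abs_le.1 hu
  have h9 : 2 * k + 1 ≠ 9 := by
    intro h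
    rw [h] at hD
    have := hD 3 ⟨1, by norm_num⟩
    rw [Int.isUnit_iff] at this
    omega
  interval_cases u <;> omega

theorem exists_adjoin_simple {s : ℂ} {D : ℚ} (hs : s ^ 2 = D) {z : ℂ}
    (hz : z ∈ IntermediateField.adjoin ℚ {s}) : ∃ p r : ℚ, z = p + r * s := by
  have hint : IsIntegral ℚ s := IsIntegral.of_pow two_pos (by
    rw [hs]
    exact isIntegral_algebraMap (R := ℚ) (x := D))
  rw [← IntermediateField.mem_toSubalgebra,
    IntermediateField.adjoin_simple_toSubalgebra_of_isAlgebraic hint.isAlgebraic] at hz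
  induction hz using Algebra.adjoin_induction with
  | mem x hx => exact ⟨0, 1, by rw [hx]; simp⟩
  | algebraMap r => exact ⟨r, 0, by simp⟩
  | add x y _ _ hx hy =>
    obtain ⟨p, r, rfl⟩ := hx
    obtain ⟨p', r', rfl⟩ := hy
    exact ⟨p + p', r + r', by push_cast; ring⟩
  | mul x y _ _ hx hy =>
    obtain ⟨p, r, rfl⟩ := hx
    obtain ⟨p', r', rfl⟩ := hy
    refine ⟨p * p' + r * r' * D, p * r' + r * p', ?_⟩
    push_cast
    linear_combination r * r' * hs

theorem sqrt_ne_rat {D : ℤ} (hD : Squarefree D) (h7 : 7 ≤ D) {s : ℂ} (hs : s ^ 2 = D) (t : ℚ) :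
    s ≠ t := by
  rintro rfl
  have h1 : t ^ 2 = D := by exact_mod_cast hs
  obtain ⟨v, rfl⟩ := exists_int_of_sq_mul_squarefree squarefree_one (D := 1) (N := D) (t := t)
    (by simpa using h1)
  have h2 : v ^ 2 = D := by exact_mod_cast h1
  have h3 := hD v ⟨1, by rw [← h2]; ring⟩
  rw [Int.isUnit_iff] at h3
  rcases h3 with rfl | rfl <;> omega

/-- If `2 cos(2πq)` lies in `ℚ(√D)` with `D ≥ 7` odd and squarefree, then it is an integer. -/
theorem two_cos_mem_quadratic {D : ℤ} (hodd : Odd D) (hD : Squarefree D) (h7 : 7 ≤ D) (q : ℚ)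
    (h : expTwoPi q + (expTwoPi q)⁻¹ ∈
      IntermediateField.adjoin ℚ {((Real.sqrt (D : ℝ) : ℝ) : ℂ)}) :
    ∃ m : ℤ, -2 ≤ m ∧ m ≤ 2 ∧ expTwoPi q + (expTwoPi q)⁻¹ = m := by
  set S : ℝ := Real.sqrt (D : ℝ) with hS
  have hS2 : S ^ 2 = D := Real.sq_sqrt (by exact_mod_cast (by omega : 0 ≤ D))
  have hs2 : ((S : ℝ) : ℂ) ^ 2 = D := by exact_mod_cast hS2
  have hs2' : ((S : ℝ) : ℂ) ^ 2 = (D : ℚ) := by exact_mod_cast hS2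
  have hirr := sqrt_ne_rat hD h7 hs2
  obtain ⟨p, r, hpr⟩ := exists_adjoin_simple hs2' h
  have hn : q.den ≠ 0 := q.den_nz
  obtain ⟨hi1, hn1⟩ := isIntegral_add_inv_of_pow hn (expTwoPi_pow_den q)
  -- The conjugate of `2cos(2πq)` also satisfies the Dickson equation, so it is again a root of
  -- unity plus its inverse: integral and of absolute value at most 2.
  obtain ⟨y, hy, hy'⟩ : ∃ y : ℂ, y ^ q.den = 1 ∧ (p : ℂ) + r * (-(S : ℂ)) = y + y⁻¹ := by
    apply exists_root_of_unity_of_dickson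
    obtain ⟨u, w, huw⟩ := aeval_conj p r D (Polynomial.dickson 1 1 q.den)
    have hmap : ∀ x : ℂ, (Polynomial.dickson 1 (1 : ℂ) q.den).eval x =
        Polynomial.aeval x (Polynomial.dickson 1 (1 : ℤ) q.den) := by
      intro x
      rw [Polynomial.aeval_def, ← Polynomial.eval_map, Polynomial.map_dickson]
      simp
    have h1 := huw S hs2'
    rw [← hmap, ← hpr, Polynomial.dickson_one_one_eval_add_inv _ _
      (mul_inv_cancel₀ (expTwoPi_ne_zero q)), inv_pow, expTwoPi_pow_den] at h1
    obtain ⟨h2, h3⟩ := eq_zero_of_add_mul_eq_zero hirr (u := u - 2) (w := w) (by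
      push_cast
      linear_combination -h1)
    rw [hmap, huw (-(S : ℂ)) (by rw [neg_sq]; exact hs2'), h3, show u = 2 by linarith]
    simp
  obtain ⟨hi2, hn2⟩ := isIntegral_add_inv_of_pow hn hy
  rw [hpr] at hi1 hn1 ⊢
  rw [← hy'] at hi2 hn2
  have hb1 : |(p : ℝ) + r * S| ≤ 2 := by
    rw [← Real.norm_eq_abs, ← Complex.norm_real]
    push_cast
    exact hn1
  have hb2 : |(p : ℝ) - r * S| ≤ 2 := by
    rw [← Real.norm_eq_abs, ← Complex.norm_real]
    push_cast
    rw [sub_eq_add_neg, ← mul_neg]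
    exact hn2
  obtain ⟨hb1, hb1'⟩ := abs_le.1 hb1
  obtain ⟨hb2, hb2'⟩ := abs_le.1 hb2
  by_cases hr : r = 0
  · subst hr
    obtain ⟨m, rfl⟩ := exists_int_of_isIntegral (t := p) (by simpa using hi1)
    refine ⟨m, ?_, ?_, by simp⟩
    · have : (-2 : ℝ) ≤ m := by simpa using hb1
      exact_mod_cast this
    · have : (m : ℝ) ≤ 2 := by simpa using hb1'
      exact_mod_cast this
  exfalso
  obtain ⟨u, hu⟩ := exists_int_of_isIntegral (t := 2 * p) (by
    have e : ((2 * p : ℚ) : ℂ) = (p + r * S) + (p + r * (-S)) := by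
      push_cast
      ring
    rw [e]
    exact hi1.add hi2)
  obtain ⟨m, hm⟩ := exists_int_of_isIntegral (t := p ^ 2 - r ^ 2 * D) (by
    have e : ((p ^ 2 - r ^ 2 * D : ℚ) : ℂ) = (p + r * S) * (p + r * (-S)) := by
      push_cast
      linear_combination (r : ℂ) ^ 2 * hs2
    rw [e]
    exact hi1.mul hi2)
  -- The discriminant `u² - 4m` of the minimal polynomial equals `(2r)² D`, so `2r` is an integer.
  obtain ⟨v, hv⟩ := exists_int_of_sq_mul_squarefree hD (t := 2 * r) (N := u ^ 2 - 4 * m) (by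
    push_cast
    rw [← hu, ← hm]
    ring)
  have hu' : (2 : ℝ) * p = u := by exact_mod_cast hu
  have hm' : (p : ℝ) ^ 2 - r ^ 2 * D = m := by exact_mod_cast hm
  have hm'' : ((p : ℝ) + r * S) * (p - r * S) = m := by
    rw [← hm']
    linear_combination -(r : ℝ) ^ 2 * hS2
  refine no_quadratic_conjugates (u := u) (m := m) (v := v) hodd hD h7 ?_ ?_ ?_ ?_ ?_
  · have h1 : |(u : ℝ)| ≤ 4 := by
      rw [← hu', abs_le]
      constructor <;> linarith
    exact_mod_cast h1
  · have h1 : (0 : ℝ) ≤ 4 - 2 * u + m := by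
      rw [← hm'', ← hu']
      nlinarith [mul_nonneg (sub_nonneg.2 hb1') (sub_nonneg.2 hb2')]
    exact_mod_cast h1
  · have h1 : (0 : ℝ) ≤ 4 + 2 * u + m := by
      rw [← hm'', ← hu']
      nlinarith [mul_nonneg (sub_nonneg.2 hb1) (sub_nonneg.2 hb2)]
    exact_mod_cast h1
  · have h1 : (u : ℚ) ^ 2 - 4 * m = v ^ 2 * D := by
      rw [← hu, ← hm, ← hv]
      ring
    exact_mod_cast h1
  · rintro rfl
    apply hr
    simpa using hv

/-! ### Square roots in `ℚ(√2, √3)` -/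

section SqrtTwoThree

/-- The field `ℚ(√2, √3)`. -/
def sqrtField : IntermediateField ℚ ℂ :=
  IntermediateField.adjoin ℚ {((Real.sqrt 2 : ℝ) : ℂ), ((Real.sqrt 3 : ℝ) : ℂ)}

theorem sqrt_two_sq : ((Real.sqrt 2 : ℝ) : ℂ) ^ 2 = 2 := by
  exact_mod_cast Real.sq_sqrt (by norm_num : (0 : ℝ) ≤ 2)

theorem sqrt_three_sq : ((Real.sqrt 3 : ℝ) : ℂ) ^ 2 = 3 := by
  exact_mod_cast Real.sq_sqrt (by norm_num : (0 : ℝ) ≤ 3)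

theorem mem_sqrtField_of_sq {x : ℂ} {m : ℤ} (h0 : 0 ≤ m) (h4 : m ≤ 4) (hx : x ^ 2 = m) :
    x ∈ sqrtField := by
  have key : ∀ y ∈ sqrtField, x ^ 2 = y ^ 2 → x ∈ sqrtField := by
    intro y hy h
    rcases sq_eq_sq_iff_eq_or_eq_neg.1 h with rfl | rfl
    · exact hy
    · exact neg_mem hy
  have h2 : ((Real.sqrt 2 : ℝ) : ℂ) ∈ sqrtField :=
    IntermediateField.subset_adjoin ℚ _ (Or.inl rfl)
  have h3 : ((Real.sqrt 3 : ℝ) : ℂ) ∈ sqrtField :=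
    IntermediateField.subset_adjoin ℚ _ (Or.inr rfl)
  interval_cases m
  · exact key 0 (zero_mem _) (by rw [hx]; simp)
  · exact key 1 (one_mem _) (by rw [hx]; simp)
  · exact key _ h2 (by rw [hx, sqrt_two_sq]; simp)
  · exact key _ h3 (by rw [hx, sqrt_three_sq]; simp)
  · exact key 2 (ofNat_mem _ 2) (by rw [hx]; norm_num)

theorem exists_sqrtField {z : ℂ} (hz : z ∈ sqrtField) : ∃ p q r t : ℚ,
    z = (p + q * (Real.sqrt 2 : ℝ)) + (r + t * (Real.sqrt 2 : ℝ)) * (Real.sqrt 3 : ℝ) := by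
  have h2 := sqrt_two_sq
  have h3 := sqrt_three_sq
  rw [sqrtField, ← IntermediateField.mem_toSubalgebra,
    IntermediateField.adjoin_toSubalgebra_of_isAlgebraic] at hz
  · induction hz using Algebra.adjoin_induction with
    | mem x hx =>
      rcases hx with rfl | rfl
      · exact ⟨0, 1, 0, 0, by simp⟩
      · exact ⟨0, 0, 1, 0, by simp⟩
    | algebraMap r => exact ⟨r, 0, 0, 0, by simp⟩
    | add x y _ _ hx hy =>
      obtain ⟨p, q, r, t, rfl⟩ := hx
      obtain ⟨p', q', r', t', rfl⟩ := hy
      exact ⟨p + p', q + q', r + r', t + t', by push_cast; ring⟩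
    | mul x y _ _ hx hy =>
      obtain ⟨p, q, r, t, rfl⟩ := hx
      obtain ⟨p', q', r', t', rfl⟩ := hy
      refine ⟨p * p' + 2 * q * q' + 3 * r * r' + 6 * t * t',
        p * q' + q * p' + 3 * r * t' + 3 * t * r', p * r' + r * p' + 2 * q * t' + 2 * t * q',
        p * t' + t * p' + q * r' + r * q', ?_⟩
      push_cast
      linear_combination (q * q' + (q * t' + t * q') * (Real.sqrt 3 : ℝ) + 3 * t * t') * h2 +
        (r * r' + (r * t' + t * r') * (Real.sqrt 2 : ℝ) +
          t * t' * ((Real.sqrt 2 : ℝ) : ℂ) ^ 2) * h3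
  · intro x hx
    refine IsIntegral.isAlgebraic (IsIntegral.of_pow two_pos ?_)
    rcases hx with rfl | rfl
    · rw [h2]
      exact isIntegral_algebraMap (R := ℚ) (x := 2)
    · rw [h3]
      exact isIntegral_algebraMap (R := ℚ) (x := 3)

theorem sqrt_two_ne_rat (t : ℚ) : ((Real.sqrt 2 : ℝ) : ℂ) ≠ t := by
  intro h
  exact irrational_sqrt_two ⟨t, by exact_mod_cast h.symm⟩

/-- The coefficient `2xy` of `√2` in the square must vanish. -/
theorem rat_eq_sq_or {m x y : ℚ} (h : (m : ℂ) = (x + y * (Real.sqrt 2 : ℝ)) ^ 2) :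
    m = x ^ 2 ∨ m = 2 * y ^ 2 := by
  obtain ⟨h1, h2⟩ := eq_zero_of_add_mul_eq_zero sqrt_two_ne_rat (u := x ^ 2 + 2 * y ^ 2 - m)
    (w := 2 * x * y) (by
      push_cast
      linear_combination -h - y ^ 2 * sqrt_two_sq)
  rcases mul_eq_zero.1 h2 with h2 | rfl
  · obtain rfl : x = 0 := by simpa using h2
    right
    linarith
  · left
    linarith

/-- `√D` can only lie in `ℚ(√2, √3)` if one of `D, 2D, 3D, 6D` is a square. -/
theorem exists_sq_of_sqrt_mem_sqrtField {D : ℤ} {d : ℂ} (hd : d ^ 2 = D) (h : d ∈ sqrtField) :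
    ∃ x : ℚ, (D : ℚ) = x ^ 2 ∨ (D : ℚ) = 2 * x ^ 2 ∨ (3 * D : ℚ) = x ^ 2 ∨
      (3 * D : ℚ) = 2 * x ^ 2 := by
  obtain ⟨p, q, r, t, e⟩ := exists_sqrtField h
  have h2 := sqrt_two_sq
  have h3 := sqrt_three_sq
  set s₂ : ℂ := ((Real.sqrt 2 : ℝ) : ℂ) with hs₂
  set s₃ : ℂ := ((Real.sqrt 3 : ℝ) : ℂ) with hs₃
  -- Write `d = u + w√3` with `u, w` in `ℚ(√2)`. If `u = 0`, then `3D = (3w)²` is a square in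
  -- `ℚ(√2)`. Otherwise `2du = D + u² - 3w²`, and dividing by `u` puts `d` itself into `ℚ(√2)`.
  by_cases hu : (p : ℂ) + q * s₂ = 0
  · rw [hu, zero_add] at e
    have h4 : ((3 * D : ℚ) : ℂ) = ((3 * r : ℚ) + (3 * t : ℚ) * s₂) ^ 2 := by
      push_cast
      rw [← hd, e]
      linear_combination 3 * (r + t * s₂) ^ 2 * h3
    rcases rat_eq_sq_or h4 with h | h
    · exact ⟨_, Or.inr (Or.inr (Or.inl h))⟩
    · exact ⟨_, Or.inr (Or.inr (Or.inr h))⟩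
  · have hN : (p ^ 2 - 2 * q ^ 2 : ℂ) ≠ 0 := by
      intro h0
      have h5 : ((p : ℂ) + q * s₂) * (p + (-q : ℚ) * s₂) = 0 := by
        push_cast
        linear_combination h0 - q ^ 2 * h2
      have h6 := eq_zero_of_add_mul_eq_zero sqrt_two_ne_rat ((mul_eq_zero.1 h5).resolve_left hu)
      apply hu
      rw [h6.1, neg_eq_zero.1 h6.2]
      simp
    have e1 : (d - (p + q * s₂)) ^ 2 = 3 * (r + t * s₂) ^ 2 := by
      rw [e]
      linear_combination (r + t * s₂) ^ 2 * h3
    -- `a + b√2` is `D + u² - 3w²`; the coordinates of `d` come from multiplying by the conjugate `p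
    -- - q√2` of `u` and dividing by twice its norm.
    obtain ⟨X, Y, hXY⟩ : ∃ X Y : ℚ, d = X + Y * s₂ := by
      let a : ℚ := D + p ^ 2 + 2 * q ^ 2 - 3 * r ^ 2 - 6 * t ^ 2
      let b : ℚ := 2 * p * q - 6 * r * t
      refine ⟨(a * p - 2 * b * q) / (2 * (p ^ 2 - 2 * q ^ 2)),
        (b * p - a * q) / (2 * (p ^ 2 - 2 * q ^ 2)), ?_⟩
      have e2 : 2 * d * (p + q * s₂) = a + b * s₂ := by
        simp only [a, b]
        push_cast
        linear_combination hd - e1 + (q ^ 2 - 3 * t ^ 2) * h2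
      have e3 : 2 * d * (p ^ 2 - 2 * q ^ 2) = (a * p - 2 * b * q) + (b * p - a * q) * s₂ := by
        linear_combination (p - q * s₂) * e2 + (2 * d * q ^ 2 - b * q) * h2
      push_cast
      field_simp
      linear_combination e3
    have h4 : ((D : ℚ) : ℂ) = (X + Y * s₂) ^ 2 := by
      rw [← hXY, hd]
      simp
    rcases rat_eq_sq_or h4 with h | h
    · exact ⟨_, Or.inl h⟩
    · exact ⟨_, Or.inr (Or.inl h)⟩

/-- Otherwise `3` is the only possible prime factor, to the first power at most, and `D` would be
`1` or `3`. -/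
theorem exists_prime_dvd_of_odd_squarefree {D : ℤ} (hodd : Odd D) (hD : Squarefree D) (h7 : 7 ≤ D) :
    ∃ p : ℕ, p.Prime ∧ 5 ≤ p ∧ (p : ℤ) ∣ D := by
  by_contra! hno
  have key : ∀ E : ℕ, (E : ℤ) ∣ D → ¬ 3 ∣ E → E = 1 := by
    intro E hE h3
    by_contra h1
    have hp := Nat.minFac_prime h1
    have hdvd : (E.minFac : ℤ) ∣ D := (Int.natCast_dvd_natCast.2 E.minFac_dvd).trans hE
    have h5 : E.minFac < 5 := by
      by_contra h5
      exact hno _ hp (not_lt.1 h5) hdvd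
    have h2 := hp.two_le
    have : E.minFac ≠ 2 := by
      intro h
      rw [h] at hdvd
      exact (Int.not_even_iff_odd.2 hodd) (even_iff_two_dvd.2 hdvd)
    have : E.minFac ≠ 3 := fun h => h3 (h ▸ E.minFac_dvd)
    have : E.minFac ≠ 4 := fun h => by rw [h] at hp; norm_num at hp
    omega
  have hpos : (D.toNat : ℤ) = D := Int.toNat_of_nonneg (by omega)
  by_cases h3 : (3 : ℤ) ∣ D
  · obtain ⟨k, rfl⟩ := h3
    have hk : (k.toNat : ℤ) = k := Int.toNat_of_nonneg (by omega)
    have := key k.toNat (by rw [hk]; exact dvd_mul_left k 3) (fun h => by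
      have h4 : (3 : ℤ) ∣ k := by rw [← hk]; exact_mod_cast h
      have := hD 3 (mul_dvd_mul_left 3 h4)
      rw [Int.isUnit_iff] at this
      omega)
    omega
  · have := key D.toNat (by rw [hpos]) (fun h => h3 (by rw [← hpos]; exact_mod_cast h))
    omega

/-- At a prime `p ≥ 5` dividing `D`, both `D` and `3D` have valuation `1`, while rational squares
and their doubles have even valuation. -/
theorem sqrt_not_mem_sqrtField {D : ℤ} (hodd : Odd D) (hD : Squarefree D) (h7 : 7 ≤ D) {d : ℂ}
    (hd : d ^ 2 = D) : d ∉ sqrtField := by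
  intro h
  obtain ⟨x, hx⟩ := exists_sq_of_sqrt_mem_sqrtField hd h
  obtain ⟨p, hp, h5, hpD⟩ := exists_prime_dvd_of_odd_squarefree hodd hD h7
  have := Fact.mk hp
  have hD0 : D ≠ 0 := by omega
  have hvD : padicValRat p (D : ℚ) = 1 := by
    rw [padicValRat.of_int]
    obtain ⟨k, rfl⟩ := hpD
    have hk : ¬ (p : ℤ) ∣ k := by
      intro hk
      have h6 := hD p (mul_dvd_mul_left _ hk)
      rw [Int.isUnit_iff] at h6
      omega
    have hk0 : k ≠ 0 := right_ne_zero_of_mul hD0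
    rw [padicValInt.mul (by exact_mod_cast hp.ne_zero) hk0, padicValInt.self hp.one_lt,
      padicValInt.eq_zero_of_not_dvd hk]
    rfl
  have hsmall : ∀ n : ℕ, 0 < n → n < 5 → padicValRat p (n : ℚ) = 0 := by
    intro n hn hn5
    rw [padicValRat.of_nat, padicValNat.eq_zero_of_not_dvd fun h => by
      have := Nat.le_of_dvd hn h
      omega]
    rfl
  have hv3 : padicValRat p (3 : ℚ) = 0 := by exact_mod_cast hsmall 3 (by norm_num) (by norm_num)
  have hv2 : padicValRat p (2 : ℚ) = 0 := by exact_mod_cast hsmall 2 (by norm_num) (by norm_num)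
  have hDq : (D : ℚ) ≠ 0 := by exact_mod_cast hD0
  have hx0 : x ≠ 0 := by
    rintro rfl
    rcases hx with h | h | h | h <;> simp [hD0] at h
  have hx2 : padicValRat p (x ^ 2) = 2 * padicValRat p x := by
    rw [padicValRat.pow]
    rfl
  have hv3D : padicValRat p (3 * D : ℚ) = 1 := by
    rw [padicValRat.mul (by norm_num) hDq, hv3, hvD]
    rfl
  have hv2x : padicValRat p (2 * x ^ 2) = 2 * padicValRat p x := by
    rw [padicValRat.mul (by norm_num) (pow_ne_zero 2 hx0), hv2, hx2, zero_add]
  rcases hx with h | h | h | h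
  · rw [h, hx2] at hvD
    omega
  · rw [h, hv2x] at hvD
    omega
  · rw [h, hx2] at hv3D
    omega
  · rw [h, hv2x] at hv3D
    omega

end SqrtTwoThree

/-! ### The adjoint trace field of a two-generator representation -/

section Rank

variable {G V : Type*} [Group G] [AddCommGroup V] [Module ℂ V] [FiniteDimensional ℂ V]
  (ρ : Representation ℂ G V)

theorem trace_linHom_self (x : G) : LinearMap.trace ℂ (V →ₗ[ℂ] V) (Representation.linHom ρ ρ x) =
    LinearMap.trace ℂ V (ρ x⁻¹) * LinearMap.trace ℂ V (ρ x) :=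
  Representation.char_linHom ρ ρ x

theorem trace_mul_trace_inv_mem_adjointTraceField (x : G) :
    LinearMap.trace ℂ V (ρ x⁻¹) * LinearMap.trace ℂ V (ρ x) ∈ adjointTraceField ρ :=
  trace_linHom_self ρ x ▸ IntermediateField.subset_adjoin _ _ ⟨x, rfl⟩

theorem comp_comm_of_finrank_le_one (h : Module.finrank ℂ V ≤ 1) (S T : V →ₗ[ℂ] V) :
    S ∘ₗ T = T ∘ₗ S := by
  obtain ⟨v, hv⟩ := finrank_le_one_iff.1 h
  ext w
  obtain ⟨k, rfl⟩ := hv w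
  obtain ⟨s, hs⟩ := hv (S v)
  obtain ⟨t, ht⟩ := hv (T v)
  simp only [LinearMap.comp_apply, map_smul, ← hs, ← ht]
  rw [smul_comm s t]

theorem adjointTraceField_eq_bot_of_finrank_le_one (h : Module.finrank ℂ V ≤ 1) :
    adjointTraceField ρ = ⊥ := by
  refine le_bot_iff.1 (IntermediateField.adjoin_le_iff.2 ?_)
  rintro _ ⟨x, rfl⟩
  have e : Representation.linHom ρ ρ x = 1 := by
    refine LinearMap.ext fun f => ?_
    rw [Representation.linHom_apply, comp_comm_of_finrank_le_one h f, ← LinearMap.comp_assoc]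
    change (ρ x * ρ x⁻¹) ∘ₗ f = f
    rw [← map_mul, mul_inv_cancel, map_one]
    rfl
  change LinearMap.trace ℂ (V →ₗ[ℂ] V) (Representation.linHom ρ ρ x) ∈
    (⊥ : IntermediateField ℚ ℂ)
  rw [e, LinearMap.trace_one]
  exact natCast_mem _ _

variable (hdim : Module.finrank ℂ V = 2)

/-- The matrices of a representation of rank two. -/
def matrixRep : G →* Matrix (Fin 2) (Fin 2) ℂ :=
  ((LinearMap.toMatrixAlgEquiv (Module.finBasisOfFinrankEq ℂ V hdim) :
    (V →ₗ[ℂ] V) →* Matrix (Fin 2) (Fin 2) ℂ)).comp ρ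

theorem matrixRep_trace (x : G) : (matrixRep ρ hdim x).trace = LinearMap.trace ℂ V (ρ x) :=
  (LinearMap.trace_eq_matrix_trace ℂ (Module.finBasisOfFinrankEq ℂ V hdim) (ρ x)).symm

theorem matrixRep_det (x : G) : (matrixRep ρ hdim x).det = LinearMap.det (ρ x) :=
  LinearMap.det_toMatrix (Module.finBasisOfFinrankEq ℂ V hdim) (ρ x)

/-- The eigenvalues of `ρ x` are `exp (2πip)` and `exp (2πiq)`. -/
def HasExponents (x : G) (p q : ℚ) : Prop :=
  LinearMap.trace ℂ V (ρ x) = expTwoPi p + expTwoPi q ∧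
    LinearMap.det (ρ x) = expTwoPi p * expTwoPi q

include hdim

theorem adjointTraceField_le {K : IntermediateField ℚ ℂ} {g h : G}
    (hgen : Subgroup.closure {g, h} = ⊤) {l m : ℂ} (hl : l ≠ 0) (hm : m ≠ 0)
    (tA : l⁻¹ * LinearMap.trace ℂ V (ρ g) ∈ K) (tB : m⁻¹ * LinearMap.trace ℂ V (ρ h) ∈ K)
    (tAB : (l * m)⁻¹ * LinearMap.trace ℂ V (ρ (g * h)) ∈ K)
    (dA : (l ^ 2)⁻¹ * LinearMap.det (ρ g) ∈ K) (dB : (m ^ 2)⁻¹ * LinearMap.det (ρ h) ∈ K) :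
    adjointTraceField ρ ≤ K := by
  refine IntermediateField.adjoin_le_iff.2 ?_
  rintro _ ⟨x, rfl⟩
  change LinearMap.trace ℂ (V →ₗ[ℂ] V) (Representation.linHom ρ ρ x) ∈ K
  rw [trace_linHom_self, ← matrixRep_trace ρ hdim, ← matrixRep_trace ρ hdim]
  apply trace_mul_trace_inv_mem K (matrixRep ρ hdim) hgen hl hm <;>
    simpa only [matrixRep_trace, matrixRep_det]

theorem trace_inv_eq_div (x : G) :
    LinearMap.trace ℂ V (ρ x⁻¹) = LinearMap.trace ℂ V (ρ x) / LinearMap.det (ρ x) := by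
  rw [← matrixRep_trace ρ hdim, ← matrixRep_trace ρ hdim, ← matrixRep_det ρ hdim]
  exact trace_inverse_fin_two (by rw [← map_mul, inv_mul_cancel, map_one])

variable {ρ}

theorem hasExponents_of_eigenvector {x : G} {p q : ℚ}
    (hdet : LinearMap.det (ρ x) = expTwoPi p * expTwoPi q)
    (h : ∃ F, F ≠ 0 ∧ ρ x F = expTwoPi p • F) : HasExponents ρ x p q :=
  ⟨trace_eq_of_eigenvector hdim (expTwoPi_ne_zero p) hdet h, hdet⟩

theorem HasExponents.inv {x : G} {p q : ℚ} (h : HasExponents ρ x p q) :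
    HasExponents ρ x⁻¹ (-p) (-q) := by
  have hp := expTwoPi_ne_zero p
  have hq := expTwoPi_ne_zero q
  constructor
  · rw [trace_inv_eq_div ρ hdim, h.1, h.2, expTwoPi_neg, expTwoPi_neg]
    field_simp
    ring
  · rw [expTwoPi_neg, expTwoPi_neg, ← mul_inv, ← h.2]
    refine eq_inv_of_mul_eq_one_left ?_
    rw [← map_mul, ← map_mul, inv_mul_cancel, map_one, map_one]

/-- In rank two `tr ρ(x⁻¹) = tr ρ(x) / det ρ(x)`, so `tr²/det` is the trace of `ad(ρ)(x)` and lies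
in `ℚ(√D)`. It equals `2 + ζ + ζ⁻¹` with `ζ = e(p - q)`, and `two_cos_mem_quadratic` applies. -/
theorem HasExponents.exists_int {D : ℤ} (hodd : Odd D) (hD : Squarefree D) (h7 : 7 ≤ D)
    (hF : adjointTraceField ρ = IntermediateField.adjoin ℚ {((Real.sqrt (D : ℝ) : ℝ) : ℂ)})
    {x : G} {p q : ℚ} (h : HasExponents ρ x p q) : ∃ m : ℤ, 0 ≤ m ∧ m ≤ 4 ∧
      LinearMap.trace ℂ V (ρ x) ^ 2 / LinearMap.det (ρ x) = m := by
  have hp := expTwoPi_ne_zero p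
  have hq := expTwoPi_ne_zero q
  have e : LinearMap.trace ℂ V (ρ x) ^ 2 / LinearMap.det (ρ x) =
      2 + (expTwoPi (p - q) + (expTwoPi (p - q))⁻¹) := by
    rw [h.1, h.2, sub_eq_add_neg, expTwoPi_add, expTwoPi_neg]
    field_simp
    ring
  have h1 := trace_mul_trace_inv_mem_adjointTraceField ρ x
  rw [trace_inv_eq_div ρ hdim, div_mul_eq_mul_div, ← sq, e, hF] at h1
  have h2 := sub_mem h1 (ofNat_mem (IntermediateField.adjoin ℚ
    {((Real.sqrt (D : ℝ) : ℝ) : ℂ)}) 2)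
  rw [add_sub_cancel_left] at h2
  obtain ⟨m, h3, h4, h5⟩ := two_cos_mem_quadratic hodd hD h7 _ h2
  exact ⟨2 + m, by linarith, by linarith, by rw [e, h5]; push_cast; rfl⟩

theorem adjointTraceField_le_of_hasExponents {g h : G} (hgen : Subgroup.closure {g, h} = ⊤)
    {p q p' q' r s : ℚ} (hg : HasExponents ρ g p q) (hh : HasExponents ρ h p' q')
    (hgh : HasExponents ρ (g * h) r s) {K : IntermediateField ℚ ℂ} (hp : expTwoPi p ∈ K)
    (hq : expTwoPi q ∈ K) (hp' : expTwoPi p' ∈ K) (hq' : expTwoPi q' ∈ K) (hr : expTwoPi r ∈ K)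
    (hs : expTwoPi s ∈ K) : adjointTraceField ρ ≤ K := by
  apply adjointTraceField_le ρ hdim hgen one_ne_zero one_ne_zero
  · simpa [hg.1] using add_mem hp hq
  · simpa [hh.1] using add_mem hp' hq'
  · rw [hgh.1]
    simpa using add_mem hr hs
  · simpa [hg.2] using mul_mem hp hq
  · simpa [hh.2] using mul_mem hp' hq'

/-- Dividing the generators by square roots `l, m` of their determinants makes the determinants `1`
and the squares of the three traces integers in `[0, 4]`. Fricke's argument then gives `ℚ(√D) ⊆
ℚ(√2, √3)`, a contradiction. -/
theorem adjointTraceField_ne_of_hasExponents {g h : G} (hgen : Subgroup.closure {g, h} = ⊤)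
    {p q p' q' r s : ℚ} (hg : HasExponents ρ g p q) (hh : HasExponents ρ h p' q')
    (hgh : HasExponents ρ (g * h) r s) {D : ℤ} (hodd : Odd D) (hD : Squarefree D) (h7 : 7 ≤ D) :
    adjointTraceField ρ ≠ IntermediateField.adjoin ℚ {((Real.sqrt (D : ℝ) : ℝ) : ℂ)} := by
  intro hF
  obtain ⟨i, hi0, hi4, hi⟩ := hg.exists_int hdim hodd hD h7 hF
  obtain ⟨j, hj0, hj4, hj⟩ := hh.exists_int hdim hodd hD h7 hF
  obtain ⟨k, hk0, hk4, hk⟩ := hgh.exists_int hdim hodd hD h7 hF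
  have dg : LinearMap.det (ρ g) ≠ 0 :=
    hg.2 ▸ mul_ne_zero (expTwoPi_ne_zero p) (expTwoPi_ne_zero q)
  have dh : LinearMap.det (ρ h) ≠ 0 :=
    hh.2 ▸ mul_ne_zero (expTwoPi_ne_zero p') (expTwoPi_ne_zero q')
  obtain ⟨l, hl⟩ := IsAlgClosed.exists_pow_nat_eq (LinearMap.det (ρ g)) two_pos
  obtain ⟨m, hm⟩ := IsAlgClosed.exists_pow_nat_eq (LinearMap.det (ρ h)) two_pos
  have hl0 : l ≠ 0 := fun h0 => dg (by rw [← hl, h0]; simp)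
  have hm0 : m ≠ 0 := fun h0 => dh (by rw [← hm, h0]; simp)
  rw [div_eq_inv_mul] at hi hj hk
  have hle : adjointTraceField ρ ≤ sqrtField := by
    apply adjointTraceField_le ρ hdim hgen hl0 hm0
    · exact mem_sqrtField_of_sq hi0 hi4 (by rw [mul_pow, inv_pow, hl, hi])
    · exact mem_sqrtField_of_sq hj0 hj4 (by rw [mul_pow, inv_pow, hm, hj])
    · refine mem_sqrtField_of_sq hk0 hk4 ?_
      rw [mul_pow, inv_pow, mul_pow, hl, hm, ← map_mul, ← map_mul, hk]
    · rw [hl, inv_mul_cancel₀ dg]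
      exact one_mem _
    · rw [hm, inv_mul_cancel₀ dh]
      exact one_mem _
  rw [hF] at hle
  refine sqrt_not_mem_sqrtField hodd hD h7 ?_ (hle (IntermediateField.mem_adjoin_simple_self _ _))
  rw [← Complex.ofReal_pow, Real.sq_sqrt (by exact_mod_cast (by linarith : (0 : ℤ) ≤ D))]
  simp

end Rank

/-! ### The exponents of the hypergeometric monodromy group -/

section Generators

variable {a₁ a₂ b₁ : ℚ} {x₀ : Base} (d : Path.Homotopic.Quotient x₀ midPt)

theorem closure_loopZero_loopOne :
    Subgroup.closure {loopZero d, (loopOne d)⁻¹} = ⊤ := by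
  refine subgroup_eq_top_of_realLoop_mem d _ (x := -1 / 2) (y := 3 / 2) (by norm_num)
    (by norm_num) (Subgroup.subset_closure (by simp)) (inv_mem_iff.1 (Subgroup.subset_closure ?_))
  exact Or.inr rfl

variable (hdim : Module.finrank ℂ (solSpace [a₁, a₂] [b₁, 1] x₀) = 2)

include hdim

theorem hasExponents_loopZero [FiniteDimensional ℂ (solSpace [a₁, a₂] [b₁, 1] x₀)] :
    HasExponents (monodromy [a₁, a₂] [b₁, 1] x₀) (loopZero d) 0 (-b₁) := by
  obtain ⟨h1, h2⟩ := monodromy_loopZero d hdim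
  refine hasExponents_of_eigenvector hdim (h2.trans ?_) (by simpa [expTwoPi] using h1)
  rw [← expTwoPi_add, expTwoPi, mul_sub, mul_one, sub_eq_add_neg, add_comm,
    Complex.exp_periodic]
  push_cast
  ring_nf

theorem hasExponents_loopOne_inv [FiniteDimensional ℂ (solSpace [a₁, a₂] [b₁, 1] x₀)] :
    HasExponents (monodromy [a₁, a₂] [b₁, 1] x₀) (loopOne d)⁻¹ 0 (b₁ - a₁ - a₂) := by
  obtain ⟨h1, h2⟩ := monodromy_loopOne d hdim
  refine hasExponents_of_eigenvector hdim (h2.trans ?_) (by simpa [expTwoPi] using h1)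
  rw [← expTwoPi_add, expTwoPi, zero_add]
  push_cast
  rfl

/-- The product of the two generators is the inverse of the loop around `∞`, hence the negated
exponents. -/
theorem hasExponents_loopZero_mul_loopOne_inv
    [FiniteDimensional ℂ (solSpace [a₁, a₂] [b₁, 1] x₀)] :
    HasExponents (monodromy [a₁, a₂] [b₁, 1] x₀) (loopZero d * (loopOne d)⁻¹) (-a₁) (-a₂) := by
  obtain ⟨h1, h2⟩ := monodromy_loopInfty d hdim
  have h := HasExponents.inv hdim (hasExponents_of_eigenvector hdim (p := a₁) (q := a₂)
    (h2.trans (by rw [← expTwoPi_add, expTwoPi]; push_cast; rfl)) h1)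
  rwa [mul_inv_rev, inv_inv] at h

end Generators

end HypLocSys

end

theorem proposition2p6 (a₁ a₂ b₁ : ℚ) (x₀ : HypLocSys.Base)
    (hirr : (HypLocSys.monodromy [a₁, a₂] [b₁, 1] x₀).IsIrreducible) :
    (∃ n : ℕ, 0 < n ∧
      HypLocSys.adjointTraceField (HypLocSys.monodromy [a₁, a₂] [b₁, 1] x₀) ≤
        IntermediateField.adjoin ℚ {Complex.exp (2 * Real.pi * Complex.I / n)}) ∧
    (∀ D : ℤ, Odd D → Squarefree D → 7 ≤ D →
      HypLocSys.adjointTraceField (HypLocSys.monodromy [a₁, a₂] [b₁, 1] x₀) ≠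
        IntermediateField.adjoin ℚ {((Real.sqrt (D : ℝ) : ℝ) : ℂ)}) := by
  obtain ⟨d⟩ := HypLocSys.exists_path_to_midPt x₀
  have hy : (HypLocSys.chartZero a₁ a₂ b₁).map HypLocSys.baseHalf = HypLocSys.midPt :=
    Subtype.ext HypLocSys.exp_baseHalf
  have hc : Path.Homotopic.Quotient x₀
      ((HypLocSys.chartZero a₁ a₂ b₁).map HypLocSys.baseHalf) := hy ▸ d
  have := (HypLocSys.chartZero a₁ a₂ b₁).finiteDimensional HypLocSys.baseHalf hc
  have hle := (HypLocSys.chartZero a₁ a₂ b₁).finrank_le_two HypLocSys.baseHalf hc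
  -- The bound on the dimension suffices: in dimension at most 1 the field is `ℚ`, which does not
  -- contain `√D`.
  rcases Nat.le_or_eq_of_le_succ hle with h1 | hdim
  · rw [HypLocSys.adjointTraceField_eq_bot_of_finrank_le_one _ h1]
    refine ⟨⟨1, one_pos, bot_le⟩, fun D _ hD h7 h => ?_⟩
    have h2 := IntermediateField.mem_adjoin_simple_self ℚ ((Real.sqrt (D : ℝ) : ℝ) : ℂ)
    rw [← h, IntermediateField.mem_bot] at h2
    obtain ⟨t, ht⟩ := h2
    refine HypLocSys.sqrt_ne_rat hD h7 ?_ t ht.symm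
    rw [← Complex.ofReal_pow, Real.sq_sqrt (by exact_mod_cast (by linarith : (0 : ℤ) ≤ D))]
    simp
  have hgen := HypLocSys.closure_loopZero_loopOne d
  have hg := HypLocSys.hasExponents_loopZero d hdim
  have hh := HypLocSys.hasExponents_loopOne_inv d hdim
  have hgh := HypLocSys.hasExponents_loopZero_mul_loopOne_inv d hdim
  -- This `n` is a common multiple of the denominators, so all six eigenvalues lie in `ℚ(e(1/n))`.
  refine ⟨⟨a₁.den * a₂.den * b₁.den, by positivity, ?_⟩, fun D hodd hD h7 =>
    HypLocSys.adjointTraceField_ne_of_hasExponents hdim hgen hg hh hgh hodd hD h7⟩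
  have hn : 0 < a₁.den * a₂.den * b₁.den := by positivity
  have m1 := HypLocSys.expTwoPi_mem_adjoin hn (q := -a₁)
    ((Dvd.intro _ rfl).mul_right _)
  have m2 := HypLocSys.expTwoPi_mem_adjoin hn (q := -a₂)
    ((Dvd.intro_left _ rfl).mul_right _)
  have m3 := HypLocSys.expTwoPi_mem_adjoin hn (q := -b₁) (Dvd.intro_left _ rfl)
  have m0 := HypLocSys.expTwoPi_mem_adjoin hn (q := 0) (one_dvd _)
  refine HypLocSys.adjointTraceField_le_of_hasExponents hdim hgen hg hh hgh m0 m3 m0 ?_ m1 m2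
  rw [sub_eq_add_neg, sub_eq_add_neg, HypLocSys.expTwoPi_add, HypLocSys.expTwoPi_add]
  rw [HypLocSys.expTwoPi_neg] at m3
  exact mul_mem (mul_mem (inv_mem_iff.1 m3) m1) m2
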